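/- Let $\Pi : G=\widetilde{SL(2,\mathbb R)}\to SL(2,\mathbb R)$ be the universal covering group, $Z(G)$ its center, and for $g\in G$ write $\operatorname{tr} g=\operatorname{tr}\Pi(g)$ and $T_2=\{g\in G:\operatorname{tr} g=2\}$. Let $G_0\subset G$ be the open set of those $g$ for which the variation of the argument from $e_2$ to $g e_2$, along a path in $G$ from $I$ to $g$, is negative. For an integer $p\ge 0$ let $H^p(\mathbb S^1)$ be the Sobolev space of real $2\pi$-periodic functions, that is, of functions $q$ on $[0,2\pi]$ with $q^{(p)}\in L^2([0,2\pi])$ and $q^{(j)}(0)=q^{(j)}(2\pi)$ for $0\le j<p$. For $q\in H^p(\mathbb S^1)$ let $\Phi:[0,2\pi]\to SL(2,\mathbb R)$ be the fundamental matrix of $-v''+qv=0$, i.e. $\Phi(0)=I$, $\Phi'=\begin{pmatrix}0&1\\ q&0\end{pmatrix}\Phi$, let $\tilde\Phi:[0,2\pi]\to G$ be its continuous lift with $\tilde\Phi(0)=I$, and let $\mu(q)=\tilde\Phi(2\pi)\in G$ be the monodromy of $q$. Let $\mathbb H$ be the infinite-dimensional separable real Hilbert space, and for $j=0,1,2$ let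 $$\mathcal C_j=\{q\in H^p(\mathbb S^1):\dim\ker(-d^2/dt^2+q : H^{p+2}(\mathbb S^1)\to H^p(\mathbb S^1))\ge j\}.$$ Let $p$ be an integer, $p>0$. Then: 1. There is a smooth diffeomorphism $\Psi: G_0\times\mathbb H\to H^p(\mathbb S^1)$ such that $\mu(\Psi(g,h))=g$ for all $(g,h)\in G_0\times\mathbb H$. 2. Every such $\Psi$ is a diffeomorphism from the triple $(G_0,\;T_2\cap G_0,\;Z(G)\cap T_2\cap G_0)\times\mathbb H$ onto $(\mathcal C_0,\mathcal C_1,\mathcal C_2)$, i.e. $\Psi(G_0\times\mathbb H)=\mathcal C_0$, $\Psi((T_2\cap G_0)\times\mathbb H)=\mathcal C_1$ and $\Psi((Z(G)\cap T_2\cap G_0)\times\mathbb H)=\mathcal C_2$. 3. There is a smooth diffeomorphism $\mathbb R^3\times\mathbb H\to H^p(\mathbb S^1)$ mapping $\Sigma\times\mathbb H$ onto $\mathcal C_1$, where $\Sigma\subset\mathbb R^3$ is the union of the plane $z=0$ and of the cones $x^2+y^2=\tan^2 z$, $2\pi n-\frac{\pi}{2}<z<2\pi n+\frac{\pi}{2}$,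 for the integers $n>0$. -/

import Mathlib

open MeasureTheory Set
open scoped Manifold ContDiff MatrixGroups

noncomputable section

/-! ### Periodic Sobolev spaces -/

/-- Lebesgue measure on `[0, 2π]`. -/
abbrev circleMeasure : Measure ℝ := volume.restrict (Icc 0 (2 * Real.pi))

/-- The space `L²([0, 2π])` of real functions. -/
abbrev L2Circle : Type := Lp ℝ 2 circleMeasure

theorem L2Circle.intervalIntegrable (u : L2Circle) {a b : ℝ} (ha : a ∈ Icc 0 (2 * Real.pi))
    (hb : b ∈ Icc 0 (2 * Real.pi)) : IntervalIntegrable (u : ℝ → ℝ) volume a b := by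
  have h : Integrable (u : ℝ → ℝ) circleMeasure :=
    (Lp.memLp u).integrable (by norm_num)
  have h' : IntegrableOn (u : ℝ → ℝ) (Icc 0 (2 * Real.pi)) volume := h
  refine (h'.mono_set ?_).intervalIntegrable
  exact uIcc_subset_Icc ha hb

theorem L2Circle.integral_congr {u v : ℝ → ℝ} (h : u =ᵐ[circleMeasure] v) {b : ℝ}
    (hb : b ∈ Icc 0 (2 * Real.pi)) : ∫ s in (0 : ℝ)..b, u s = ∫ s in (0 : ℝ)..b, v s := by
  rw [Filter.EventuallyEq, ae_restrict_iff' measurableSet_Icc] at h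
  refine intervalIntegral.integral_congr_ae ?_
  filter_upwards [h] with x hx hxb
  rw [uIoc_of_le hb.1] at hxb
  exact hx ⟨hxb.1.le, hxb.2.trans hb.2⟩

theorem two_pi_mem : 2 * Real.pi ∈ Icc 0 (2 * Real.pi) :=
  ⟨by positivity, le_rfl⟩

/-- `v` is the derivative of `u` on the circle `ℝ / 2πℤ`: the function `u` agrees almost everywhere
on `[0, 2π]` with the absolutely continuous function `t ↦ c + ∫₀ᵗ v`, which takes the same
value at `0` and at `2π`. -/
def IsPeriodicDeriv (u v : L2Circle) : Prop :=
  (∃ c : ℝ, (u : ℝ → ℝ) =ᵐ[circleMeasure] fun t => c + ∫ s in (0 : ℝ)..t, v s) ∧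
    ∫ s in (0 : ℝ)..(2 * Real.pi), v s = 0

/-- The periodic Sobolev space `H^p(𝕊¹)`. An element `u` is the tuple `(u, u', …, u⁽ᵖ⁾)` of the
function and its derivatives in `L²([0, 2π])`, with `u⁽ʲ⁾(0) = u⁽ʲ⁾(2π)` for `j < p`; the norm is
`‖u‖² = ∑_{j ≤ p} ‖u⁽ʲ⁾‖²`. -/
def sobolevCircle (p : ℕ) : Submodule ℝ (PiLp 2 fun _ : Fin (p + 1) => L2Circle) where
  carrier := {u | ∀ j : Fin p, IsPeriodicDeriv (u j.castSucc) (u j.succ)}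
  zero_mem' := by
    intro j
    have h0 : ((0 : L2Circle) : ℝ → ℝ) =ᵐ[circleMeasure] 0 := Lp.coeFn_zero _ _ _
    refine ⟨⟨0, ?_⟩, ?_⟩
    · filter_upwards [h0, ae_restrict_mem measurableSet_Icc] with t ht htm
      have := L2Circle.integral_congr h0 htm
      simp only [PiLp.zero_apply, ht, this]
      simp
    · have := L2Circle.integral_congr h0 two_pi_mem
      simp only [PiLp.zero_apply, this]
      simp
  add_mem' := by
    intro u v hu hv j
    obtain ⟨⟨c, hc⟩, hc0⟩ := hu j
    obtain ⟨⟨d, hd⟩, hd0⟩ := hv j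
    have key : ∀ t ∈ Icc 0 (2 * Real.pi), ∫ s in (0 : ℝ)..t, (u j.succ + v j.succ : L2Circle) s =
        (∫ s in (0 : ℝ)..t, u j.succ s) + ∫ s in (0 : ℝ)..t, v j.succ s := by
      intro t ht
      have h0 : (0 : ℝ) ∈ Icc 0 (2 * Real.pi) := ⟨le_rfl, by positivity⟩
      rw [L2Circle.integral_congr (Lp.coeFn_add (u j.succ) (v j.succ)) ht]
      exact intervalIntegral.integral_add (L2Circle.intervalIntegrable _ h0 ht)
        (L2Circle.intervalIntegrable _ h0 ht)
    refine ⟨⟨c + d, ?_⟩, ?_⟩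
    · filter_upwards [hc, hd, Lp.coeFn_add (u j.castSucc) (v j.castSucc),
        ae_restrict_mem measurableSet_Icc] with t h1 h2 h3 ht
      simp only [PiLp.add_apply] at *
      rw [h3, key t ht, Pi.add_apply, h1, h2]
      ring
    · simp only [PiLp.add_apply] at *
      rw [key _ two_pi_mem, hc0, hd0, add_zero]
  smul_mem' := by
    intro a u hu j
    obtain ⟨⟨c, hc⟩, hc0⟩ := hu j
    have key : ∀ t ∈ Icc 0 (2 * Real.pi), ∫ s in (0 : ℝ)..t, (a • u j.succ : L2Circle) s =
        a * ∫ s in (0 : ℝ)..t, u j.succ s := by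
      intro t ht
      rw [L2Circle.integral_congr (Lp.coeFn_smul a (u j.succ)) ht]
      simp
    refine ⟨⟨a * c, ?_⟩, ?_⟩
    · filter_upwards [hc, Lp.coeFn_smul a (u j.castSucc),
        ae_restrict_mem measurableSet_Icc] with t h1 h3 ht
      simp only [PiLp.smul_apply] at *
      rw [h3, key t ht, Pi.smul_apply, h1, smul_eq_mul]
      ring
    · simp only [PiLp.smul_apply] at *
      rw [key _ two_pi_mem, hc0, mul_zero]

theorem aeEqFun_mul_add (f g h : ℝ →ₘ[circleMeasure] ℝ) : f * (g + h) = f * g + f * h := by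
  induction f using AEEqFun.induction_on with | _ f hf
  induction g using AEEqFun.induction_on with | _ g hg
  induction h using AEEqFun.induction_on with | _ h hh
  simp only [AEEqFun.mk_add_mk, AEEqFun.mk_mul_mk, mul_add]

theorem aeEqFun_mul_smul (a : ℝ) (f g : ℝ →ₘ[circleMeasure] ℝ) : f * (a • g) = a • (f * g) := by
  induction f using AEEqFun.induction_on with | _ f hf
  induction g using AEEqFun.induction_on with | _ g hg
  simp only [AEEqFun.mk_mul_mk, AEEqFun.smul_mk, mul_smul_comm]

/-- The Sturm-Liouville operator `L_p(q) v = -v'' + q v` on `H^{p+2}(𝕊¹)`. Its values, which lie in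
`H^p(𝕊¹)`, are regarded as measurable functions on `[0, 2π]` modulo a.e. equality. -/
def sturmLiouville (p : ℕ) (q : sobolevCircle p) :
    sobolevCircle (p + 2) →ₗ[ℝ] (ℝ →ₘ[circleMeasure] ℝ) where
  toFun v := -((v.1 2 : L2Circle) : ℝ →ₘ[circleMeasure] ℝ) +
    ((q.1 0 : L2Circle) : ℝ →ₘ[circleMeasure] ℝ) * ((v.1 0 : L2Circle) : ℝ →ₘ[circleMeasure] ℝ)
  map_add' v w := by
    change -((v.1 2).1 + (w.1 2).1) + (q.1 0).1 * ((v.1 0).1 + (w.1 0).1) =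
      (-(v.1 2).1 + (q.1 0).1 * (v.1 0).1) + (-(w.1 2).1 + (q.1 0).1 * (w.1 0).1)
    rw [aeEqFun_mul_add, neg_add]
    abel
  map_smul' a v := by
    change -(a • (v.1 2).1) + (q.1 0).1 * (a • (v.1 0).1) =
      a • (-(v.1 2).1 + (q.1 0).1 * (v.1 0).1)
    rw [smul_add, smul_neg, aeEqFun_mul_smul]

/-- The set `C_j` of potentials `q ∈ H^p(𝕊¹)` with `dim ker L_p(q) ≥ j`. -/
def kernelStratum (p j : ℕ) : Set (sobolevCircle p) :=
  {q | (j : Cardinal) ≤ Module.rank ℝ (LinearMap.ker (sturmLiouville p q))}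

/-! ### The universal cover of `SL(2, ℝ)` -/

/-- The unit vector of argument `x`. -/
def unitVec (x : ℝ) : Fin 2 → ℝ := ![Real.cos x, Real.sin x]

/-- `f` lifts to arguments of vectors the action of `A` on directions of the plane: `A` maps the
unit vector of argument `x` to a positive multiple of the unit vector of argument `f x`. -/
def IsAngleLift (A : SL(2, ℝ)) (f : ℝ → ℝ) : Prop :=
  ∀ x, ∃ r : ℝ, 0 < r ∧ A.1.mulVec (unitVec x) = r • unitVec (f x)

/-- The pairs `(A, f)` of a matrix `A ∈ SL(2, ℝ)` and a continuous lift `f : ℝ → ℝ` of its action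
on the circle of directions. -/
def liftSubgroup : Subgroup (SL(2, ℝ) × (ℝ ≃ₜ ℝ)) where
  carrier := {g | IsAngleLift g.1 g.2}
  one_mem' := fun x => ⟨1, one_pos, by simp⟩
  mul_mem' := by
    intro g h hg hh x
    obtain ⟨r, hr, e⟩ := hh x
    obtain ⟨s, hs, e'⟩ := hg (h.2 x)
    refine ⟨r * s, mul_pos hr hs, ?_⟩
    change (g.1 * h.1).1.mulVec (unitVec x) = (r * s) • unitVec (g.2 (h.2 x))
    rw [Matrix.SpecialLinearGroup.coe_mul, ← Matrix.mulVec_mulVec, e, Matrix.mulVec_smul, e',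
      smul_smul]
  inv_mem' := by
    intro g hg x
    obtain ⟨r, hr, e⟩ := hg (g.2.symm x)
    refine ⟨r⁻¹, inv_pos.2 hr, ?_⟩
    change (g.1⁻¹).1.mulVec (unitVec x) = r⁻¹ • unitVec (g.2.symm x)
    rw [Homeomorph.apply_symm_apply] at e
    have h1 : (g.1⁻¹).1.mulVec (g.1.1.mulVec (unitVec (g.2.symm x))) = unitVec (g.2.symm x) := by
      rw [Matrix.mulVec_mulVec, ← Matrix.SpecialLinearGroup.coe_mul, inv_mul_cancel]
      simp
    rw [e, Matrix.mulVec_smul] at h1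
    rw [← h1, smul_smul, inv_mul_cancel₀ hr.ne', one_smul]

/-- The universal cover `G` of `SL(2, ℝ)`, realized as the group of pairs `(A, f)` of a matrix and
a continuous lift of its action on the circle of directions. -/
def CoverSL2 : Type := liftSubgroup

namespace CoverSL2

instance : Group CoverSL2 := inferInstanceAs (Group liftSubgroup)

/-- The covering homomorphism `Π : G → SL(2, ℝ)`. -/
def proj : CoverSL2 →* SL(2, ℝ) := (MonoidHom.fst _ _).comp liftSubgroup.subtype

/-- The action of `g ∈ G` on arguments of vectors: `g.lift x - x` is the variation of the argument
from `v` to `g v` along a path from the identity to `g`, if `v` has argument `x`. -/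
def lift (g : CoverSL2) : ℝ ≃ₜ ℝ := g.1.2

theorem isAngleLift (g : CoverSL2) : IsAngleLift (proj g) (lift g) := g.2

/-- The topology of `G` as a covering space of `SL(2, ℝ)`: sheets over a given matrix are
distinguished by the value at `π / 2` of the lifted action, that is, by the variation of the
argument of the vector `e₂`. -/
instance : TopologicalSpace CoverSL2 :=
  TopologicalSpace.induced (fun g => (proj g, lift g (Real.pi / 2))) inferInstance

theorem continuous_pair :
    Continuous fun g : CoverSL2 => (proj g, lift g (Real.pi / 2)) :=
  continuous_induced_dom

theorem continuous_proj : Continuous fun g : CoverSL2 => proj g := by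
  have h := continuous_fst.comp continuous_pair
  exact h

theorem continuous_lift : Continuous fun g => lift g (Real.pi / 2) :=
  continuous_snd.comp continuous_pair

/-- The open half-space `G₀ ⊂ G` of those `g` for which the variation of the argument from `e₂`
to `g e₂` is negative. -/
def G₀ : TopologicalSpace.Opens CoverSL2 where
  carrier := {g | lift g (Real.pi / 2) < Real.pi / 2}
  is_open' := isOpen_lt continuous_lift continuous_const

/-- The level set `T_c` of the trace function on `G`. -/
def traceLevel (c : ℝ) : Set CoverSL2 := {g | (proj g).1.trace = c}

theorem exists_int_of_unitVec {r s x y : ℝ} (hr : 0 < r) (hs : 0 < s)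
    (h : r • unitVec x = s • unitVec y) : ∃ k : ℤ, x - y = k * (2 * Real.pi) := by
  have h0 : r * Real.cos x = s * Real.cos y := by simpa [unitVec] using congrFun h 0
  have h1 : r * Real.sin x = s * Real.sin y := by simpa [unitVec] using congrFun h 1
  have hrs : r ^ 2 = s ^ 2 := by
    have e1 : r ^ 2 = (r * Real.cos x) ^ 2 + (r * Real.sin x) ^ 2 := by
      linear_combination r ^ 2 * -(Real.sin_sq_add_cos_sq x)
    rw [e1, h0, h1]
    linear_combination s ^ 2 * (Real.sin_sq_add_cos_sq y)
  have hrs' : r = s := by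
    rcases sq_eq_sq_iff_eq_or_eq_neg.1 hrs with h | h
    · exact h
    · linarith
  subst hrs'
  have c0 := mul_left_cancel₀ hr.ne' h0
  have c1 := mul_left_cancel₀ hr.ne' h1
  have hc : Real.cos (x - y) = 1 := by
    rw [Real.cos_sub, c0, c1]
    nlinarith [Real.sin_sq_add_cos_sq y]
  obtain ⟨k, hk⟩ := (Real.cos_eq_one_iff _).1 hc
  exact ⟨k, hk.symm⟩

theorem ext_of_eq {g h : CoverSL2} (h1 : proj g = proj h)
    (h2 : lift g (Real.pi / 2) = lift h (Real.pi / 2)) : g = h := by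
  have hk : ∀ x, ∃ k : ℤ, lift g x - lift h x = k * (2 * Real.pi) := by
    intro x
    obtain ⟨r, hr, e⟩ := isAngleLift g x
    obtain ⟨s, hs, e'⟩ := isAngleLift h x
    rw [h1, e'] at e
    exact exists_int_of_unitVec hr hs e.symm
  choose k hk using hk
  have hc : Continuous fun x => (lift g x - lift h x) / (2 * Real.pi) :=
    ((lift g).continuous.sub (lift h).continuous).div_const _
  have hki : ∀ x, (lift g x - lift h x) / (2 * Real.pi) = k x := by
    intro x
    rw [hk, mul_div_assoc, div_self (by positivity), mul_one]
  have hkc : Continuous k := by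
    rw [Int.isClosedEmbedding_coe_real.isInducing.continuous_iff]
    exact hc.congr hki
  have hconst : ∀ x, k x = k (Real.pi / 2) := fun x =>
    PreconnectedSpace.constant inferInstance hkc
  have h0 : (k (Real.pi / 2) : ℝ) = 0 := by
    rw [← hki, h2]
    simp
  have hl : lift g = lift h := by
    ext x
    have := hk x
    rw [hconst x, h0, zero_mul] at this
    linarith
  exact Subtype.ext (Prod.ext h1 hl)

/-! #### Iwasawa coordinates -/

/-- The vector `A uₓ`, rotated by the angle `-x`, as a complex number. -/
def turn (A : SL(2, ℝ)) (x : ℝ) : ℂ :=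
  ⟨(A 0 0 * Real.cos x + A 0 1 * Real.sin x) * Real.cos x +
      (A 1 0 * Real.cos x + A 1 1 * Real.sin x) * Real.sin x,
    (A 1 0 * Real.cos x + A 1 1 * Real.sin x) * Real.cos x -
      (A 0 0 * Real.cos x + A 0 1 * Real.sin x) * Real.sin x⟩

/-- The lifted action of a lower triangular matrix with positive diagonal. -/
def lowFun (A : SL(2, ℝ)) (x : ℝ) : ℝ := x + (turn A x).arg

theorem turn_mem {A : SL(2, ℝ)} (h : A 0 1 = 0) (h0 : 0 < A 0 0) (h1 : 0 < A 1 1) (x : ℝ) :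
    turn A x ∈ Complex.slitPlane := by
  rw [Complex.mem_slitPlane_iff]
  by_contra hcon
  push Not at hcon
  obtain ⟨hre, him⟩ := hcon
  simp only [turn, h, zero_mul, add_zero] at hre him
  have hsc := Real.sin_sq_add_cos_sq x
  by_cases hc : Real.cos x = 0
  · simp only [hc, mul_zero, zero_add] at hre hsc
    nlinarith
  · have e : A 1 0 * Real.cos x + A 1 1 * Real.sin x = A 0 0 * Real.sin x := by
      apply mul_right_cancel₀ hc
      linear_combination him
    rw [e] at hre
    nlinarith

theorem lowFun_continuous {A : SL(2, ℝ)} (h : A 0 1 = 0) (h0 : 0 < A 0 0) (h1 : 0 < A 1 1) :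
    Continuous (lowFun A) := by
  have ht : Continuous (turn A) := by
    have : turn A = fun x => Complex.equivRealProdCLM.symm ((turn A x).re, (turn A x).im) := by
      funext x
      apply Complex.ext <;> simp
    rw [this]
    refine Complex.equivRealProdCLM.symm.continuous.comp (Continuous.prodMk ?_ ?_)
    · simp only [turn]
      fun_prop
    · simp only [turn]
      fun_prop
  refine continuous_id.add (continuous_iff_continuousAt.2 fun x => ?_)
  exact (Complex.continuousAt_arg (turn_mem h h0 h1 x)).comp ht.continuousAt

theorem lowFun_isAngleLift {A : SL(2, ℝ)} (h : A 0 1 = 0) (h0 : 0 < A 0 0) (h1 : 0 < A 1 1) :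
    IsAngleLift A (lowFun A) := by
  intro x
  have hne := Complex.slitPlane_ne_zero (turn_mem h h0 h1 x)
  refine ⟨‖turn A x‖, norm_pos_iff.2 hne, ?_⟩
  have hre : ‖turn A x‖ * Real.cos (turn A x).arg = (turn A x).re := Complex.norm_mul_cos_arg _
  have him : ‖turn A x‖ * Real.sin (turn A x).arg = (turn A x).im := Complex.norm_mul_sin_arg _
  have hsc := Real.sin_sq_add_cos_sq x
  funext i
  fin_cases i
  · simp only [unitVec, lowFun, Matrix.mulVec, dotProduct, Fin.sum_univ_two, Pi.smul_apply,
      smul_eq_mul, Real.cos_add]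
    simp only [turn] at hre him ⊢
    simp
    linear_combination (-(Real.cos x)) * hre + Real.sin x * him -
      (A 0 0 * Real.cos x + A 0 1 * Real.sin x) * hsc
  · simp only [unitVec, lowFun, Matrix.mulVec, dotProduct, Fin.sum_univ_two, Pi.smul_apply,
      smul_eq_mul, Real.sin_add]
    simp only [turn] at hre him ⊢
    simp
    linear_combination (-(Real.sin x)) * hre - Real.cos x * him -
      (A 1 0 * Real.cos x + A 1 1 * Real.sin x) * hsc

theorem lowFun_inv {A B : SL(2, ℝ)} (hA : A 0 1 = 0) (hA0 : 0 < A 0 0) (hA1 : 0 < A 1 1)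
    (hB : B 0 1 = 0) (hB0 : 0 < B 0 0) (hB1 : 0 < B 1 1) (hBA : B * A = 1) (x : ℝ) :
    lowFun B (lowFun A x) = x := by
  obtain ⟨r, hr, e⟩ := lowFun_isAngleLift hA hA0 hA1 x
  obtain ⟨s, hs, e'⟩ := lowFun_isAngleLift hB hB0 hB1 (lowFun A x)
  have h1 : B.1.mulVec (A.1.mulVec (unitVec x)) = unitVec x := by
    rw [Matrix.mulVec_mulVec, ← Matrix.SpecialLinearGroup.coe_mul, hBA]
    simp
  rw [e, Matrix.mulVec_smul, e', smul_smul] at h1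
  obtain ⟨k, hk⟩ := exists_int_of_unitVec (y := x) (mul_pos hr hs) one_pos (by rw [h1, one_smul])
  have b1 : |(turn A x).arg| < Real.pi := lt_of_le_of_ne (Complex.abs_arg_le_pi _) fun h => by
    have := Complex.mem_slitPlane_iff_arg.1 (turn_mem hA hA0 hA1 x)
    rcases abs_eq Real.pi_pos.le |>.1 h with h | h
    · exact this.1 h
    · linarith [Complex.neg_pi_lt_arg (turn A x)]
  have b2 : |(turn B (lowFun A x)).arg| < Real.pi :=
    lt_of_le_of_ne (Complex.abs_arg_le_pi _) fun h => by
      have := Complex.mem_slitPlane_iff_arg.1 (turn_mem hB hB0 hB1 (lowFun A x))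
      rcases abs_eq Real.pi_pos.le |>.1 h with h | h
      · exact this.1 h
      · linarith [Complex.neg_pi_lt_arg (turn B (lowFun A x))]
  have e2 : lowFun B (lowFun A x) - x = (turn A x).arg + (turn B (lowFun A x)).arg := by
    unfold lowFun
    ring
  have hk0 : k = 0 := by
    rw [abs_lt] at b1 b2
    have p := Real.pi_pos
    have k1 : (k : ℝ) < 1 := by
      by_contra hc
      push Not at hc
      nlinarith
    have k2 : (-1 : ℝ) < k := by
      by_contra hc
      push Not at hc
      nlinarith
    have k1' : k < 1 := by exact_mod_cast k1
    have k2' : -1 < k := by exact_mod_cast k2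
    omega
  rw [hk0] at hk
  simp at hk
  linarith

/-- The lower triangular matrix `diag(√ρ, 1/√ρ) (1, 0; ν/2, 1)` with `ρ = exp s`. -/
def lowMatrix (s ν : ℝ) : SL(2, ℝ) :=
  ⟨!![Real.exp (s / 2), 0; Real.exp (-(s / 2)) * (ν / 2), Real.exp (-(s / 2))], by
    rw [Matrix.det_fin_two_of, ← Real.exp_add]
    simp⟩

/-- The rotation `(cos θ, sin θ; -sin θ, cos θ)`. -/
def rotMatrix (θ : ℝ) : SL(2, ℝ) :=
  ⟨!![Real.cos θ, Real.sin θ; -Real.sin θ, Real.cos θ], by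
    rw [Matrix.det_fin_two_of]
    nlinarith [Real.sin_sq_add_cos_sq θ]⟩

theorem lowMatrix_zero_one (s ν : ℝ) : lowMatrix s ν 0 1 = 0 := rfl

theorem lowMatrix_zero_zero (s ν : ℝ) : 0 < lowMatrix s ν 0 0 := Real.exp_pos _

theorem lowMatrix_one_one (s ν : ℝ) : 0 < lowMatrix s ν 1 1 := Real.exp_pos _

theorem lowMatrix_mul (s ν : ℝ) : lowMatrix (-s) (-(Real.exp (-s) * ν)) * lowMatrix s ν = 1 := by
  have e1 : Real.exp (-(s / 2)) * Real.exp (s / 2) = 1 := by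
    rw [← Real.exp_add]
    simp
  have e2 : Real.exp (-s) = Real.exp (-(s / 2)) * Real.exp (-(s / 2)) := by
    rw [← Real.exp_add]
    congr 1
    ring
  ext i j
  rw [Matrix.SpecialLinearGroup.coe_mul, Matrix.mul_apply, Fin.sum_univ_two]
  fin_cases i <;> fin_cases j <;> simp [lowMatrix, neg_div, e2]
  · linear_combination e1
  · linear_combination -(Real.exp (s / 2) * Real.exp (-(s / 2)) * ν / 2) * e1
  · linear_combination e1

/-- The element of `G` over a lower triangular matrix which fixes the argument of `e₂`. -/
def lowElement (s ν : ℝ) : CoverSL2 :=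
  ⟨(lowMatrix s ν,
    { toFun := lowFun (lowMatrix s ν)
      invFun := lowFun (lowMatrix (-s) (-(Real.exp (-s) * ν)))
      left_inv := lowFun_inv (lowMatrix_zero_one _ _) (lowMatrix_zero_zero _ _)
        (lowMatrix_one_one _ _) (lowMatrix_zero_one _ _) (lowMatrix_zero_zero _ _)
        (lowMatrix_one_one _ _) (lowMatrix_mul s ν)
      right_inv := lowFun_inv (lowMatrix_zero_one _ _) (lowMatrix_zero_zero _ _)
        (lowMatrix_one_one _ _) (lowMatrix_zero_one _ _) (lowMatrix_zero_zero _ _)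
        (lowMatrix_one_one _ _) (mul_eq_one_comm.1 (lowMatrix_mul s ν))
      continuous_toFun := lowFun_continuous (lowMatrix_zero_one _ _) (lowMatrix_zero_zero _ _)
        (lowMatrix_one_one _ _)
      continuous_invFun := lowFun_continuous (lowMatrix_zero_one _ _) (lowMatrix_zero_zero _ _)
        (lowMatrix_one_one _ _) }),
    lowFun_isAngleLift (lowMatrix_zero_one _ _) (lowMatrix_zero_zero _ _)
      (lowMatrix_one_one _ _)⟩

/-- The lift to `G` of the one-parameter group of rotations, which decreases arguments by `θ`. -/
def rotElement (θ : ℝ) : CoverSL2 :=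
  ⟨(rotMatrix θ, Homeomorph.subRight θ), fun x => ⟨1, one_pos, by
    funext i
    fin_cases i
    · simp [rotMatrix, unitVec, Matrix.mulVec, dotProduct, Fin.sum_univ_two, Real.cos_sub]
      ring
    · simp [rotMatrix, unitVec, Matrix.mulVec, dotProduct, Fin.sum_univ_two, Real.sin_sub]
      ring⟩⟩

/-- The left Iwasawa parametrization `φ_L` of `G`, with `ρ = exp s`. -/
def ofIwasawa (z : ℝ × ℝ × ℝ) : CoverSL2 := rotElement z.1 * lowElement z.2.1 z.2.2

theorem proj_ofIwasawa (z : ℝ × ℝ × ℝ) :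
    proj (ofIwasawa z) = rotMatrix z.1 * lowMatrix z.2.1 z.2.2 := rfl

theorem lift_ofIwasawa (z : ℝ × ℝ × ℝ) :
    lift (ofIwasawa z) (Real.pi / 2) = Real.pi / 2 - z.1 := by
  change lowFun (lowMatrix z.2.1 z.2.2) (Real.pi / 2) - z.1 = Real.pi / 2 - z.1
  have : turn (lowMatrix z.2.1 z.2.2) (Real.pi / 2) = (Real.exp (-(z.2.1 / 2)) : ℝ) := by
    apply Complex.ext
    · rw [Complex.ofReal_re]
      simp [turn, lowMatrix]
    · rw [Complex.ofReal_im]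
      simp [turn, lowMatrix]
  rw [lowFun, this, Complex.arg_ofReal_of_nonneg (Real.exp_pos _).le, add_zero]

/-- The left Iwasawa coordinates `(θ, log ρ, ν)` of an element of `G`. -/
def toIwasawa (g : CoverSL2) : ℝ × ℝ × ℝ :=
  (Real.pi / 2 - lift g (Real.pi / 2), -Real.log (proj g 0 1 ^ 2 + proj g 1 1 ^ 2),
    2 * (proj g 0 0 * proj g 0 1 + proj g 1 0 * proj g 1 1) / (proj g 0 1 ^ 2 + proj g 1 1 ^ 2))

theorem sq_pos (A : SL(2, ℝ)) : 0 < A 0 1 ^ 2 + A 1 1 ^ 2 := by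
  have hdet : A 0 0 * A 1 1 - A 0 1 * A 1 0 = 1 := by
    rw [← Matrix.det_fin_two]
    exact A.2
  rcases eq_or_ne (A 0 1) 0 with h | h
  · rcases eq_or_ne (A 1 1) 0 with h' | h'
    · simp [h, h'] at hdet
    · positivity
  · positivity

/-- Left Iwasawa coordinates identify `G` with `ℝ³`. -/
def iwasawa : CoverSL2 ≃ₜ ℝ × ℝ × ℝ where
  toFun := toIwasawa
  invFun := ofIwasawa
  left_inv := by
    intro g
    refine ext_of_eq ?_ ?_
    · rw [proj_ofIwasawa]
      obtain ⟨r, hr, e⟩ := isAngleLift g (Real.pi / 2)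
      have e0 : proj g 0 1 = r * Real.cos (lift g (Real.pi / 2)) := by
        have := congrFun e 0
        simpa [unitVec, Matrix.mulVec, dotProduct, Fin.sum_univ_two] using this
      have e1 : proj g 1 1 = r * Real.sin (lift g (Real.pi / 2)) := by
        have := congrFun e 1
        simpa [unitVec, Matrix.mulVec, dotProduct, Fin.sum_univ_two] using this
      have hdet : proj g 0 0 * proj g 1 1 - proj g 0 1 * proj g 1 0 = 1 := by
        rw [← Matrix.det_fin_two]
        exact (proj g).2
      have hsc := Real.sin_sq_add_cos_sq (lift g (Real.pi / 2))
      have hrr : proj g 0 1 ^ 2 + proj g 1 1 ^ 2 = r ^ 2 := by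
        rw [e0, e1]
        linear_combination r ^ 2 * hsc
      have hlog : Real.log (r ^ 2) / 2 = Real.log r := by
        rw [Real.log_pow]
        push_cast
        ring
      have hx1 : Real.exp (-Real.log (r ^ 2) / 2) = r⁻¹ := by
        rw [neg_div, hlog, Real.exp_neg, Real.exp_log hr]
      have hx2 : Real.exp (-(-Real.log (r ^ 2) / 2)) = r := by
        rw [neg_div, neg_neg, hlog, Real.exp_log hr]
      have hcoef : toIwasawa g = (Real.pi / 2 - lift g (Real.pi / 2), -Real.log (r ^ 2),
          2 * (proj g 0 0 * proj g 0 1 + proj g 1 0 * proj g 1 1) /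
            (proj g 0 1 ^ 2 + proj g 1 1 ^ 2)) := by
        rw [← hrr]
        rfl
      generalize proj g = A at *
      have hdet' : A 0 0 * Real.sin (lift g (Real.pi / 2)) -
          A 1 0 * Real.cos (lift g (Real.pi / 2)) = r⁻¹ := by
        apply eq_inv_of_mul_eq_one_left
        rw [e0, e1] at hdet
        linear_combination hdet
      have hν : 2 * (A 0 0 * A 0 1 + A 1 0 * A 1 1) / (A 0 1 ^ 2 + A 1 1 ^ 2) / 2 =
          (A 0 0 * Real.cos (lift g (Real.pi / 2)) + A 1 0 * Real.sin (lift g (Real.pi / 2))) *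
            r⁻¹ := by
        rw [hrr, e0, e1]
        field_simp
      ext i j
      rw [Matrix.SpecialLinearGroup.coe_mul, Matrix.mul_apply, Fin.sum_univ_two, hcoef]
      fin_cases i <;> fin_cases j <;>
        simp only [rotMatrix, lowMatrix, hx1, hx2, hν, Real.cos_pi_div_two_sub,
          Real.sin_pi_div_two_sub] <;> simp
      · rw [← hdet']
        have hr1 : r * (A 0 0 * Real.sin (lift g (Real.pi / 2)) -
          A 1 0 * Real.cos (lift g (Real.pi / 2))) = 1 := by
          rw [hdet', mul_inv_cancel₀ hr.ne']
        linear_combination A 0 0 * hsc + Real.cos (lift g (Real.pi / 2)) *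
          (A 0 0 * Real.cos (lift g (Real.pi / 2)) + A 1 0 * Real.sin (lift g (Real.pi / 2))) * hr1
      · rw [e0, mul_comm]
      · rw [← hdet']
        have hr1 : r * (A 0 0 * Real.sin (lift g (Real.pi / 2)) -
          A 1 0 * Real.cos (lift g (Real.pi / 2))) = 1 := by
          rw [hdet', mul_inv_cancel₀ hr.ne']
        linear_combination A 1 0 * hsc + Real.sin (lift g (Real.pi / 2)) *
          (A 0 0 * Real.cos (lift g (Real.pi / 2)) + A 1 0 * Real.sin (lift g (Real.pi / 2))) * hr1
      · rw [e1, mul_comm]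
    · rw [lift_ofIwasawa]
      simp [toIwasawa]
  right_inv := by
    rintro ⟨θ, s, ν⟩
    have hsc := Real.sin_sq_add_cos_sq θ
    have e1 : Real.exp (-(s / 2)) * Real.exp (s / 2) = 1 := by
      rw [← Real.exp_add]
      simp
    have e2 : Real.exp (-s) = Real.exp (-(s / 2)) * Real.exp (-(s / 2)) := by
      rw [← Real.exp_add]
      congr 1
      ring
    have h01 : proj (ofIwasawa (θ, s, ν)) 0 1 = Real.sin θ * Real.exp (-(s / 2)) := by
      rw [proj_ofIwasawa, Matrix.SpecialLinearGroup.coe_mul, Matrix.mul_apply, Fin.sum_univ_two]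
      simp [rotMatrix, lowMatrix]
    have h11 : proj (ofIwasawa (θ, s, ν)) 1 1 = Real.cos θ * Real.exp (-(s / 2)) := by
      rw [proj_ofIwasawa, Matrix.SpecialLinearGroup.coe_mul, Matrix.mul_apply, Fin.sum_univ_two]
      simp [rotMatrix, lowMatrix]
    have h00 : proj (ofIwasawa (θ, s, ν)) 0 0 = Real.cos θ * Real.exp (s / 2) +
        Real.sin θ * (Real.exp (-(s / 2)) * (ν / 2)) := by
      rw [proj_ofIwasawa, Matrix.SpecialLinearGroup.coe_mul, Matrix.mul_apply, Fin.sum_univ_two]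
      simp [rotMatrix, lowMatrix]
    have h10 : proj (ofIwasawa (θ, s, ν)) 1 0 = -Real.sin θ * Real.exp (s / 2) +
        Real.cos θ * (Real.exp (-(s / 2)) * (ν / 2)) := by
      rw [proj_ofIwasawa, Matrix.SpecialLinearGroup.coe_mul, Matrix.mul_apply, Fin.sum_univ_two]
      simp [rotMatrix, lowMatrix]
    have hsq : proj (ofIwasawa (θ, s, ν)) 0 1 ^ 2 + proj (ofIwasawa (θ, s, ν)) 1 1 ^ 2 =
        Real.exp (-s) := by
      rw [h01, h11, e2]
      linear_combination Real.exp (-(s / 2)) ^ 2 * hsc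
    have hin : 2 * (proj (ofIwasawa (θ, s, ν)) 0 0 * proj (ofIwasawa (θ, s, ν)) 0 1 +
        proj (ofIwasawa (θ, s, ν)) 1 0 * proj (ofIwasawa (θ, s, ν)) 1 1) = ν * Real.exp (-s) := by
      rw [h00, h01, h10, h11, e2]
      linear_combination ν * Real.exp (-(s / 2)) ^ 2 * hsc
    rw [toIwasawa, hsq, hin, lift_ofIwasawa, Real.log_exp, mul_div_assoc,
      div_self (Real.exp_pos _).ne']
    simp
  continuous_toFun := by
    have hp : ∀ i j, Continuous fun g : CoverSL2 => proj g i j := fun i j =>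
      (Continuous.matrix_elem (Continuous.subtype_val continuous_proj) i j)
    refine (continuous_const.sub continuous_lift).prodMk (Continuous.prodMk ?_ ?_)
    · exact ((((hp 0 1).pow 2).add ((hp 1 1).pow 2)).log fun g => (sq_pos (proj g)).ne').neg
    · exact (continuous_const.mul (((hp 0 0).mul (hp 0 1)).add ((hp 1 0).mul (hp 1 1)))).div
        (((hp 0 1).pow 2).add ((hp 1 1).pow 2)) fun g => (sq_pos (proj g)).ne'
  continuous_invFun := by
    rw [continuous_induced_rng]
    refine Continuous.prodMk ?_ ?_
    · have hrot : Continuous fun z : ℝ × ℝ × ℝ => rotMatrix z.1 := by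
        refine Continuous.subtype_mk (continuous_matrix fun i j => ?_) _
        fin_cases i <;> fin_cases j <;> simp <;> fun_prop
      have hlow : Continuous fun z : ℝ × ℝ × ℝ => lowMatrix z.2.1 z.2.2 := by
        refine Continuous.subtype_mk (continuous_matrix fun i j => ?_) _
        fin_cases i <;> fin_cases j <;> simp <;> fun_prop
      exact hrot.mul hlow
    · exact (continuous_const.sub continuous_fst).congr fun z => (lift_ofIwasawa z).symm

/-- The smooth structure of `G`, for which left Iwasawa coordinates are a diffeomorphism. -/
instance : ChartedSpace (ℝ × ℝ × ℝ) CoverSL2 :=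
  iwasawa.toOpenPartialHomeomorph.singletonChartedSpace rfl

instance : IsManifold 𝓘(ℝ, ℝ × ℝ × ℝ) ∞ CoverSL2 :=
  iwasawa.toOpenPartialHomeomorph.isManifold_singleton rfl

end CoverSL2

/-! ### The monodromy -/

/-- `Φ` is the fundamental matrix `(v₁, v₂; v₁', v₂')` of `-v'' + q v = 0` on `[0, 2π]`, that is,
`Φ(0) = I` and `Φ' = (0, 1; q, 0) Φ`, in integrated form. -/
def IsFundamentalMatrix {p : ℕ} (q : sobolevCircle p) (Φ : ℝ → SL(2, ℝ)) : Prop :=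
  ContinuousOn Φ (Icc 0 (2 * Real.pi)) ∧
    ∀ t ∈ Icc 0 (2 * Real.pi), ∀ i : Fin 2,
      Φ t 0 i = (1 : Matrix (Fin 2) (Fin 2) ℝ) 0 i + ∫ s in (0 : ℝ)..t, Φ s 1 i ∧
      Φ t 1 i = (1 : Matrix (Fin 2) (Fin 2) ℝ) 1 i + ∫ s in (0 : ℝ)..t, q.1 0 s * Φ s 0 i

/-- `g ∈ G` is the monodromy `μ(q)` of the potential `q`: the end point at `t = 2π` of the
continuous lift to `G`, starting at the identity, of the fundamental matrix of `q`. -/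
def IsMonodromy {p : ℕ} (q : sobolevCircle p) (g : CoverSL2) : Prop :=
  ∃ Φ : ℝ → CoverSL2, ContinuousOn Φ (Icc 0 (2 * Real.pi)) ∧ Φ 0 = 1 ∧
    IsFundamentalMatrix q (fun t => CoverSL2.proj (Φ t)) ∧ Φ (2 * Real.pi) = g

/-! ### The model -/

/-- The union `Σ ⊂ ℝ³` of the plane `z = 0` and of the cones `x² + y² = tan² z`,
`2πn - π/2 < z < 2πn + π/2`, for the integers `n > 0`. -/
def planeAndCones : Set (ℝ × ℝ × ℝ) :=
  {w | w.2.2 = 0} ∪ ⋃ n : ℕ, ⋃ _ : 0 < n,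
    {w | w.1 ^ 2 + w.2.1 ^ 2 = Real.tan w.2.2 ^ 2 ∧
      2 * Real.pi * n - Real.pi / 2 < w.2.2 ∧ w.2.2 < 2 * Real.pi * n + Real.pi / 2}

end

noncomputable section

/-! The first row of the fundamental matrix of q is a plane curve (v₁, v₂) with v₁v₂' - v₂v₁' = 1.
In polar coordinates it has radius exp(-w/2) and argument θ with θ' = exp w, and the differential
equation becomes q = -w''/2 + w'²/4 - exp(2w) with w(0) = w'(0) = 0 (`IsKepler`,
`IsKepler.isLinSol_fundEntry`). A potential is therefore the same as a function w, and its monodromy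
is given by three numbers: θ(2π) = ∫ exp w > 0, a = w(2π) and b = w'(2π) (`isMonodromy_ofArgument`).
With log θ in place of θ these are global coordinates on G₀ (`logCoordinates`).

Two nonlinear conditions have to be straightened. The first is the periodicity of the jets of q:
once a, b and the common jet c of q at both ends are prescribed, the jets of w at the ends are
determined; a smooth family J(a, b, c) realizes them, and w - J runs through the double primitives
of a fixed closed subspace of finite codimension (`exists_flat_coordinates`). The second is the
value of ∫ exp w: it increases along a positive bump, so its logarithm can replace one linear
coordinate (`exists_straightening`). What remains is an infinite-dimensional separable Hilbert
space.

The kernel of -d²/dt² + q corresponds to the vectors fixed by A = Π(μ(q)) (`map_initialValues_ker`).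
Since det(A - I) = 2 - tr A, there is a nonzero one exactly on T₂, and two independent ones exactly
when A = I, that is, when μ(q) is central of trace 2.

It remains to find a diffeomorphism of ℝ³ carrying Σ to T₂ in logarithmic coordinates
(`exists_model`). In suitable coordinates (x, y, z) the trace is 2√(1 + x² + y²) cos z, so trace 2
means x² + y² = tan² z with cos z > 0. The half-space θ > 0 contains the cones with n > 0, all in θ
> π, and meets the cone n = 0 only in θ < π. There a shear replaces trace 2 by trace 0, which is the
surface z = π/2, and this surface is flattened to the plane of Σ. -/

namespace Hill

/-! ### Calculus on [0, 2π]: primitives, smooth families, jets and polynomials -/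

/-! ### Continuous functions on the period interval -/

/-- The Banach algebra of continuous functions on `[0, 2π]`. -/
abbrev CI : Type := C(Icc (0 : ℝ) (2 * Real.pi), ℝ)

/-- The left end point of the period interval. -/
def left : Icc (0 : ℝ) (2 * Real.pi) := ⟨0, le_rfl, by positivity⟩

/-- The right end point of the period interval. -/
def right : Icc (0 : ℝ) (2 * Real.pi) := ⟨2 * Real.pi, by positivity, le_rfl⟩

theorem zero_le_two_pi : (0 : ℝ) ≤ 2 * Real.pi := by positivity

/-- Extension of a continuous function on `[0, 2π]` to the line, constant outside the interval. -/
def ext (f : CI) : ℝ → ℝ := IccExtend zero_le_two_pi f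

theorem ext_apply (f : CI) (t : ℝ) : ext f t = f (projIcc 0 (2 * Real.pi) zero_le_two_pi t) := rfl

theorem ext_coe (f : CI) (t : Icc (0 : ℝ) (2 * Real.pi)) : ext f t = f t :=
  IccExtend_val _ _ _

theorem ext_of_mem (f : CI) {t : ℝ} (ht : t ∈ Icc (0 : ℝ) (2 * Real.pi)) : ext f t = f ⟨t, ht⟩ :=
  IccExtend_of_mem _ _ ht

theorem ext_zero (f : CI) : ext f 0 = f left := ext_of_mem f left.2

theorem ext_two_pi (f : CI) : ext f (2 * Real.pi) = f right := ext_of_mem f right.2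

theorem continuous_ext (f : CI) : Continuous (ext f) := f.continuous.Icc_extend'

theorem abs_ext_le (f : CI) (t : ℝ) : |ext f t| ≤ ‖f‖ := f.norm_coe_le_norm _

theorem ext_intervalIntegrable (f : CI) (a b : ℝ) : IntervalIntegrable (ext f) volume a b :=
  (continuous_ext f).intervalIntegrable a b

/-- The primitive vanishing at `0`. -/
def prim : CI →L[ℝ] CI :=
  LinearMap.mkContinuous
    { toFun := fun f => ⟨fun t => ∫ s in (0 : ℝ)..t, ext f s, by
        have : Continuous fun t : ℝ => ∫ s in (0 : ℝ)..t, ext f s :=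
          intervalIntegral.continuous_primitive (ext_intervalIntegrable f) 0
        exact this.comp continuous_subtype_val⟩
      map_add' := fun f g => by
        ext t
        exact intervalIntegral.integral_add (ext_intervalIntegrable f _ _)
          (ext_intervalIntegrable g _ _)
      map_smul' := fun a f => by
        ext t
        exact intervalIntegral.integral_smul a (ext f) }
    (2 * Real.pi) fun f => by
      refine (ContinuousMap.norm_le _ (by positivity)).2 fun t => ?_
      have h := intervalIntegral.norm_integral_le_of_norm_le_const (a := (0 : ℝ)) (b := t)
        (f := ext f) (C := ‖f‖) fun x _ => abs_ext_le f x
      refine h.trans ?_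
      rw [sub_zero, abs_of_nonneg t.2.1, mul_comm]
      exact mul_le_mul_of_nonneg_right t.2.2 (norm_nonneg _)

theorem prim_apply (f : CI) (t : Icc (0 : ℝ) (2 * Real.pi)) :
    prim f t = ∫ s in (0 : ℝ)..t, ext f s := rfl

theorem prim_left (f : CI) : prim f left = 0 := intervalIntegral.integral_same

/-- `g` is the derivative of `f` on `[0, 2π]`. -/
def IsDer (f g : CI) : Prop :=
  ∀ t ∈ Icc (0 : ℝ) (2 * Real.pi), HasDerivWithinAt (ext f) (ext g t) (Icc 0 (2 * Real.pi)) t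

theorem isDer_const (c : ℝ) : IsDer (c • 1) 0 := fun t _ => by
  have : ext (c • 1) = fun _ => c := by
    funext s
    simp [ext_apply]
  rw [this]
  exact hasDerivWithinAt_const _ _ _

theorem IsDer.add {f g f' g' : CI} (hf : IsDer f f') (hg : IsDer g g') :
    IsDer (f + g) (f' + g') := fun t ht => (hf t ht).add (hg t ht)

theorem IsDer.sub {f g f' g' : CI} (hf : IsDer f f') (hg : IsDer g g') :
    IsDer (f - g) (f' - g') := fun t ht => (hf t ht).sub (hg t ht)

theorem IsDer.neg {f f' : CI} (hf : IsDer f f') : IsDer (-f) (-f') := fun t ht => (hf t ht).neg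

theorem IsDer.smul {f f' : CI} (c : ℝ) (hf : IsDer f f') : IsDer (c • f) (c • f') :=
  fun t ht => (hf t ht).const_smul c

theorem IsDer.mul {f g f' g' : CI} (hf : IsDer f f') (hg : IsDer g g') :
    IsDer (f * g) (f' * g + f * g') := fun t ht => (hf t ht).mul (hg t ht)

/-- Evaluation at a point is a continuous algebra homomorphism, so it commutes with the exponential
of the Banach algebra. -/
theorem exp_apply (f : CI) (t : Icc (0 : ℝ) (2 * Real.pi)) :
    NormedSpace.exp f t = Real.exp (f t) := by
  have h := NormedSpace.map_exp (ContinuousMap.evalAlgHom (S := ℝ) (R := ℝ) t)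
    (continuous_eval_const t) f
  rw [← Real.exp_eq_exp_ℝ] at h
  exact h

theorem IsDer.exp {f f' : CI} (hf : IsDer f f') :
    IsDer (NormedSpace.exp f) (f' * NormedSpace.exp f) := fun t ht => by
  have h := (hf t ht).exp
  have e : ext (NormedSpace.exp f) = fun s => Real.exp (ext f s) := by
    funext s
    exact exp_apply f _
  rw [e]
  refine h.congr_deriv ?_
  rw [mul_comm, ← congrFun e t]
  rfl

theorem isDer_prim (f : CI) : IsDer (prim f) f := fun t ht => by
  have h : HasDerivAt (fun x => ∫ s in (0 : ℝ)..x, ext f s) (ext f t) t :=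
    intervalIntegral.integral_hasDerivAt_right (ext_intervalIntegrable f _ _)
      ((continuous_ext f).stronglyMeasurableAtFilter _ _) (continuous_ext f).continuousAt
  refine h.hasDerivWithinAt.congr (fun x hx => ?_) ?_
  · rw [ext_of_mem _ hx, prim_apply]
  · rw [ext_of_mem _ ht, prim_apply]

theorem IsDer.apply_eq {f g : CI} (h : IsDer f g) (t : Icc (0 : ℝ) (2 * Real.pi)) :
    f t = f left + prim g t := by
  have h1 := intervalIntegral.integral_eq_sub_of_hasDeriv_right (a := 0) (b := t) (f := ext f)
    (f' := ext g) (continuous_ext f).continuousOn (fun x hx => by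
      rw [min_eq_left t.2.1, max_eq_right t.2.1] at hx
      have hx' : x ∈ Ico (0 : ℝ) (2 * Real.pi) := ⟨hx.1.le, hx.2.trans_le t.2.2⟩
      have := h x ⟨hx'.1, hx'.2.le⟩
      refine (this.hasDerivAt (Icc_mem_nhds hx.1 hx'.2)).hasDerivWithinAt)
    (ext_intervalIntegrable g _ _)
  rw [prim_apply, h1, ext_coe, ext_zero]
  ring

theorem IsDer.eq {f g : CI} (h : IsDer f g) : f = f left • 1 + prim g := by
  ext t
  simpa using h.apply_eq t

/-- The interval is a set of unique differentiability, end points included. This identifies the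
derivatives hidden in the existential definitions of `SmoothFamily`, `JetAt` and `PeriodicCk` with
explicit ones. -/
theorem IsDer.unique {f g g' : CI} (h : IsDer f g) (h' : IsDer f g') : g = g' := by
  ext t
  have hu : UniqueDiffWithinAt ℝ (Icc (0 : ℝ) (2 * Real.pi)) t :=
    uniqueDiffOn_Icc (by positivity) t t.2
  have := hu.eq_deriv _ (h t t.2) (h' t t.2)
  rwa [ext_coe, ext_coe] at this

theorem isDer_smul_one_add_prim (c : ℝ) (f : CI) : IsDer (c • 1 + prim f) f := by
  simpa using (isDer_const c).add (isDer_prim f)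

theorem IsDer.eq_const {f : CI} (h : IsDer f 0) (s t : Icc (0 : ℝ) (2 * Real.pi)) :
    f s = f t := by
  rw [h.apply_eq s, h.apply_eq t]
  simp

theorem IsDer.congr {f g g' : CI} (h : IsDer f g) (e : g = g') : IsDer f g' := e ▸ h

theorem IsDer.prim_eq {f g : CI} (h : IsDer f g) (h0 : f left = 0) : prim g = f := by
  have := h.eq
  rw [h0, zero_smul, zero_add] at this
  exact this.symm

/-- The value at a point as a continuous linear functional. -/
def ev (t : Icc (0 : ℝ) (2 * Real.pi)) : CI →L[ℝ] ℝ := ContinuousMap.evalCLM ℝ t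

/-! ### Smooth families of differentiable functions -/

section SmoothFamily

variable {X Z : Type*} [NormedAddCommGroup X] [NormedSpace ℝ X]
  [NormedAddCommGroup Z] [NormedSpace ℝ Z]

/-- The functions `F x` have `k` derivatives on `[0, 2π]`, which depend smoothly on the
parameter `x`. -/
def SmoothFamily : ℕ → (X → CI) → Prop
  | 0, F => ContDiff ℝ ∞ F
  | k + 1, F => ContDiff ℝ ∞ F ∧ ∃ F', (∀ x, IsDer (F x) (F' x)) ∧ SmoothFamily k F'

variable {k l : ℕ} {F G : X → CI}

theorem SmoothFamily.contDiff (h : SmoothFamily k F) : ContDiff ℝ ∞ F := by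
  cases k with
  | zero => exact h
  | succ k => exact h.1

theorem SmoothFamily.of_succ (h : SmoothFamily (k + 1) F) : SmoothFamily k F := by
  induction k generalizing F with
  | zero => exact h.1
  | succ k ih =>
    obtain ⟨h1, F', hF, h2⟩ := h
    exact ⟨h1, F', hF, ih h2⟩

theorem SmoothFamily.mono (h : SmoothFamily k F) (hl : l ≤ k) : SmoothFamily l F := by
  induction hl with
  | refl => exact h
  | step _ ih => exact ih h.of_succ

theorem SmoothFamily.deriv {F' : X → CI} (h : SmoothFamily (k + 1) F)
    (hF : ∀ x, IsDer (F x) (F' x)) : SmoothFamily k F' := by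
  obtain ⟨_, G, hG, h2⟩ := h
  have : F' = G := funext fun x => (hF x).unique (hG x)
  rwa [this]

theorem SmoothFamily.comp (h : SmoothFamily k F) {g : Z → X} (hg : ContDiff ℝ ∞ g) :
    SmoothFamily k fun z => F (g z) := by
  induction k generalizing F with
  | zero => exact ContDiff.comp h hg
  | succ k ih =>
    obtain ⟨h1, F', hF, h2⟩ := h
    exact ⟨h1.comp hg, fun z => F' (g z), fun z => hF _, ih h2⟩

theorem SmoothFamily.add (hF : SmoothFamily k F) (hG : SmoothFamily k G) :
    SmoothFamily k fun x => F x + G x := by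
  induction k generalizing F G with
  | zero => exact ContDiff.add hF hG
  | succ k ih =>
    obtain ⟨h1, F', hF, h2⟩ := hF
    obtain ⟨g1, G', hG, g2⟩ := hG
    exact ⟨h1.add g1, _, fun x => (hF x).add (hG x), ih h2 g2⟩

theorem SmoothFamily.smul {a : X → ℝ} (ha : ContDiff ℝ ∞ a) (hF : SmoothFamily k F) :
    SmoothFamily k fun x => a x • F x := by
  induction k generalizing F with
  | zero => exact ContDiff.smul ha hF
  | succ k ih =>
    obtain ⟨h1, F', hF, h2⟩ := hF
    exact ⟨ha.smul h1, _, fun x => (hF x).smul (a x), ih h2⟩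

theorem SmoothFamily.const_smul (a : ℝ) (hF : SmoothFamily k F) :
    SmoothFamily k fun x => a • F x := hF.smul (a := fun _ => a) contDiff_const

theorem SmoothFamily.neg (hF : SmoothFamily k F) : SmoothFamily k fun x => -F x := by
  simpa using hF.const_smul (-1)

theorem SmoothFamily.sub (hF : SmoothFamily k F) (hG : SmoothFamily k G) :
    SmoothFamily k fun x => F x - G x := by
  simpa [sub_eq_add_neg] using hF.add hG.neg

theorem SmoothFamily.mul (hF : SmoothFamily k F) (hG : SmoothFamily k G) :
    SmoothFamily k fun x => F x * G x := by
  induction k generalizing F G with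
  | zero => exact ContDiff.mul hF hG
  | succ k ih =>
    have hF0 := hF.of_succ
    have hG0 := hG.of_succ
    obtain ⟨h1, F', hF, h2⟩ := hF
    obtain ⟨g1, G', hG, g2⟩ := hG
    exact ⟨h1.mul g1, _, fun x => (hF x).mul (hG x), (ih h2 hG0).add (ih hF0 g2)⟩

theorem contDiff_exp_CI : ContDiff ℝ ∞ (NormedSpace.exp : CI → CI) := by
  have h : AnalyticOnNhd ℝ (NormedSpace.exp : CI → CI) univ :=
    fun x _ => NormedSpace.exp_analytic x
  exact h.contDiff

theorem SmoothFamily.exp (hF : SmoothFamily k F) :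
    SmoothFamily k fun x => NormedSpace.exp (F x) := by
  induction k generalizing F with
  | zero => exact contDiff_exp_CI.comp hF
  | succ k ih =>
    have hF0 := hF.of_succ
    obtain ⟨h1, F', hF, h2⟩ := hF
    exact ⟨contDiff_exp_CI.comp h1, _, fun x => (hF x).exp, h2.mul (ih hF0)⟩

theorem SmoothFamily.prim (hF : SmoothFamily k F) :
    SmoothFamily (k + 1) fun x => prim (F x) :=
  ⟨(Hill.prim).contDiff.comp hF.contDiff, F, fun _ => isDer_prim _, hF⟩

theorem SmoothFamily.of_isDer {F' : X → CI} (h : ContDiff ℝ ∞ F)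
    (hF : ∀ x, IsDer (F x) (F' x)) (hF' : SmoothFamily k F') : SmoothFamily (k + 1) F :=
  ⟨h, F', hF, hF'⟩

theorem SmoothFamily.smul_one {a : X → ℝ} (ha : ContDiff ℝ ∞ a) :
    SmoothFamily k fun x => a x • (1 : CI) := by
  have h0 : ∀ k, SmoothFamily k fun _ : X => (0 : CI) := fun k => by
    induction k with
    | zero => exact contDiff_const
    | succ k ih => exact ⟨contDiff_const, _, fun _ => by simpa using isDer_const 0, ih⟩
  cases k with
  | zero => exact ha.smul contDiff_const
  | succ k => exact ⟨ha.smul contDiff_const, _, fun x => isDer_const _, h0 k⟩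

theorem SmoothFamily.ev (hF : SmoothFamily k F) (t : Icc (0 : ℝ) (2 * Real.pi)) :
    ContDiff ℝ ∞ fun x => F x t := (Hill.ev t).contDiff.comp hF.contDiff

/-- Collects the nested derivatives into one sequence, the form in which they become the components
of a Sobolev function. -/
theorem SmoothFamily.exists_deriv (hF : SmoothFamily k F) :
    ∃ D : ℕ → X → CI, D 0 = F ∧ (∀ j ≤ k, ContDiff ℝ ∞ (D j)) ∧
      ∀ j < k, ∀ x, IsDer (D j x) (D (j + 1) x) := by
  induction k generalizing F with
  | zero => exact ⟨fun _ => F, rfl, fun _ _ => hF, fun j hj => absurd hj (by omega)⟩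
  | succ k ih =>
    obtain ⟨h1, F', hF, h2⟩ := hF
    obtain ⟨D, d0, d1, d2⟩ := ih h2
    refine ⟨fun j => Nat.casesOn j F D, rfl, fun j hj => ?_, fun j hj x => ?_⟩
    · cases j with
      | zero => exact h1
      | succ j => exact d1 j (by omega)
    · cases j with
      | zero =>
        change IsDer (F x) (D 0 x)
        rw [d0]
        exact hF x
      | succ j => exact d2 j (by omega) x

end SmoothFamily

/-- `f` is `k` times continuously differentiable on `[0, 2π]`. -/
def IsCk (k : ℕ) (f : CI) : Prop := SmoothFamily k fun _ : ℝ => f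

theorem SmoothFamily.isCk {X : Type*} [NormedAddCommGroup X] [NormedSpace ℝ X] {k : ℕ}
    {F : X → CI} (h : SmoothFamily k F) (x : X) : IsCk k (F x) :=
  h.comp (g := fun _ : ℝ => x) contDiff_const

theorem IsCk.smoothFamily {X : Type*} [NormedAddCommGroup X] [NormedSpace ℝ X] {k : ℕ}
    {f : CI} (h : IsCk k f) : SmoothFamily k fun _ : X => f :=
  h.comp (g := fun _ : X => (0 : ℝ)) contDiff_const

theorem IsCk.of_isDer {k : ℕ} {f f' : CI} (h : IsDer f f') (h' : IsCk k f') : IsCk (k + 1) f :=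
  SmoothFamily.of_isDer contDiff_const (fun _ => h) h'

theorem isCk_smul_one (k : ℕ) (a : ℝ) : IsCk k (a • 1) :=
  SmoothFamily.smul_one (a := fun _ => a) contDiff_const

/-! ### Jets -/

/-- The derivatives of `f` at `t` up to order `k` are `c 0, …, c k`. -/
def JetAt (t : Icc (0 : ℝ) (2 * Real.pi)) : ℕ → CI → (ℕ → ℝ) → Prop
  | 0, f, c => f t = c 0
  | k + 1, f, c => f t = c 0 ∧ ∃ f', IsDer f f' ∧ JetAt t k f' fun j => c (j + 1)

section JetAt

variable {t : Icc (0 : ℝ) (2 * Real.pi)} {k l : ℕ} {f g : CI} {c d : ℕ → ℝ}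

theorem JetAt.apply (h : JetAt t k f c) : f t = c 0 := by
  cases k with
  | zero => exact h
  | succ k => exact h.1

theorem JetAt.deriv {f' : CI} (h : JetAt t (k + 1) f c) (hf : IsDer f f') :
    JetAt t k f' fun j => c (j + 1) := by
  obtain ⟨_, g, hg, h2⟩ := h
  rwa [hf.unique hg]

theorem JetAt.add (hf : JetAt t k f c) (hg : JetAt t k g d) : JetAt t k (f + g) (c + d) := by
  induction k generalizing f g c d with
  | zero =>
    change f t + g t = c 0 + d 0
    rw [hf.apply, hg.apply]
  | succ k ih =>
    obtain ⟨h1, f', hf, h2⟩ := hf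
    obtain ⟨g1, g', hg, g2⟩ := hg
    refine ⟨?_, _, hf.add hg, ih h2 g2⟩
    change f t + g t = c 0 + d 0
    rw [h1, g1]

theorem JetAt.smul (a : ℝ) (hf : JetAt t k f c) : JetAt t k (a • f) (a • c) := by
  induction k generalizing f c with
  | zero =>
    change a * f t = a * c 0
    rw [hf.apply]
  | succ k ih =>
    obtain ⟨h1, f', hf, h2⟩ := hf
    refine ⟨?_, _, hf.smul a, ih h2⟩
    change a * f t = a * c 0
    rw [h1]

theorem JetAt.neg (hf : JetAt t k f c) : JetAt t k (-f) (-c) := by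
  simpa using hf.smul (-1)

theorem JetAt.sub (hf : JetAt t k f c) (hg : JetAt t k g d) : JetAt t k (f - g) (c - d) := by
  simpa [sub_eq_add_neg] using hf.add hg.neg

theorem JetAt.of_succ (h : JetAt t (k + 1) f c) : JetAt t k f c := by
  induction k generalizing f c with
  | zero => exact h.1
  | succ k ih =>
    obtain ⟨h1, f', hf, h2⟩ := h
    exact ⟨h1, f', hf, ih h2⟩

theorem JetAt.mono (h : JetAt t k f c) (hl : l ≤ k) : JetAt t l f c := by
  induction hl with
  | refl => exact h
  | step _ ih => exact ih h.of_succ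

theorem JetAt.congr (h : JetAt t k f c) (hd : ∀ j ≤ k, c j = d j) : JetAt t k f d := by
  induction k generalizing f c d with
  | zero => exact h.apply.trans (hd 0 le_rfl)
  | succ k ih =>
    obtain ⟨h1, f', hf, h2⟩ := h
    exact ⟨h1.trans (hd 0 (by omega)), f', hf, ih h2 fun j hj => hd (j + 1) (by omega)⟩

/-- The derivatives of `f` at `t` up to order `k` vanish. -/
abbrev VanishAt (t : Icc (0 : ℝ) (2 * Real.pi)) (k : ℕ) (f : CI) : Prop := JetAt t k f 0

theorem vanishAt_succ {f' : CI} (h : f t = 0) (hf : IsDer f f') (h' : VanishAt t k f') :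
    VanishAt t (k + 1) f := ⟨h, f', hf, h'⟩

theorem VanishAt.add (hf : VanishAt t k f) (hg : VanishAt t k g) : VanishAt t k (f + g) := by
  simpa [VanishAt] using JetAt.add hf hg

theorem VanishAt.sub (hf : VanishAt t k f) (hg : VanishAt t k g) : VanishAt t k (f - g) := by
  simpa [VanishAt] using JetAt.sub hf hg

theorem VanishAt.smul (a : ℝ) (hf : VanishAt t k f) : VanishAt t k (a • f) := by
  simpa [VanishAt] using JetAt.smul a hf

theorem VanishAt.mul (hf : VanishAt t k f) (hg : IsCk k g) : VanishAt t k (f * g) := by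
  induction k generalizing f g with
  | zero =>
    change f t * g t = 0
    rw [hf.apply]
    simp
  | succ k ih =>
    have hf0 := JetAt.of_succ hf
    obtain ⟨h1, f', hf, h2⟩ := hf
    have hg0 := hg.of_succ
    obtain ⟨_, g', hg, g2⟩ := hg
    refine ⟨?_, _, hf.mul (hg 0), ?_⟩
    · change f t * g t = 0
      rw [h1]
      simp
    · exact (ih h2 hg0).add (ih hf0 (SmoothFamily.isCk g2 0))

/-- One order is gained: in f'g + fg' the first term is covered by induction, since f' loses one
order and g still vanishes, and the second by the vanishing of f. Used for powers of `parabola`. -/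
theorem VanishAt.mul_vanishAt_zero (hf : VanishAt t k f) (hg : IsCk (k + 1) g) (h0 : g t = 0)
    (hf' : IsCk (k + 1) f) : VanishAt t (k + 1) (f * g) := by
  induction k generalizing f g with
  | zero =>
    obtain ⟨_, g', hg, g2⟩ := hg
    obtain ⟨_, f', hf', f2⟩ := hf'
    refine ⟨?_, _, (hf' 0).mul (hg 0), ?_⟩
    · change f t * g t = 0
      rw [h0]
      simp
    · change f' 0 t * g t + f t * g' 0 t = 0
      rw [h0, hf.apply]
      simp
  | succ k ih =>
    have hf0 := hf
    obtain ⟨h1, f1, hf, h2⟩ := hf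
    have hg0 := SmoothFamily.of_succ hg
    obtain ⟨_, g', hg, g2⟩ := hg
    have hf1 : IsCk (k + 1) f1 := SmoothFamily.deriv hf' fun _ => hf
    refine ⟨?_, _, hf.mul (hg 0), ?_⟩
    · change f t * g t = 0
      rw [h1]
      simp
    · exact (ih h2 hg0 h0 hf1).add (hf0.mul (SmoothFamily.isCk g2 0))

end JetAt

/-- The derivatives of `f` up to order `k` have the same values at `0` and at `2π`. -/
def PeriodicCk : ℕ → CI → Prop
  | 0, f => f left = f right
  | k + 1, f => f left = f right ∧ ∃ f', IsDer f f' ∧ PeriodicCk k f'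

section PeriodicCk

variable {k l : ℕ} {f g : CI} {c : ℕ → ℝ}

theorem PeriodicCk.apply (h : PeriodicCk k f) : f left = f right := by
  cases k with
  | zero => exact h
  | succ k => exact h.1

theorem JetAt.periodicCk (h0 : JetAt left k f c) (h1 : JetAt right k f c) : PeriodicCk k f := by
  induction k generalizing f c with
  | zero => exact h0.apply.trans h1.apply.symm
  | succ k ih =>
    refine ⟨h0.apply.trans h1.apply.symm, ?_⟩
    obtain ⟨_, f', hf, h2⟩ := h0
    exact ⟨f', hf, ih h2 (h1.deriv hf)⟩

end PeriodicCk

/-! ### Polynomials with prescribed jets -/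

/-- The primitive vanishing at `t₀`. -/
def primAt (t₀ : Icc (0 : ℝ) (2 * Real.pi)) (f : CI) : CI := prim f - prim f t₀ • 1

theorem primAt_self (t₀ : Icc (0 : ℝ) (2 * Real.pi)) (f : CI) : primAt t₀ f t₀ = 0 := by
  simp [primAt]

theorem isDer_primAt (t₀ : Icc (0 : ℝ) (2 * Real.pi)) (f : CI) : IsDer (primAt t₀ f) f := by
  simpa [primAt] using (isDer_prim f).sub (isDer_const (prim f t₀))

/-- The polynomial of degree `≤ m` with derivatives `c 0, …, c m` at `t₀`. -/
def taylorPoly (t₀ : Icc (0 : ℝ) (2 * Real.pi)) : ℕ → (ℕ → ℝ) → CI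
  | 0, c => c 0 • 1
  | m + 1, c => c 0 • 1 + primAt t₀ (taylorPoly t₀ m fun j => c (j + 1))

theorem isDer_taylorPoly_succ (t₀ : Icc (0 : ℝ) (2 * Real.pi)) (m : ℕ) (c : ℕ → ℝ) :
    IsDer (taylorPoly t₀ (m + 1) c) (taylorPoly t₀ m fun j => c (j + 1)) := by
  simpa [taylorPoly] using (isDer_const (c 0)).add (isDer_primAt t₀ (taylorPoly t₀ m fun j => c (j + 1)))

theorem jetAt_taylorPoly (t₀ : Icc (0 : ℝ) (2 * Real.pi)) (m : ℕ) (c : ℕ → ℝ) :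
    JetAt t₀ m (taylorPoly t₀ m c) c := by
  induction m generalizing c with
  | zero => simp [JetAt, taylorPoly]
  | succ m ih =>
    refine ⟨?_, _, isDer_taylorPoly_succ t₀ m c, ih _⟩
    simp [taylorPoly, primAt_self]

theorem smoothFamily_taylorPoly {X : Type*} [NormedAddCommGroup X] [NormedSpace ℝ X]
    (t₀ : Icc (0 : ℝ) (2 * Real.pi)) (m k : ℕ) {c : X → ℕ → ℝ}
    (hc : ∀ j, ContDiff ℝ ∞ fun x => c x j) :
    SmoothFamily k fun x => taylorPoly t₀ m (c x) := by
  induction m generalizing c k with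
  | zero => exact SmoothFamily.smul_one (hc 0)
  | succ m ih =>
    have h1 : ∀ k, SmoothFamily k fun x => taylorPoly t₀ m fun j => c x (j + 1) :=
      fun k => ih k fun j => hc (j + 1)
    have h2 : ContDiff ℝ ∞ fun x => taylorPoly t₀ (m + 1) (c x) := by
      refine ((hc 0).smul contDiff_const).add ((prim.contDiff.comp (h1 0)).sub ?_)
      exact ((ev t₀).contDiff.comp (prim.contDiff.comp (h1 0))).smul contDiff_const
    cases k with
    | zero => exact h2
    | succ k => exact ⟨h2, _, fun x => isDer_taylorPoly_succ t₀ m (c x), h1 k⟩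

/-! ### Linear equation, and the nonlinear equation for the logarithmic radius -/

/-! ### The linear equation `v'' = q v` -/

/-- `v' = v₁` and `v₁' = q v`. -/
def IsLinSol (q v v₁ : CI) : Prop := IsDer v v₁ ∧ IsDer v₁ (q * v)

/-- Each integration turns tⁿ/n! into tⁿ⁺¹/(n+1)!; this gives the factorial decay of the iterated
Volterra operators. -/
theorem abs_prim_le {f : CI} {C : ℝ} {n : ℕ}
    (h : ∀ t : Icc (0 : ℝ) (2 * Real.pi), |f t| ≤ C * (t : ℝ) ^ n / n.factorial)
    (t : Icc (0 : ℝ) (2 * Real.pi)) :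
    |prim f t| ≤ C * (t : ℝ) ^ (n + 1) / (n + 1).factorial := by
  have hb : ∀ s ∈ Ioc (0 : ℝ) t, ‖ext f s‖ ≤ C * s ^ n / n.factorial := fun s hs => by
    rw [ext_of_mem f ⟨hs.1.le, hs.2.trans t.2.2⟩]
    exact h ⟨s, hs.1.le, hs.2.trans t.2.2⟩
  have hi := intervalIntegral.norm_integral_le_of_norm_le (μ := volume) (f := ext f) t.2.1 (Filter.Eventually.of_forall hb)
    (Continuous.intervalIntegrable (by fun_prop) _ _)
  rw [prim_apply]
  refine hi.trans (le_of_eq ?_)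
  have e : (fun s : ℝ => C * s ^ n / n.factorial) = fun s => C / n.factorial * s ^ n := by
    funext s
    ring
  rw [e, intervalIntegral.integral_const_mul, integral_pow, Nat.factorial_succ]
  push_cast
  field_simp
  simp

/-- The Volterra operator `f ↦ ∫∫ q f`, as a function of `q`. -/
def volterra : CI →L[ℝ] CI →L[ℝ] CI :=
  (ContinuousLinearMap.compL ℝ CI CI CI (prim.comp prim)).comp (ContinuousLinearMap.mul ℝ CI)

theorem volterra_apply (q f : CI) : volterra q f = prim (prim (q * f)) := rfl

theorem abs_volterra_pow_le (q f : CI) (n : ℕ) (t : Icc (0 : ℝ) (2 * Real.pi)) :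
    |((volterra q) ^ n) f t| ≤ ‖q‖ ^ n * ‖f‖ * (t : ℝ) ^ (2 * n) / (2 * n).factorial := by
  induction n generalizing t with
  | zero => simpa using f.norm_coe_le_norm t
  | succ n ih =>
    rw [pow_succ', mul_apply_eq_comp, volterra_apply]
    refine abs_prim_le (n := 2 * n + 1) (fun s => abs_prim_le (n := 2 * n) (fun r => ?_) s) t
    rw [ContinuousMap.mul_apply, abs_mul]
    calc |q r| * |((volterra q) ^ n) f r|
        ≤ ‖q‖ * (‖q‖ ^ n * ‖f‖ * (r : ℝ) ^ (2 * n) / (2 * n).factorial) :=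
          mul_le_mul (q.norm_coe_le_norm r) (ih r) (abs_nonneg _) (norm_nonneg _)
      _ = ‖q‖ ^ (n + 1) * ‖f‖ * (r : ℝ) ^ (2 * n) / (2 * n).factorial := by ring

/-- The Volterra operator V need not be small, but the norm of Vⁿ is at most ‖q‖ⁿ(2π)²ⁿ/(2n)!, so 1
- Vⁿ is invertible for some n. Its factor 1 - V commutes with the complementary geometric sum, hence
is invertible too. Solving by inversion in an operator algebra makes the solution smooth in q. -/
theorem isUnit_one_sub_volterra (q : CI) : IsUnit (1 - volterra q) := by
  -- The maximum with 1 allows the n-th power of ‖q‖ to be absorbed in a (2n)-th power.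
  set M : ℝ := max ‖q‖ 1 * (2 * Real.pi) with hM
  have hlim := FloorSemiring.tendsto_pow_div_factorial_atTop M
  have hlim2 : Filter.Tendsto (fun n : ℕ => M ^ (2 * n) / (2 * n).factorial) Filter.atTop
      (nhds 0) := hlim.comp (Filter.tendsto_id.const_mul_atTop' (by norm_num))
  obtain ⟨n, hn⟩ := (hlim2.eventually (gt_mem_nhds one_pos)).exists
  have hnorm : ‖(volterra q) ^ n‖ < 1 := by
    refine lt_of_le_of_lt (ContinuousLinearMap.opNorm_le_bound _ (by positivity) fun f => ?_) hn
    refine (ContinuousMap.norm_le _ (by positivity)).2 fun t => ?_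
    refine (abs_volterra_pow_le q f n t).trans ?_
    have h1 : ‖q‖ ^ n ≤ (max ‖q‖ 1) ^ (2 * n) :=
      calc ‖q‖ ^ n ≤ (max ‖q‖ 1) ^ n := pow_le_pow_left₀ (norm_nonneg _) (le_max_left _ _) _
        _ ≤ (max ‖q‖ 1) ^ (2 * n) := pow_le_pow_right₀ (le_max_right _ _) (by omega)
    have h2 : (t : ℝ) ^ (2 * n) ≤ (2 * Real.pi) ^ (2 * n) := pow_le_pow_left₀ t.2.1 t.2.2 _
    have h3 : ‖q‖ ^ n * (t : ℝ) ^ (2 * n) ≤ M ^ (2 * n) := by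
      rw [hM, mul_pow]
      exact mul_le_mul h1 h2 (pow_nonneg t.2.1 _) (by positivity)
    calc ‖q‖ ^ n * ‖f‖ * (t : ℝ) ^ (2 * n) / (2 * n).factorial
        = (‖q‖ ^ n * (t : ℝ) ^ (2 * n)) / (2 * n).factorial * ‖f‖ := by ring
      _ ≤ M ^ (2 * n) / (2 * n).factorial * ‖f‖ := by gcongr
  have hu : IsUnit (1 - (volterra q) ^ n) :=
    isUnit_one_sub_of_norm_lt_one (R := CI →L[ℝ] CI) hnorm
  rw [← mul_neg_geom_sum] at hu
  have hc : Commute (1 - volterra q) (∑ i ∈ Finset.range n, volterra q ^ i) := by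
    change _ * _ = _ * _
    rw [mul_neg_geom_sum, geom_sum_mul_neg]
  exact (hc.isUnit_mul_iff.1 hu).1

/-- The solution of `v = e + ∫∫ q v`. -/
def volterraSol (q e : CI) : CI := Ring.inverse (1 - volterra q) e

theorem volterraSol_eq (q e : CI) :
    volterraSol q e = e + prim (prim (q * volterraSol q e)) := by
  have h := congrArg (fun T : CI →L[ℝ] CI => T e)
    (Ring.mul_inverse_cancel _ (isUnit_one_sub_volterra q))
  simp only [mul_apply_eq_comp, sub_apply,
    one_apply_eq_self, volterra_apply] at h
  exact sub_eq_iff_eq_add.1 h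

theorem volterraSol_unique {q e v : CI} (h : v = e + prim (prim (q * v))) :
    v = volterraSol q e := by
  have h1 := congrArg (fun T : CI →L[ℝ] CI => T v)
    (Ring.inverse_mul_cancel _ (isUnit_one_sub_volterra q))
  simp only [mul_apply_eq_comp, sub_apply,
    one_apply_eq_self, volterra_apply] at h1
  rw [sub_eq_iff_eq_add.2 h] at h1
  exact h1.symm

theorem contDiff_ringInverse_comp {X R : Type*} [NormedAddCommGroup X] [NormedSpace ℝ X]
    [NormedRing R] [NormedAlgebra ℝ R] [CompleteSpace R] {f : X → R} (hf : ContDiff ℝ ∞ f)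
    (hu : ∀ x, IsUnit (f x)) : ContDiff ℝ ∞ fun x => Ring.inverse (f x) := by
  rw [contDiff_iff_contDiffAt]
  intro x
  exact ContDiffAt.comp x (contDiffAt_ringInverse ℝ (hu x).unit) hf.contDiffAt

theorem contDiff_volterraSol (e : CI) : ContDiff ℝ ∞ fun q => volterraSol q e := by
  have hv : ContDiff ℝ ∞ fun q : CI => volterra q := by fun_prop
  have h0 : ContDiff ℝ ∞ fun q : CI => 1 - volterra q := contDiff_const.sub hv
  have h := contDiff_ringInverse_comp (R := CI →L[ℝ] CI) h0 isUnit_one_sub_volterra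
  have h' : ContDiff ℝ ∞ fun q : CI => (Ring.inverse (1 - volterra q) : CI →L[ℝ] CI) := h
  exact h'.clm_apply contDiff_const

/-- The solution of `v'' = q v` with `v(0) = 1`, `v'(0) = 0`. -/
def linC (q : CI) : CI := volterraSol q 1

/-- The derivative of `linC q`. -/
def linC' (q : CI) : CI := prim (q * linC q)

/-- The solution of `v'' = q v` with `v(0) = 0`, `v'(0) = 1`. -/
def linS (q : CI) : CI := volterraSol q (prim 1)

/-- The derivative of `linS q`. -/
def linS' (q : CI) : CI := 1 + prim (q * linS q)

theorem isLinSol_linC (q : CI) : IsLinSol q (linC q) (linC' q) := by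
  refine ⟨?_, isDer_prim _⟩
  have h := isDer_smul_one_add_prim 1 (linC' q)
  rwa [one_smul, linC', linC, ← volterraSol_eq] at h

theorem isLinSol_linS (q : CI) : IsLinSol q (linS q) (linS' q) := by
  refine ⟨?_, ?_⟩
  · have h := (isDer_prim 1).add (isDer_prim (prim (q * volterraSol q (prim 1))))
    rwa [← volterraSol_eq] at h
  · simpa [linS'] using isDer_smul_one_add_prim 1 (q * linS q)

theorem linC_left (q : CI) : linC q left = 1 := by
  rw [linC, volterraSol_eq]
  simp [prim_left]

theorem linS_left (q : CI) : linS q left = 0 := by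
  rw [linS, volterraSol_eq]
  simp [prim_left]

theorem linS'_left (q : CI) : linS' q left = 1 := by simp [linS', prim_left]

theorem contDiff_linC : ContDiff ℝ ∞ linC := contDiff_volterraSol 1

theorem contDiff_linC' : ContDiff ℝ ∞ linC' := prim.contDiff.comp (contDiff_id.mul contDiff_linC)

theorem contDiff_linS : ContDiff ℝ ∞ linS := contDiff_volterraSol (prim 1)

theorem contDiff_linS' : ContDiff ℝ ∞ linS' :=
  contDiff_const.add (prim.contDiff.comp (contDiff_id.mul contDiff_linS))

theorem IsLinSol.unique {q v v₁ u u₁ : CI} (hv : IsLinSol q v v₁) (hu : IsLinSol q u u₁)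
    (h : v left = u left) (h₁ : v₁ left = u₁ left) : v = u := by
  -- Integrated twice, the equation is the Volterra equation with inhomogeneity v(0) + v'(0) t.
  have key : ∀ {v v₁ : CI}, IsLinSol q v v₁ →
      v = volterraSol q (v left • 1 + v₁ left • prim 1) := fun {v v₁} hv => by
    refine volterraSol_unique ?_
    have h1 := hv.2.eq
    have h2 := hv.1.eq
    rw [h1, map_add, map_smul, ← add_assoc] at h2
    exact h2
  rw [key hv, key hu, h, h₁]

theorem IsLinSol.wronskian_eq {q v v₁ u u₁ : CI} (hv : IsLinSol q v v₁) (hu : IsLinSol q u u₁)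
    (s t : Icc (0 : ℝ) (2 * Real.pi)) :
    v s * u₁ s - u s * v₁ s = v t * u₁ t - u t * v₁ t := by
  have h : IsDer (v * u₁ - u * v₁) 0 :=
    ((hv.1.mul hu.2).sub (hu.1.mul hv.2)).congr (by ring)
  exact h.eq_const s t

theorem wronskian_linC_linS (q : CI) (t : Icc (0 : ℝ) (2 * Real.pi)) :
    linC q t * linS' q t - linS q t * linC' q t = 1 := by
  rw [(isLinSol_linC q).wronskian_eq (isLinSol_linS q) t left, linC_left, linS'_left, linS_left]
  ring

theorem IsLinSol.add {q v v₁ u u₁ : CI} (hv : IsLinSol q v v₁) (hu : IsLinSol q u u₁) :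
    IsLinSol q (v + u) (v₁ + u₁) :=
  ⟨hv.1.add hu.1, (hv.2.add hu.2).congr (by ring)⟩

theorem IsLinSol.smul {q v v₁ : CI} (a : ℝ) (hv : IsLinSol q v v₁) :
    IsLinSol q (a • v) (a • v₁) :=
  ⟨hv.1.smul a, (hv.2.smul a).congr (mul_smul_comm a q v).symm⟩

/-- The solution of `v'' = q v` with `v(t₀) = α`, `v'(t₀) = β`. -/
def linSol (t₀ : Icc (0 : ℝ) (2 * Real.pi)) (q : CI) (α β : ℝ) : CI :=
  (α * linS' q t₀ - β * linS q t₀) • linC q + (β * linC q t₀ - α * linC' q t₀) • linS q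

/-- The derivative of `linSol t₀ q α β`. -/
def linSol' (t₀ : Icc (0 : ℝ) (2 * Real.pi)) (q : CI) (α β : ℝ) : CI :=
  (α * linS' q t₀ - β * linS q t₀) • linC' q + (β * linC q t₀ - α * linC' q t₀) • linS' q

section LinSol

variable (t₀ : Icc (0 : ℝ) (2 * Real.pi)) (q : CI) (α β : ℝ)

theorem isLinSol_linSol : IsLinSol q (linSol t₀ q α β) (linSol' t₀ q α β) :=
  ((isLinSol_linC q).smul _).add ((isLinSol_linS q).smul _)

theorem linSol_self : linSol t₀ q α β t₀ = α := by
  change (α * linS' q t₀ - β * linS q t₀) * linC q t₀ +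
    (β * linC q t₀ - α * linC' q t₀) * linS q t₀ = α
  linear_combination α * wronskian_linC_linS q t₀

theorem linSol'_self : linSol' t₀ q α β t₀ = β := by
  change (α * linS' q t₀ - β * linS q t₀) * linC' q t₀ +
    (β * linC q t₀ - α * linC' q t₀) * linS' q t₀ = β
  linear_combination β * wronskian_linC_linS q t₀

end LinSol

section ContDiff

variable {X : Type*} [NormedAddCommGroup X] [NormedSpace ℝ X] (t₀ : Icc (0 : ℝ) (2 * Real.pi))
  {q : X → CI} {α β : X → ℝ}

theorem contDiff_linSol (hq : ContDiff ℝ ∞ q) (hα : ContDiff ℝ ∞ α) (hβ : ContDiff ℝ ∞ β) :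
    ContDiff ℝ ∞ fun x => linSol t₀ (q x) (α x) (β x) := by
  have e : ∀ {F : CI → CI}, ContDiff ℝ ∞ F → ContDiff ℝ ∞ fun x => F (q x) t₀ :=
    fun hF => (ev t₀).contDiff.comp (hF.comp hq)
  exact (((hα.mul (e contDiff_linS')).sub (hβ.mul (e contDiff_linS))).smul
    (contDiff_linC.comp hq)).add
    (((hβ.mul (e contDiff_linC)).sub (hα.mul (e contDiff_linC'))).smul (contDiff_linS.comp hq))

theorem contDiff_linSol' (hq : ContDiff ℝ ∞ q) (hα : ContDiff ℝ ∞ α) (hβ : ContDiff ℝ ∞ β) :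
    ContDiff ℝ ∞ fun x => linSol' t₀ (q x) (α x) (β x) := by
  have e : ∀ {F : CI → CI}, ContDiff ℝ ∞ F → ContDiff ℝ ∞ fun x => F (q x) t₀ :=
    fun hF => (ev t₀).contDiff.comp (hF.comp hq)
  exact (((hα.mul (e contDiff_linS')).sub (hβ.mul (e contDiff_linS))).smul
    (contDiff_linC'.comp hq)).add
    (((hβ.mul (e contDiff_linC)).sub (hα.mul (e contDiff_linC'))).smul (contDiff_linS'.comp hq))

end ContDiff

/-! ### The Kepler transform -/

/-- The nonlinearity `w'² / 4 - exp (2w)`. -/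
def kepler (w w₁ : CI) : CI :=
  (1 / 4 : ℝ) • (w₁ * w₁) - NormedSpace.exp w * NormedSpace.exp w

/-- `q = -w'' / 2 + w'² / 4 - exp (2w)` and `w' = w₁`. -/
def IsKepler (q w w₁ : CI) : Prop :=
  IsDer w w₁ ∧ IsDer w₁ ((-2 : ℝ) • q + (2 : ℝ) • kepler w w₁)

section Kepler

variable (t₀ : Icc (0 : ℝ) (2 * Real.pi)) (q : CI) (a b : ℝ)

/-- The first component of the curve with argument `0`, and with logarithmic radial
coordinates `(a, b)`, at `t₀`. -/
def curveX : CI := linSol t₀ q (Real.exp (-(a / 2))) (-(b / 2) * Real.exp (-(a / 2)))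

/-- The derivative of `curveX`. -/
def curveX' : CI := linSol' t₀ q (Real.exp (-(a / 2))) (-(b / 2) * Real.exp (-(a / 2)))

/-- The second component of the curve with argument `0`, and with logarithmic radial
coordinates `(a, b)`, at `t₀`. -/
def curveY : CI := linSol t₀ q 0 (Real.exp (a / 2))

/-- The derivative of `curveY`. -/
def curveY' : CI := linSol' t₀ q 0 (Real.exp (a / 2))

/-- The initial data at t₀ are chosen so that the Wronskian is exp(-a/2) exp(a/2) = 1. In particular
the curve never meets the origin. -/
theorem wronskian_curve (t : Icc (0 : ℝ) (2 * Real.pi)) :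
    curveX t₀ q a b t * curveY' t₀ q a t - curveY t₀ q a t * curveX' t₀ q a b t = 1 := by
  rw [curveX, curveX', curveY, curveY',
    (isLinSol_linSol t₀ q _ _).wronskian_eq (isLinSol_linSol t₀ q _ _) t t₀, linSol_self,
    linSol'_self, linSol_self, ← Real.exp_add]
  simp

/-- The squared radius of the curve. -/
def radiusSq : CI := curveX t₀ q a b * curveX t₀ q a b + curveY t₀ q a * curveY t₀ q a

theorem isUnit_radiusSq : IsUnit (radiusSq t₀ q a b) := by
  rw [ContinuousMap.isUnit_iff_forall_ne_zero]
  intro t h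
  have hw := wronskian_curve t₀ q a b t
  change curveX t₀ q a b t * curveX t₀ q a b t + curveY t₀ q a t * curveY t₀ q a t = 0 at h
  obtain ⟨hx, hy⟩ := (mul_self_add_mul_self_eq_zero).1 h
  rw [hx, hy] at hw
  simp at hw

/-- The derivative of the solution `keplerSol` of the Kepler equation. -/
def keplerSol' : CI :=
  -((2 : ℝ) • (curveX t₀ q a b * curveX' t₀ q a b + curveY t₀ q a * curveY' t₀ q a)) *
    Ring.inverse (radiusSq t₀ q a b)

/-- The solution `w` of `q = -w'' / 2 + w'² / 4 - exp (2w)`, `w(t₀) = a`, `w'(t₀) = b`. -/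
def keplerSol : CI := a • 1 + primAt t₀ (keplerSol' t₀ q a b)

theorem keplerSol_self : keplerSol t₀ q a b t₀ = a := by simp [keplerSol, primAt_self]

theorem ringInverse_apply {f : CI} (hf : IsUnit f) (t : Icc (0 : ℝ) (2 * Real.pi)) :
    f t * Ring.inverse f t = 1 :=
  congrArg (fun g : CI => g t) (Ring.mul_inverse_cancel f hf)

theorem keplerSol'_self : keplerSol' t₀ q a b t₀ = b := by
  have hi := ringInverse_apply (isUnit_radiusSq t₀ q a b) t₀
  have hX : curveX t₀ q a b t₀ = Real.exp (-(a / 2)) := linSol_self _ _ _ _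
  have hX' : curveX' t₀ q a b t₀ = -(b / 2) * Real.exp (-(a / 2)) := linSol'_self _ _ _ _
  have hY : curveY t₀ q a t₀ = 0 := linSol_self _ _ _ _
  change (curveX t₀ q a b t₀ * curveX t₀ q a b t₀ + curveY t₀ q a t₀ * curveY t₀ q a t₀) * _ = 1
    at hi
  change -(2 * (curveX t₀ q a b t₀ * curveX' t₀ q a b t₀ + curveY t₀ q a t₀ * _)) * _ = b
  rw [hX, hY] at hi
  rw [hX, hX', hY]
  linear_combination b * hi

theorem isDer_keplerSol : IsDer (keplerSol t₀ q a b) (keplerSol' t₀ q a b) := by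
  simpa [keplerSol] using (isDer_const a).add (isDer_primAt t₀ (keplerSol' t₀ q a b))

theorem isDer_radiusSq : IsDer (radiusSq t₀ q a b)
    ((2 : ℝ) • (curveX t₀ q a b * curveX' t₀ q a b + curveY t₀ q a * curveY' t₀ q a)) := by
  have hx := (isLinSol_linSol t₀ q (Real.exp (-(a / 2))) (-(b / 2) * Real.exp (-(a / 2)))).1
  have hy := (isLinSol_linSol t₀ q 0 (Real.exp (a / 2))).1
  refine ((hx.mul hx).add (hy.mul hy)).congr ?_
  rw [two_smul]
  simp only [curveX, curveX', curveY, curveY']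
  ring

/-- Thus w is minus the logarithm of the squared radius: the logarithmic derivatives of the two
factors cancel, so the product is constant, and it equals 1 at t₀, where the radius is exp(-a/2). -/
theorem exp_keplerSol : NormedSpace.exp (keplerSol t₀ q a b) =
    Ring.inverse (radiusSq t₀ q a b) := by
  have hu := isUnit_radiusSq t₀ q a b
  have h : IsDer (radiusSq t₀ q a b * NormedSpace.exp (keplerSol t₀ q a b)) 0 := by
    refine ((isDer_radiusSq t₀ q a b).mul (isDer_keplerSol t₀ q a b).exp).congr ?_
    have hi := Ring.mul_inverse_cancel _ hu
    rw [keplerSol']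
    linear_combination (-((2 : ℝ) • (curveX t₀ q a b * curveX' t₀ q a b +
      curveY t₀ q a * curveY' t₀ q a)) * NormedSpace.exp (keplerSol t₀ q a b)) * hi
  have h1 : radiusSq t₀ q a b * NormedSpace.exp (keplerSol t₀ q a b) = 1 := by
    ext t
    rw [h.eq_const t t₀, ContinuousMap.mul_apply, exp_apply, keplerSol_self]
    change (curveX t₀ q a b t₀ * curveX t₀ q a b t₀ + curveY t₀ q a t₀ * curveY t₀ q a t₀) * _ = 1
    have hX : curveX t₀ q a b t₀ = Real.exp (-(a / 2)) := linSol_self _ _ _ _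
    have hY : curveY t₀ q a t₀ = 0 := linSol_self _ _ _ _
    rw [hX, hY, ← Real.exp_add, mul_zero, add_zero, ← Real.exp_add, Real.exp_eq_one_iff]
    ring
  have hi := Ring.inverse_mul_cancel _ hu
  linear_combination Ring.inverse (radiusSq t₀ q a b) * h1 -
    NormedSpace.exp (keplerSol t₀ q a b) * hi

/-- The nonlinear equation is solved through the linear one, by the radius of a plane curve of
solutions with Wronskian 1. Solutions therefore exist on the whole interval and depend smoothly on
q, a and b. -/
theorem isKepler_keplerSol : IsKepler q (keplerSol t₀ q a b) (keplerSol' t₀ q a b) := by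
  refine ⟨isDer_keplerSol t₀ q a b, ?_⟩
  have hx := isLinSol_linSol t₀ q (Real.exp (-(a / 2))) (-(b / 2) * Real.exp (-(a / 2)))
  have hy := isLinSol_linSol t₀ q 0 (Real.exp (a / 2))
  have h1 : IsDer (keplerSol' t₀ q a b) _ :=
    (((hx.1.mul hx.2).add (hy.1.mul hy.2)).smul 2).neg.mul
      ((isDer_keplerSol t₀ q a b).exp.congr rfl |> fun h => by
        rwa [exp_keplerSol] at h)
  refine h1.congr ?_
  rw [kepler, exp_keplerSol]
  ext t
  have hi := ringInverse_apply (isUnit_radiusSq t₀ q a b) t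
  have hw := wronskian_curve t₀ q a b t
  rw [keplerSol']
  simp only [radiusSq, curveX, curveX', curveY, curveY', ContinuousMap.add_apply,
    ContinuousMap.mul_apply, ContinuousMap.smul_apply, ContinuousMap.neg_apply,
    ContinuousMap.sub_apply, smul_eq_mul] at hi hw ⊢
  generalize (Ring.inverse _ : CI) t = r at *
  generalize linSol t₀ q (Real.exp (-(a / 2))) (-(b / 2) * Real.exp (-(a / 2))) t = x at *
  generalize linSol' t₀ q (Real.exp (-(a / 2))) (-(b / 2) * Real.exp (-(a / 2))) t = x' at *
  generalize linSol t₀ q 0 (Real.exp (a / 2)) t = y at *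
  generalize linSol' t₀ q 0 (Real.exp (a / 2)) t = y' at *
  generalize q t = Q at *
  -- Here `hi` says (x² + y²) r = 1 and `hw` says xy' - yx' = 1. The identity behind the computation
  -- is (xx' + yy')² + (xy' - yx')² = (x² + y²)(x'² + y'²).
  linear_combination (-2 * Q + 2 * r * (x' ^ 2 + y' ^ 2)) * hi -
    2 * r ^ 2 * (x * y' - y * x' + 1) * hw

end Kepler

section Family

variable {X : Type*} [NormedAddCommGroup X] [NormedSpace ℝ X] (t₀ : Icc (0 : ℝ) (2 * Real.pi))
  {q w w₁ : X → CI} {a b : X → ℝ} {k : ℕ}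

theorem contDiff_keplerSol' (hq : ContDiff ℝ ∞ q) (ha : ContDiff ℝ ∞ a) (hb : ContDiff ℝ ∞ b) :
    ContDiff ℝ ∞ fun x => keplerSol' t₀ (q x) (a x) (b x) := by
  have he : ContDiff ℝ ∞ fun x => Real.exp (-(a x / 2)) := (ha.div_const 2).neg.exp
  have he' : ContDiff ℝ ∞ fun x => Real.exp (a x / 2) := (ha.div_const 2).exp
  have hb' : ContDiff ℝ ∞ fun x => -(b x / 2) * Real.exp (-(a x / 2)) :=
    (hb.div_const 2).neg.mul he
  have hX := contDiff_linSol t₀ hq he hb'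
  have hX' := contDiff_linSol' t₀ hq he hb'
  have hY := contDiff_linSol t₀ hq contDiff_const (α := fun _ => 0) he'
  have hY' := contDiff_linSol' t₀ hq contDiff_const (α := fun _ => 0) he'
  have hr : ContDiff ℝ ∞ fun x => radiusSq t₀ (q x) (a x) (b x) := (hX.mul hX).add (hY.mul hY)
  have hi := contDiff_ringInverse_comp hr fun x => isUnit_radiusSq t₀ (q x) (a x) (b x)
  exact (((hX.mul hX').add (hY.mul hY')).const_smul (2 : ℝ)).neg.mul hi

theorem contDiff_keplerSol (hq : ContDiff ℝ ∞ q) (ha : ContDiff ℝ ∞ a) (hb : ContDiff ℝ ∞ b) :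
    ContDiff ℝ ∞ fun x => keplerSol t₀ (q x) (a x) (b x) := by
  have h := contDiff_keplerSol' t₀ hq ha hb
  have h1 := prim.contDiff (n := ∞).comp h
  exact (ha.smul contDiff_const).add (h1.sub (((ev t₀).contDiff.comp h1).smul contDiff_const))

theorem SmoothFamily.kepler (hw : SmoothFamily k w) (hw₁ : SmoothFamily k w₁) :
    SmoothFamily k fun x => kepler (w x) (w₁ x) :=
  ((hw₁.mul hw₁).const_smul _).sub (hw.exp.mul hw.exp)

/-- Bootstrapping: w'' is a smooth expression in q, w and w', so each pass gains one derivative of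
w', until the regularity of q is exhausted. -/
theorem SmoothFamily.of_isKepler (hq : SmoothFamily k q) (hw : ContDiff ℝ ∞ w)
    (hw₁ : ContDiff ℝ ∞ w₁) (h : ∀ x, IsKepler (q x) (w x) (w₁ x)) :
    SmoothFamily (k + 2) w ∧ SmoothFamily (k + 1) w₁ := by
  have h1 : ∀ l ≤ k + 1, SmoothFamily l w₁ := fun l hl => by
    induction l with
    | zero => exact hw₁
    | succ l ih =>
      have h1 := ih (by omega)
      have h0 : SmoothFamily l w := (h1.of_isDer hw fun x => (h x).1).of_succ
      exact SmoothFamily.of_isDer hw₁ (fun x => (h x).2)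
        (((hq.mono (by omega)).const_smul _).add ((h0.kepler h1).const_smul _))
  exact ⟨(h1 _ le_rfl).of_isDer hw fun x => (h x).1, h1 _ le_rfl⟩

theorem SmoothFamily.keplerSol (hq : SmoothFamily k q) (ha : ContDiff ℝ ∞ a)
    (hb : ContDiff ℝ ∞ b) :
    SmoothFamily (k + 2) (fun x => keplerSol t₀ (q x) (a x) (b x)) ∧
      SmoothFamily (k + 1) fun x => keplerSol' t₀ (q x) (a x) (b x) :=
  hq.of_isKepler (contDiff_keplerSol t₀ hq.contDiff ha hb) (contDiff_keplerSol' t₀ hq.contDiff ha hb)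
    fun _ => isKepler_keplerSol _ _ _ _

end Family

/-! ### The fundamental matrix in Kepler coordinates -/

/-- The cosine of a continuous function. -/
def cosCI (f : CI) : CI := ⟨fun t => Real.cos (f t), Real.continuous_cos.comp f.continuous⟩

/-- The sine of a continuous function. -/
def sinCI (f : CI) : CI := ⟨fun t => Real.sin (f t), Real.continuous_sin.comp f.continuous⟩

theorem IsDer.cosCI {f f' : CI} (h : IsDer f f') : IsDer (cosCI f) (-sinCI f * f') :=
  fun t ht => (h t ht).cos

theorem IsDer.sinCI {f f' : CI} (h : IsDer f f') : IsDer (sinCI f) (Hill.cosCI f * f') :=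
  fun t ht => (h t ht).sin

/-- The entries of the fundamental matrix, in terms of the solution `w` of the Kepler equation. -/
def fundEntry (w w₁ : CI) : Fin 2 → Fin 2 → CI :=
  ![![NormedSpace.exp ((-1 / 2 : ℝ) • w) * cosCI (prim (NormedSpace.exp w)),
      NormedSpace.exp ((-1 / 2 : ℝ) • w) * sinCI (prim (NormedSpace.exp w))],
    ![-(NormedSpace.exp ((1 / 2 : ℝ) • w) * sinCI (prim (NormedSpace.exp w))) -
        NormedSpace.exp ((-1 / 2 : ℝ) • w) * (((1 / 2 : ℝ) • w₁) *
          cosCI (prim (NormedSpace.exp w))),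
      NormedSpace.exp ((1 / 2 : ℝ) • w) * cosCI (prim (NormedSpace.exp w)) -
        NormedSpace.exp ((-1 / 2 : ℝ) • w) * (((1 / 2 : ℝ) • w₁) *
          sinCI (prim (NormedSpace.exp w)))]]

/-- A curve of radius exp(-w/2) and angular speed exp w has Wronskian 1, so its acceleration is
parallel to its position; the factor of proportionality is q by the Kepler equation. -/
theorem IsKepler.isLinSol_fundEntry {q w w₁ : CI} (h : IsKepler q w w₁) (i : Fin 2) :
    IsLinSol q (fundEntry w w₁ 0 i) (fundEntry w w₁ 1 i) := by
  obtain ⟨h0, h1⟩ := h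
  have hθ := isDer_prim (NormedSpace.exp w)
  have hm := (h0.smul (-1 / 2 : ℝ)).exp
  have hp := (h0.smul (1 / 2 : ℝ)).exp
  have e1 : ∀ t, NormedSpace.exp w t = Real.exp (w t / 2) * Real.exp (w t / 2) := fun t => by
    rw [exp_apply, ← Real.exp_add]
    ring_nf
  have e2 : ∀ t, NormedSpace.exp ((-1 / 2 : ℝ) • w) t = Real.exp (-(w t / 2)) := fun t => by
    rw [exp_apply]
    simp
    ring_nf
  have e3 : ∀ t, NormedSpace.exp ((1 / 2 : ℝ) • w) t = Real.exp (w t / 2) := fun t => by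
    rw [exp_apply]
    simp
    ring_nf
  have e4 : ∀ t, Real.exp (-(w t / 2)) * Real.exp (w t / 2) = 1 := fun t => by
    rw [← Real.exp_add]
    simp
  fin_cases i
  · refine ⟨(hm.mul hθ.cosCI).congr ?_, ((hp.mul hθ.sinCI).neg.sub
      (hm.mul ((h1.smul (1 / 2 : ℝ)).mul hθ.cosCI))).congr ?_⟩
    · ext t
      simp only [fundEntry, Matrix.cons_val_zero, Matrix.cons_val_one, Fin.zero_eta, Fin.mk_one,
        ContinuousMap.add_apply, ContinuousMap.mul_apply, ContinuousMap.smul_apply,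
        ContinuousMap.neg_apply, ContinuousMap.sub_apply, smul_eq_mul, e1, e2, e3]
      linear_combination (-Real.exp (w t / 2) *
        sinCI (prim (NormedSpace.exp w)) t) * e4 t
    · ext t
      simp only [fundEntry, kepler, Matrix.cons_val_zero, Matrix.cons_val_one, Fin.zero_eta,
        ContinuousMap.add_apply, ContinuousMap.mul_apply, ContinuousMap.smul_apply,
        ContinuousMap.neg_apply, ContinuousMap.sub_apply, smul_eq_mul, e1, e2, e3]
      linear_combination (Real.exp (w t / 2) * w₁ t / 2 * sinCI (prim (NormedSpace.exp w)) t +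
        Real.exp (w t / 2) ^ 3 * cosCI (prim (NormedSpace.exp w)) t) * e4 t
  · refine ⟨(hm.mul hθ.sinCI).congr ?_, ((hp.mul hθ.cosCI).sub
      (hm.mul ((h1.smul (1 / 2 : ℝ)).mul hθ.sinCI))).congr ?_⟩
    · ext t
      simp only [fundEntry, Matrix.cons_val_zero, Matrix.cons_val_one, Fin.zero_eta, Fin.mk_one,
        ContinuousMap.add_apply, ContinuousMap.mul_apply, ContinuousMap.smul_apply,
        ContinuousMap.neg_apply, ContinuousMap.sub_apply, smul_eq_mul, e1, e2, e3]
      linear_combination (Real.exp (w t / 2) *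
        cosCI (prim (NormedSpace.exp w)) t) * e4 t
    · ext t
      simp only [fundEntry, kepler, Matrix.cons_val_zero, Matrix.cons_val_one, Fin.mk_one,
        ContinuousMap.add_apply, ContinuousMap.mul_apply, ContinuousMap.smul_apply,
        ContinuousMap.neg_apply, ContinuousMap.sub_apply, smul_eq_mul, e1, e2, e3]
      linear_combination (-Real.exp (w t / 2) * w₁ t / 2 * cosCI (prim (NormedSpace.exp w)) t +
        Real.exp (w t / 2) ^ 3 * sinCI (prim (NormedSpace.exp w)) t) * e4 t

theorem fundEntry_left {w w₁ : CI} (h : w left = 0) (h₁ : w₁ left = 0) (i j : Fin 2) :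
    fundEntry w w₁ i j left = (1 : Matrix (Fin 2) (Fin 2) ℝ) i j := by
  fin_cases i <;> fin_cases j <;> simp [fundEntry, exp_apply, h, h₁, cosCI, sinCI, prim_left]

/-- Both solutions build the fundamental matrix of the same q, and w is recovered from the squared
radius exp(-w) of its first row. -/
theorem IsKepler.unique {q w w₁ z z₁ : CI} (hw : IsKepler q w w₁) (hz : IsKepler q z z₁)
    (h : w left = 0) (h₁ : w₁ left = 0) (h' : z left = 0) (h₁' : z₁ left = 0) : w = z := by
  have key : ∀ i, fundEntry w w₁ 0 i = fundEntry z z₁ 0 i := fun i =>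
    (hw.isLinSol_fundEntry i).unique (hz.isLinSol_fundEntry i)
      (by rw [fundEntry_left h h₁, fundEntry_left h' h₁'])
      (by rw [fundEntry_left h h₁, fundEntry_left h' h₁'])
  have hr : ∀ (w w₁ : CI) (t : Icc (0 : ℝ) (2 * Real.pi)),
      fundEntry w w₁ 0 0 t ^ 2 + fundEntry w w₁ 0 1 t ^ 2 = Real.exp (-w t) := fun w w₁ t => by
    simp [fundEntry, exp_apply, cosCI, sinCI]
    rw [mul_pow, mul_pow, ← mul_add, Real.cos_sq_add_sin_sq, mul_one, ← Real.exp_nat_mul]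
    ring_nf
  ext t
  have := hr w w₁ t
  rw [key 0, key 1, hr z z₁ t] at this
  linarith [Real.exp_injective this]

/-! ### Propagation of jets through the Kepler equation -/

section Jets

variable {t : Icc (0 : ℝ) (2 * Real.pi)} {k : ℕ} {q p w w₁ z z₁ : CI}

theorem VanishAt.exp_sub_exp (h : VanishAt t k (w - z)) (hw : IsCk k w) (hz : IsCk k z) :
    VanishAt t k (NormedSpace.exp w - NormedSpace.exp z) := by
  induction k generalizing w z with
  | zero =>
    have h1 : w t - z t = 0 := h
    change NormedSpace.exp w t - NormedSpace.exp z t = 0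
    rw [exp_apply, exp_apply, sub_eq_zero.1 h1, sub_self]
  | succ k ih =>
    have h1 : w t - z t = 0 := h.apply
    have hw0 := SmoothFamily.of_succ hw
    have hz0 := SmoothFamily.of_succ hz
    obtain ⟨_, w', hw, hw'⟩ := hw
    obtain ⟨_, z', hz, hz'⟩ := hz
    have hd := (hw 0).sub (hz 0)
    refine vanishAt_succ ?_ ((hw 0).exp.sub (hz 0).exp) ?_
    · change NormedSpace.exp w t - NormedSpace.exp z t = 0
      rw [exp_apply, exp_apply, sub_eq_zero.1 h1, sub_self]
    -- (exp w - exp z)' = (w' - z') exp w + (exp w - exp z) z'.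
    · have h2 := VanishAt.mul (h.deriv hd) hw0.exp
      have h3 := VanishAt.mul (ih h.of_succ hw0 hz0) (SmoothFamily.isCk hz' 0)
      refine cast ?_ (h2.add h3)
      congr 1
      ring

theorem VanishAt.kepler_sub_kepler (h : VanishAt t k (w - z)) (h₁ : VanishAt t k (w₁ - z₁))
    (hw : IsCk k w) (hz : IsCk k z) (hw₁ : IsCk k w₁) (hz₁ : IsCk k z₁) :
    VanishAt t k (kepler w w₁ - kepler z z₁) := by
  have h2 := VanishAt.smul (1 / 4) (VanishAt.mul h₁ (SmoothFamily.add hw₁ hz₁))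
  have h3 := VanishAt.mul (h.exp_sub_exp hw hz) (SmoothFamily.add hw.exp hz.exp)
  refine cast ?_ (h2.sub h3)
  congr 1
  ext s
  simp [kepler]
  ring

theorem IsKepler.isCk (h : IsKepler q w w₁) (hq : IsCk k q) : IsCk (k + 2) w ∧ IsCk (k + 1) w₁ :=
  SmoothFamily.of_isKepler (X := ℝ) (q := fun _ => q) (w := fun _ => w) (w₁ := fun _ => w₁) hq
    contDiff_const contDiff_const fun _ => h

/-- The equation expresses w'' through w, w' and q, so agreement at one order passes to the next as
long as the jets of the potentials agree. -/
theorem IsKepler.vanishAt (hw : IsKepler q w w₁) (hz : IsKepler p z z₁) (h : w t = z t)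
    (h₁ : w₁ t = z₁ t) (hq : IsCk k q) (hp : IsCk k p) (hqp : VanishAt t k (q - p)) :
    VanishAt t (k + 2) (w - z) ∧ VanishAt t (k + 1) (w₁ - z₁) := by
  have hv : w t - z t = 0 := sub_eq_zero.2 h
  have hv₁ : w₁ t - z₁ t = 0 := sub_eq_zero.2 h₁
  have cw := hw.isCk hq
  have cz := hz.isCk hp
  have key : ∀ l ≤ k + 1, VanishAt t l (w₁ - z₁) := fun l hl => by
    induction l with
    | zero => exact hv₁
    | succ l ih =>
      have h1 := ih (by omega)
      have h0 : VanishAt t l (w - z) := (vanishAt_succ hv (hw.1.sub hz.1) h1).of_succ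
      refine vanishAt_succ hv₁ (hw.2.sub hz.2) ?_
      have h2 := VanishAt.kepler_sub_kepler h0 h1 (cw.1.mono (by omega)) (cz.1.mono (by omega))
        (cw.2.mono (by omega)) (cz.2.mono (by omega))
      refine cast ?_ ((VanishAt.smul (-2) (hqp.mono (show l ≤ k by omega))).add
        (VanishAt.smul 2 h2))
      congr 1
      module
  exact ⟨vanishAt_succ hv (hw.1.sub hz.1) (key _ le_rfl), key _ le_rfl⟩

end Jets

/-! ### Sobolev functions as continuous functions, and straightening the periodicity conditions -/

/-! ### Continuous representatives of Sobolev functions -/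

/-- A continuous function on `[0, 2π]` as an element of `L²`. -/
def toL2 : CI →L[ℝ] L2Circle :=
  LinearMap.mkContinuous
    { toFun := fun f => MemLp.toLp (ext f) (MemLp.of_bound
        (continuous_ext f).aestronglyMeasurable ‖f‖ (Filter.Eventually.of_forall (abs_ext_le f)))
      map_add' := fun _ _ => rfl
      map_smul' := fun _ _ => rfl }
    ((measureUnivNNReal circleMeasure : ℝ) ^ (2 : ENNReal).toReal⁻¹) fun f => by
      refine Lp.norm_le_of_ae_bound (norm_nonneg f) ?_
      filter_upwards [MemLp.coeFn_toLp (MemLp.of_bound (μ := circleMeasure) (p := 2)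
        (continuous_ext f).aestronglyMeasurable ‖f‖
        (Filter.Eventually.of_forall (abs_ext_le f)))] with t ht
      exact (congrArg norm ht).trans_le (abs_ext_le f t)

theorem coeFn_toL2 (f : CI) : (toL2 f : ℝ → ℝ) =ᵐ[circleMeasure] ext f :=
  MemLp.coeFn_toLp (MemLp.of_bound (continuous_ext f).aestronglyMeasurable ‖f‖
    (Filter.Eventually.of_forall (abs_ext_le f)))

theorem integral_norm_le (v : L2Circle) :
    ∫ t, ‖v t‖ ∂circleMeasure ≤
      ‖v‖ * (circleMeasure univ ^ (1 / (1 : ENNReal).toReal - 1 / (2 : ENNReal).toReal)).toReal := by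
  have h := eLpNorm_le_eLpNorm_mul_rpow_measure_univ (p := 1) (q := 2) (μ := circleMeasure)
    (by norm_num) (Lp.memLp v).aestronglyMeasurable
  rw [integral_norm_eq_lintegral_enorm (Lp.memLp v).aestronglyMeasurable,
    ← eLpNorm_one_eq_lintegral_enorm, Lp.norm_def, ← ENNReal.toReal_mul]
  refine ENNReal.toReal_mono (ENNReal.mul_ne_top (Lp.eLpNorm_ne_top v) ?_) h
  exact ENNReal.rpow_ne_top_of_nonneg (by norm_num) (measure_ne_top _ _)

theorem L2Circle.intervalIntegrable_zero (v : L2Circle) {t : ℝ}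
    (ht : t ∈ Icc (0 : ℝ) (2 * Real.pi)) : IntervalIntegrable (v : ℝ → ℝ) volume 0 t :=
  L2Circle.intervalIntegrable v left.2 ht

/-- The primitive vanishing at `0` of a square integrable function. -/
def primL2 : L2Circle →L[ℝ] CI :=
  LinearMap.mkContinuous
    { toFun := fun v => ⟨fun t => ∫ s in (0 : ℝ)..t, v s, by
        have h : ContinuousOn (fun t : ℝ => ∫ s in (0 : ℝ)..t, v s) (Icc 0 (2 * Real.pi)) := by
          have := intervalIntegral.continuousOn_primitive_interval (μ := volume) (f := v)
            (a := 0) (b := 2 * Real.pi) (by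
              rw [uIcc_of_le zero_le_two_pi]
              have h : Integrable (v : ℝ → ℝ) circleMeasure :=
                (Lp.memLp v).integrable (by norm_num)
              exact h)
          rwa [uIcc_of_le zero_le_two_pi] at this
        exact continuousOn_iff_continuous_domRestrict.1 h⟩
      map_add' := fun u v => by
        ext t
        change ∫ s in (0 : ℝ)..t, (u + v : L2Circle) s = _
        rw [L2Circle.integral_congr (Lp.coeFn_add u v) t.2]
        exact intervalIntegral.integral_add (L2Circle.intervalIntegrable_zero _ t.2)
          (L2Circle.intervalIntegrable_zero _ t.2)
      map_smul' := fun a v => by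
        ext t
        change ∫ s in (0 : ℝ)..t, (a • v : L2Circle) s = _
        rw [L2Circle.integral_congr (Lp.coeFn_smul a v) t.2]
        exact intervalIntegral.integral_smul a v }
    (circleMeasure univ ^ (1 / (1 : ENNReal).toReal - 1 / (2 : ENNReal).toReal)).toReal fun v => by
      refine (ContinuousMap.norm_le _ (by positivity)).2 fun t => ?_
      have hi : Integrable (fun s => ‖v s‖) circleMeasure :=
        ((Lp.memLp v).integrable (by norm_num)).norm
      have h1 : ‖∫ s in (0 : ℝ)..t, v s‖ ≤ ∫ s in Ioc 0 (t : ℝ), ‖v s‖ := by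
        rw [intervalIntegral.integral_of_le t.2.1]
        exact norm_integral_le_integral_norm _
      have h2 : ∫ s in Ioc 0 (t : ℝ), ‖v s‖ ≤ ∫ s, ‖v s‖ ∂circleMeasure :=
        setIntegral_mono_set hi (Filter.Eventually.of_forall fun s => norm_nonneg _)
          (Filter.Eventually.of_forall fun s hs => ⟨hs.1.le, hs.2.trans t.2.2⟩)
      exact (h1.trans (h2.trans (integral_norm_le v))).trans_eq (mul_comm _ _)

theorem primL2_apply (v : L2Circle) (t : Icc (0 : ℝ) (2 * Real.pi)) :
    primL2 v t = ∫ s in (0 : ℝ)..t, v s := rfl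

theorem primL2_left (v : L2Circle) : primL2 v left = 0 := intervalIntegral.integral_same

theorem primL2_toL2 (f : CI) : primL2 (toL2 f) = prim f := by
  ext t
  exact L2Circle.integral_congr (coeFn_toL2 f) t.2

theorem toL2_injective : Function.Injective toL2 := fun f g h => by
  have h1 := congrArg primL2 h
  rw [primL2_toL2, primL2_toL2] at h1
  exact (isDer_prim f).unique (h1 ▸ isDer_prim g)

/-- Lebesgue differentiation: almost everywhere v is the derivative of its primitive. The end points
are discarded so that two-sided derivatives can be compared. -/
theorem primL2_eq_zero {v : L2Circle} (h : primL2 v = 0) : v = 0 := by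
  refine Lp.ext ?_
  refine Filter.EventuallyEq.trans ?_ (Lp.coeFn_zero _ _ _).symm
  have h0 : ∀ t ∈ Icc (0 : ℝ) (2 * Real.pi), ∫ s in (0 : ℝ)..t, v s = 0 := fun t ht =>
    congrArg (fun f : CI => f ⟨t, ht⟩) h
  have hne : ∀ a : ℝ, ∀ᵐ x : ℝ, x ≠ a := fun a => by simp [ae_iff, measure_singleton]
  rw [Filter.EventuallyEq, ae_restrict_iff' measurableSet_Icc]
  filter_upwards [(L2Circle.intervalIntegrable_zero v two_pi_mem).ae_hasDerivAt_integral, hne 0,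
    hne (2 * Real.pi)] with x hx x0 x1 hm
  rw [uIcc_of_le zero_le_two_pi] at hx
  have h1 := hx hm 0 left.2
  have h2 : HasDerivAt (fun x => ∫ t in (0 : ℝ)..x, v t) 0 x := by
    refine (hasDerivAt_const x (0 : ℝ)).congr_of_eventuallyEq ?_
    filter_upwards [Icc_mem_nhds (lt_of_le_of_ne hm.1 x0.symm) (lt_of_le_of_ne hm.2 x1)] with y hy
    exact h0 y hy
  exact h1.unique h2

/-- Uniqueness of the weak derivative: the values at 0 compare the constants, which leaves equal
primitives. -/
theorem toL2_const_add_primL2_inj {u v : L2Circle} {c d : ℝ}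
    (h : toL2 (c • 1 + primL2 u) = toL2 (d • 1 + primL2 v)) : u = v := by
  have h1 := toL2_injective h
  have h0 := congrArg (fun f : CI => f left) h1
  simp only [ContinuousMap.add_apply, primL2_left, ContinuousMap.smul_apply,
    ContinuousMap.one_apply, smul_eq_mul, mul_one, add_zero] at h0
  rw [h0, add_right_inj] at h1
  exact sub_eq_zero.1 (primL2_eq_zero (by rw [map_sub, h1, sub_self]))

theorem isPeriodicDeriv_iff {u v : L2Circle} : IsPeriodicDeriv u v ↔
    (∃ c : ℝ, u = toL2 (c • 1 + primL2 v)) ∧ primL2 v right = 0 := by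
  have key : ∀ c : ℝ, (toL2 (c • 1 + primL2 v) : ℝ → ℝ) =ᵐ[circleMeasure]
      fun t => c + ∫ s in (0 : ℝ)..t, v s := fun c => by
    filter_upwards [coeFn_toL2 (c • 1 + primL2 v), ae_restrict_mem measurableSet_Icc] with t ht hm
    rw [ht, ext_of_mem _ hm, ContinuousMap.add_apply, primL2_apply]
    simp
  refine and_congr ⟨fun ⟨c, hc⟩ => ⟨c, Lp.ext (hc.trans (key c).symm)⟩,
    fun ⟨c, hc⟩ => ⟨c, hc ▸ key c⟩⟩ Iff.rfl

/-- The continuous representative of a function `u` with derivative `v`. -/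
def reprL2 : (L2Circle × L2Circle) →L[ℝ] CI :=
  ((((2 * Real.pi)⁻¹ : ℝ) • ((ev right).comp (primL2.comp (ContinuousLinearMap.fst ℝ _ _)) -
    (ev right).comp (prim.comp (primL2.comp (ContinuousLinearMap.snd ℝ _ _))))).smulRight
      (1 : CI)) + primL2.comp (ContinuousLinearMap.snd ℝ _ _)

theorem prim_one_right : prim 1 right = 2 * Real.pi := by
  rw [prim_apply]
  have : ext 1 = fun _ => 1 := rfl
  rw [this]
  simp [right]

/-- Integrating u = c + ∫ v over the period gives ∫ u = 2πc + ∬ v, and `reprL2` contains this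
equation solved for c. Written so, the representative is a continuous linear function of an
arbitrary pair in L². -/
theorem reprL2_eq {u v : L2Circle} {c : ℝ} (h : u = toL2 (c • 1 + primL2 v)) :
    reprL2 (u, v) = c • 1 + primL2 v := by
  have h1 : primL2 u right = c * (2 * Real.pi) + prim (primL2 v) right := by
    rw [h, primL2_toL2, map_add, map_smul]
    simp [prim_one_right]
  have h2 : reprL2 (u, v) =
      ((2 * Real.pi)⁻¹ * (primL2 u right - prim (primL2 v) right)) • 1 + primL2 v := rfl
  rw [h2, h1]
  congr 2
  field_simp
  ring

theorem toL2_reprL2 {u v : L2Circle} (h : IsPeriodicDeriv u v) : toL2 (reprL2 (u, v)) = u := by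
  obtain ⟨⟨c, hc⟩, _⟩ := isPeriodicDeriv_iff.1 h
  rw [reprL2_eq hc, ← hc]

theorem reprL2_toL2 {f g : CI} (h : IsDer f g) : reprL2 (toL2 f, toL2 g) = f := by
  have e : f = f left • 1 + primL2 (toL2 g) := by rw [primL2_toL2, ← h.eq]
  rw [reprL2_eq (c := f left) (by rw [← e]), ← e]

theorem reprL2_periodic {u v : L2Circle} (h : IsPeriodicDeriv u v) :
    reprL2 (u, v) left = reprL2 (u, v) right := by
  obtain ⟨⟨c, hc⟩, h0⟩ := isPeriodicDeriv_iff.1 h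
  rw [reprL2_eq hc, ContinuousMap.add_apply, ContinuousMap.add_apply, h0, primL2_left]
  simp

theorem isDer_reprL2 {u v w : L2Circle} (huv : IsPeriodicDeriv u v) (hvw : IsPeriodicDeriv v w) :
    IsDer (reprL2 (u, v)) (reprL2 (v, w)) := by
  obtain ⟨⟨c, hc⟩, _⟩ := isPeriodicDeriv_iff.1 huv
  rw [reprL2_eq hc]
  conv_lhs => rw [← toL2_reprL2 hvw, primL2_toL2]
  exact isDer_smul_one_add_prim _ _

theorem isPeriodicDeriv_toL2 {f g : CI} (h : IsDer f g) (hp : f left = f right) :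
    IsPeriodicDeriv (toL2 f) (toL2 g) := by
  rw [isPeriodicDeriv_iff, primL2_toL2]
  refine ⟨⟨f left, by rw [← h.eq]⟩, ?_⟩
  have := h.apply_eq right
  linarith

/-- The `j`-th derivative of a Sobolev function, as an element of `L²`. -/
def coord (p : ℕ) (j : Fin (p + 1)) : sobolevCircle p →L[ℝ] L2Circle :=
  (PiLp.proj 2 (fun _ : Fin (p + 1) => L2Circle) j).comp (sobolevCircle p).subtypeL

/-- The continuous representative of the `j`-th derivative of a function in `H^p`, for `j < p`. -/
def rep (p : ℕ) (j : Fin p) : sobolevCircle p →L[ℝ] CI :=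
  reprL2.comp ((coord p j.castSucc).prod (coord p j.succ))

section Rep

variable {p : ℕ}

theorem toL2_rep (j : Fin p) (u : sobolevCircle p) : toL2 (rep p j u) = u.1 j.castSucc :=
  toL2_reprL2 (u.2 j)

theorem rep_periodic (j : Fin p) (u : sobolevCircle p) : rep p j u left = rep p j u right :=
  reprL2_periodic (u.2 j)

theorem isDer_rep (j : Fin p) (k : Fin p) (h : (k : ℕ) = j + 1) (u : sobolevCircle p) :
    IsDer (rep p j u) (rep p k u) := by
  have h1 := isDer_reprL2 (u.2 j) (w := u.1 k.succ) (by
    have h2 := u.2 k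
    have e : k.castSucc = j.succ := Fin.ext (by simp [h])
    rwa [e] at h2)
  have e : k.castSucc = j.succ := Fin.ext (by simp [h])
  change IsDer _ (reprL2 (u.1 k.castSucc, _))
  rw [e]
  exact h1

/-- The function alone determines the tuple of its derivatives. -/
theorem ext_of_coord_zero {u v : sobolevCircle p} (h : u.1 0 = v.1 0) : u = v := by
  have key : ∀ j (hj : j < p + 1), u.1 ⟨j, hj⟩ = v.1 ⟨j, hj⟩ := fun j => by
    induction j with
    | zero => exact fun _ => h
    | succ j ih =>
      intro hj
      have h1 := ih (by omega)
      obtain ⟨⟨c, hc⟩, _⟩ := isPeriodicDeriv_iff.1 (u.2 ⟨j, by omega⟩)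
      obtain ⟨⟨d, hd⟩, _⟩ := isPeriodicDeriv_iff.1 (v.2 ⟨j, by omega⟩)
      exact toL2_const_add_primL2_inj (hc.symm.trans (h1.trans hd))
  exact Subtype.ext (PiLp.ext fun j => key j j.2)

theorem rep_injective {m : ℕ} : Function.Injective (rep (m + 1) 0) := fun u v h => by
  refine ext_of_coord_zero ?_
  have h1 := toL2_rep 0 u
  rw [h, toL2_rep] at h1
  exact h1.symm

/-- Of the m + 1 derivatives only the first m have continuous representatives; the last one is
merely square integrable. -/
theorem smoothFamily_rep {m : ℕ} : SmoothFamily m (rep (m + 1) 0) := by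
  have key : ∀ k (j : Fin (m + 1)), (j : ℕ) + k = m → SmoothFamily k (rep (m + 1) j) := fun k => by
    induction k with
    | zero => exact fun j _ => (rep (m + 1) j).contDiff
    | succ k ih =>
      intro j hj
      exact SmoothFamily.of_isDer (rep (m + 1) j).contDiff
        (isDer_rep j ⟨j + 1, by omega⟩ rfl) (ih ⟨j + 1, by omega⟩ (by simp only; omega))
  exact key m 0 (by simp)

/-- The derivatives at `0` of a function in `H^{m+1}`, up to order `m`. -/
def jet (m : ℕ) : sobolevCircle (m + 1) →L[ℝ] (Fin (m + 1) → ℝ) :=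
  ContinuousLinearMap.pi fun j => (ev left).comp (rep (m + 1) j)

/-- Extension of a finite sequence by zero. -/
def extendSeq {n : ℕ} (c : Fin n → ℝ) (j : ℕ) : ℝ := if h : j < n then c ⟨j, h⟩ else 0

theorem extendSeq_zero {n : ℕ} : extendSeq (0 : Fin n → ℝ) = 0 := by
  funext j
  simp [extendSeq]

theorem contDiff_extendSeq {n : ℕ} (j : ℕ) : ContDiff ℝ ∞ fun c : Fin n → ℝ => extendSeq c j := by
  by_cases h : j < n
  · simp only [extendSeq, h, dite_true]
    fun_prop
  · simp only [extendSeq, h, dite_false]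
    fun_prop

theorem jetAt_rep_jet {m : ℕ} (u : sobolevCircle (m + 1)) :
    JetAt left m (rep (m + 1) 0 u) (extendSeq (jet m u)) ∧
      JetAt right m (rep (m + 1) 0 u) (extendSeq (jet m u)) := by
  have key : ∀ k (j : Fin (m + 1)), (j : ℕ) + k = m →
      JetAt left k (rep (m + 1) j u) (fun i => extendSeq (jet m u) (j + i)) ∧
      JetAt right k (rep (m + 1) j u) (fun i => extendSeq (jet m u) (j + i)) := fun k => by
    have h0 : ∀ j : Fin (m + 1), rep (m + 1) j u left = extendSeq (jet m u) (j + 0) := fun j => by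
      simp only [add_zero, extendSeq, j.2, dite_true]
      rfl
    have h1 : ∀ j : Fin (m + 1), rep (m + 1) j u right = extendSeq (jet m u) (j + 0) := fun j =>
      (rep_periodic j u).symm.trans (h0 j)
    induction k with
    | zero => exact fun j _ => ⟨h0 j, h1 j⟩
    | succ k ih =>
      intro j hj
      have hd := isDer_rep j ⟨j + 1, by omega⟩ rfl u
      obtain ⟨i0, i1⟩ := ih ⟨j + 1, by omega⟩ (by simp only; omega)
      exact ⟨⟨h0 j, _, hd, i0.congr fun i _ => by congr 1; simp only; omega⟩,
        ⟨h1 j, _, hd, i1.congr fun i _ => by congr 1; simp only; omega⟩⟩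
  have h := key m 0 (by simp)
  exact ⟨h.1.congr fun i _ => by simp, h.2.congr fun i _ => by simp⟩

theorem jet_eq_of_jetAt {m : ℕ} {u : sobolevCircle (m + 1)} {c : Fin (m + 1) → ℝ}
    (h : JetAt left m (rep (m + 1) 0 u) (extendSeq c)) : jet m u = c := by
  have key : ∀ j (hj : j < m + 1),
      JetAt left (m - j) (rep (m + 1) ⟨j, hj⟩ u) (fun i => extendSeq c (j + i)) := fun j => by
    induction j with
    | zero =>
      intro _
      simpa using h
    | succ j ih =>
      intro hj
      have h1 := ih (by omega)
      have e : m - j = (m - (j + 1)) + 1 := by omega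
      rw [e] at h1
      refine (h1.deriv (isDer_rep _ ⟨j + 1, hj⟩ rfl u)).congr fun i _ => ?_
      congr 1
      omega
  funext j
  have h1 := (key j j.2).apply
  rw [add_zero, extendSeq, dif_pos j.2] at h1
  exact h1

end Rep

/-! ### The Hilbert space structure -/

/-- A map with values in K equals its composition with the orthogonal projection onto K, which is
continuous and linear. -/
theorem contDiff_codRestrict {X E : Type*} [NormedAddCommGroup X] [NormedSpace ℝ X]
    [NormedAddCommGroup E] [InnerProductSpace ℝ E] {K : Submodule ℝ E}
    [K.HasOrthogonalProjection] {f : X → E} (hf : ContDiff ℝ ∞ f) (h : ∀ x, f x ∈ K) :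
    ContDiff ℝ ∞ fun x => (⟨f x, h x⟩ : K) := by
  have e : (fun x => (⟨f x, h x⟩ : K)) = fun x => K.orthogonalProjectionOnto (f x) := by
    funext x
    exact (K.orthogonalProjectionOnto_mem_subspace_eq_self ⟨f x, h x⟩).symm
  rw [e]
  exact K.orthogonalProjectionOnto.contDiff.comp hf

/-- Through `reprL2` the existence of the constant of integration becomes an equation between
continuous maps. -/
theorem isClosed_sobolevCircle (p : ℕ) :
    IsClosed (sobolevCircle p : Set (PiLp 2 fun _ : Fin (p + 1) => L2Circle)) := by
  have e : (sobolevCircle p : Set (PiLp 2 fun _ : Fin (p + 1) => L2Circle)) =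
      ⋂ j : Fin p, {u | toL2 (reprL2 (u j.castSucc, u j.succ)) = u j.castSucc ∧
        primL2 (u j.succ) right = 0} := by
    ext u
    simp only [mem_iInter, mem_ofPred_eq]
    refine forall_congr' fun j => ⟨fun h => ⟨toL2_reprL2 h, (isPeriodicDeriv_iff.1 h).2⟩,
      fun h => isPeriodicDeriv_iff.2 ⟨⟨_, h.1.symm⟩, h.2⟩⟩
  rw [e]
  refine isClosed_iInter fun j => ?_
  have h1 : Continuous fun u : PiLp 2 fun _ : Fin (p + 1) => L2Circle => u j.castSucc :=
    (PiLp.proj 2 (fun _ : Fin (p + 1) => L2Circle) j.castSucc : _ →L[ℝ] _).continuous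
  have h2 : Continuous fun u : PiLp 2 fun _ : Fin (p + 1) => L2Circle => u j.succ :=
    (PiLp.proj 2 (fun _ : Fin (p + 1) => L2Circle) j.succ : _ →L[ℝ] _).continuous
  refine (isClosed_eq (toL2.continuous.comp (reprL2.continuous.comp (h1.prodMk h2))) h1).inter
    (isClosed_eq ?_ continuous_const)
  exact (ev right).continuous.comp (primL2.continuous.comp h2)

instance (p : ℕ) : CompleteSpace (sobolevCircle p) :=
  (isClosed_sobolevCircle p).completeSpace_coe

instance (p : ℕ) : TopologicalSpace.SeparableSpace (sobolevCircle p) := by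
  have : Fact ((2 : ENNReal) ≠ ⊤) := ⟨by norm_num⟩
  have h0 : SecondCountableTopology L2Circle := inferInstance
  have h1 : TopologicalSpace.SeparableSpace (PiLp 2 fun _ : Fin (p + 1) => L2Circle) :=
    (WithLp.toLp_surjective 2).denseRange.separableSpace
      (PiLp.continuous_toLp 2 fun _ : Fin (p + 1) => L2Circle)
  have h2 := UniformSpace.secondCountable_of_separable
    (PiLp 2 fun _ : Fin (p + 1) => L2Circle)
  infer_instance

/-- A smooth family of periodic functions with `m + 1` derivatives is a smooth family in
`H^{m+1}`. -/
theorem exists_contDiff_rep_eq {X : Type*} [NormedAddCommGroup X] [NormedSpace ℝ X] {m : ℕ}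
    {F : X → CI} (hF : SmoothFamily (m + 1) F) (hp : ∀ x, PeriodicCk m (F x)) :
    ∃ u : X → sobolevCircle (m + 1), ContDiff ℝ ∞ u ∧ ∀ x, rep (m + 1) 0 (u x) = F x := by
  obtain ⟨D, d0, d1, d2⟩ := hF.exists_deriv
  have hper : ∀ x, ∀ j ≤ m, D j x left = D j x right := fun x => by
    have key : ∀ j ≤ m, PeriodicCk (m - j) (D j x) := fun j => by
      induction j with
      | zero =>
        intro _
        rw [d0]
        exact hp x
      | succ j ih =>
        intro hj
        have h := ih (by omega)
        have e : m - j = (m - (j + 1)) + 1 := by omega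
        rw [e] at h
        obtain ⟨_, g, hg, h2⟩ := h
        rwa [(d2 j (by omega) x).unique hg]
    exact fun j hj => (key j hj).apply
  let U : X → PiLp 2 fun _ : Fin (m + 1 + 1) => L2Circle :=
    fun x => WithLp.toLp 2 fun j => toL2 (D j x)
  have hU : ContDiff ℝ ∞ U := by
    rw [contDiff_piLp]
    intro j
    exact toL2.contDiff.comp (d1 j (by omega))
  have hm : ∀ x, U x ∈ sobolevCircle (m + 1) := fun x j =>
    isPeriodicDeriv_toL2 (d2 j (by omega) x) (hper x j (by omega))
  refine ⟨fun x => ⟨U x, hm x⟩, contDiff_codRestrict hU hm, fun x => ?_⟩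
  change reprL2 (toL2 (D 0 x), toL2 (D 1 x)) = F x
  rw [reprL2_toL2 (d2 0 (by omega) x), d0]

/-! ### Interpolation between the end points -/

/-- The polynomial `t (2π - t)`. -/
def parabola : CI := prim 1 * ((2 * Real.pi) • 1 - prim 1)

theorem parabola_apply (t : Icc (0 : ℝ) (2 * Real.pi)) :
    parabola t = t * (2 * Real.pi - t) := by
  have h : prim 1 t = t := by
    rw [prim_apply]
    have : ext 1 = fun _ => 1 := rfl
    rw [this]
    simp
  simp [parabola, h]

theorem isCk_parabola (k : ℕ) : IsCk k parabola := by
  have h1 : IsCk k (prim 1) := by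
    have h : IsCk k (1 : CI) := by simpa using isCk_smul_one k 1
    exact SmoothFamily.of_succ (SmoothFamily.prim h)
  exact SmoothFamily.mul h1 (SmoothFamily.sub (isCk_smul_one k _) h1)

theorem isCk_parabola_pow (k n : ℕ) : IsCk k (parabola ^ n) := by
  induction n with
  | zero => simpa using isCk_smul_one k 1
  | succ n ih =>
    rw [pow_succ]
    exact SmoothFamily.mul ih (isCk_parabola k)

theorem vanishAt_parabola_pow {t : Icc (0 : ℝ) (2 * Real.pi)} (h : parabola t = 0) (k : ℕ) :
    VanishAt t k (parabola ^ (k + 1)) := by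
  induction k with
  | zero => simpa [JetAt] using h
  | succ k ih =>
    rw [pow_succ]
    exact ih.mul_vanishAt_zero (isCk_parabola _) h (isCk_parabola_pow _ _)

theorem parabola_left : parabola left = 0 := by simp [parabola_apply, left]

theorem parabola_right : parabola right = 0 := by simp [parabola_apply, right]

theorem prim_pos {f : CI} (h : ∀ t : Icc (0 : ℝ) (2 * Real.pi),
    0 < (t : ℝ) → (t : ℝ) < 2 * Real.pi → 0 < f t) : 0 < prim f right := by
  refine intervalIntegral.intervalIntegral_pos_of_pos_on (ext_intervalIntegrable f _ _)
    (fun x hx => ?_) Real.two_pi_pos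
  rw [ext_of_mem f ⟨hx.1.le, hx.2.le⟩]
  exact h ⟨x, hx.1.le, hx.2.le⟩ hx.1 hx.2

theorem parabola_pow_nonneg (n : ℕ) (t : Icc (0 : ℝ) (2 * Real.pi)) : 0 ≤ (parabola ^ n) t := by
  rw [ContinuousMap.pow_apply, parabola_apply]
  exact pow_nonneg (mul_nonneg t.2.1 (sub_nonneg.2 t.2.2)) _

theorem parabola_pow_pos (n : ℕ) (t : Icc (0 : ℝ) (2 * Real.pi)) (h0 : 0 < (t : ℝ))
    (h1 : (t : ℝ) < 2 * Real.pi) : 0 < (parabola ^ n) t := by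
  rw [ContinuousMap.pow_apply, parabola_apply]
  exact pow_pos (mul_pos h0 (sub_pos.2 h1)) _

/-- There is a smooth transition function from `0` at `0` to `1` at `2π`, flat to order `k`. -/
theorem exists_transition (k : ℕ) : ∃ χ : CI, (∀ l, IsCk l χ) ∧ VanishAt left k χ ∧
    VanishAt right k (1 - χ) := by
  -- The transition is the normalized primitive of the power k + 1 of t(2π - t), which vanishes to
  -- order k at both ends.
  have hpos : 0 < prim (parabola ^ (k + 1)) right :=
    prim_pos (parabola_pow_pos _)
  set c := prim (parabola ^ (k + 1)) right with hc
  have hd : IsDer (c⁻¹ • prim (parabola ^ (k + 1))) (c⁻¹ • parabola ^ (k + 1)) :=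
    (isDer_prim _).smul _
  have hd' : IsDer (1 - c⁻¹ • prim (parabola ^ (k + 1))) (-1 • (c⁻¹ • parabola ^ (k + 1)) : CI) :=
    by simpa using (isDer_const 1).sub hd
  refine ⟨c⁻¹ • prim (parabola ^ (k + 1)), fun l => ?_, ?_, ?_⟩
  · exact (IsCk.of_isDer hd (SmoothFamily.const_smul _ (isCk_parabola_pow l _))).of_succ
  · exact (vanishAt_succ (by simp [prim_left]) hd
      ((vanishAt_parabola_pow parabola_left k).smul _)).of_succ
  · refine (vanishAt_succ ?_ hd' ?_).of_succ
    · simp only [ContinuousMap.sub_apply, ContinuousMap.one_apply, ContinuousMap.smul_apply,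
        smul_eq_mul, ← hc]
      rw [inv_mul_cancel₀ hpos.ne', sub_self]
    · simpa using ((vanishAt_parabola_pow parabola_right k).smul c⁻¹).smul (-1)

section Interpolation

variable (m : ℕ)

/-- The potential near an end point, with derivatives prescribed by `c`. -/
def endPotential (t₀ : Icc (0 : ℝ) (2 * Real.pi)) (c : Fin (m + 1) → ℝ) : CI :=
  taylorPoly t₀ m (extendSeq c)

theorem smoothFamily_endPotential {X : Type*} [NormedAddCommGroup X] [NormedSpace ℝ X] (k : ℕ)
    (t₀ : Icc (0 : ℝ) (2 * Real.pi)) {c : X → Fin (m + 1) → ℝ} (hc : ContDiff ℝ ∞ c) :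
    SmoothFamily k fun x => endPotential m t₀ (c x) :=
  smoothFamily_taylorPoly t₀ m k fun j => (contDiff_extendSeq j).comp hc

/-- The model solution near `0`. -/
def startModel (z : ℝ × ℝ × (Fin (m + 1) → ℝ)) : CI :=
  keplerSol left (endPotential m left z.2.2) 0 0

/-- The model solution near `2π`. -/
def endModel (z : ℝ × ℝ × (Fin (m + 1) → ℝ)) : CI :=
  keplerSol right (endPotential m right z.2.2) z.1 z.2.1

/-- J passes from the start model to the end model by means of a flat transition function. Order m +
2 is needed because the jet of order m of a potential involves w up to order m + 2. -/
theorem exists_interpolation : ∃ J : ℝ × ℝ × (Fin (m + 1) → ℝ) → CI, (∀ k, SmoothFamily k J) ∧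
    (∀ z, VanishAt left (m + 2) (J z - startModel m z)) ∧
    ∀ z, VanishAt right (m + 2) (J z - endModel m z) := by
  obtain ⟨χ, hχ, h0, h1⟩ := exists_transition (m + 2)
  have hs : ∀ k, SmoothFamily k (startModel m) := fun k =>
    (SmoothFamily.keplerSol left (smoothFamily_endPotential m k left
      (contDiff_snd.comp contDiff_snd)) contDiff_const contDiff_const).1.mono (by omega)
  have he : ∀ k, SmoothFamily k (endModel m) := fun k =>
    (SmoothFamily.keplerSol right (smoothFamily_endPotential m k right
      (contDiff_snd.comp contDiff_snd)) contDiff_fst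
      (contDiff_fst.comp contDiff_snd)).1.mono (by omega)
  refine ⟨fun z => startModel m z + χ * (endModel m z - startModel m z), fun k => ?_, fun z => ?_,
    fun z => ?_⟩
  · exact (hs k).add ((hχ k).smoothFamily.mul ((he k).sub (hs k)))
  · have := h0.mul (((he (m + 2)).sub (hs (m + 2))).isCk z)
    rwa [add_sub_cancel_left]
  · have := h1.mul (((hs (m + 2)).sub (he (m + 2))).isCk z)
    refine cast ?_ this
    congr 1
    ring

theorem contDiff_coe {E : Type*} [NormedAddCommGroup E] [NormedSpace ℝ E] (W : Submodule ℝ E) :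
    ContDiff ℝ ∞ fun x : W => (x : E) := W.subtypeL.contDiff

/-- The jets at `0` up to order `m`, and the first two iterated integrals over the period. -/
def flatMap : sobolevCircle (m + 1) →L[ℝ] (Fin (m + 1) → ℝ) × ℝ × ℝ :=
  (jet m).prod (((ev right).comp (prim.comp (rep (m + 1) 0))).prod
    ((ev right).comp (prim.comp (prim.comp (rep (m + 1) 0)))))

/-- The second derivatives of functions in `H^{m+3}` with vanishing derivatives at the end points
up to order `m + 2`. -/
def flatSpace : Submodule ℝ (sobolevCircle (m + 1)) := LinearMap.ker (flatMap m).toLinearMap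

variable {m}

theorem mem_flatSpace {y : sobolevCircle (m + 1)} : y ∈ flatSpace m ↔ jet m y = 0 ∧
    prim (rep (m + 1) 0 y) right = 0 ∧ prim (prim (rep (m + 1) 0 y)) right = 0 := by
  change (_, _, _) = (0 : _ × _ × _) ↔ _
  rw [Prod.mk_eq_zero, Prod.mk_eq_zero]
  rfl

theorem vanishAt_prim_prim {y : sobolevCircle (m + 1)} (hy : y ∈ flatSpace m) :
    VanishAt left (m + 2) (prim (prim (rep (m + 1) 0 y))) ∧
      VanishAt right (m + 2) (prim (prim (rep (m + 1) 0 y))) := by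
  obtain ⟨h0, h1, h2⟩ := mem_flatSpace.1 hy
  have hj := jetAt_rep_jet y
  rw [h0, extendSeq_zero] at hj
  exact ⟨vanishAt_succ (prim_left _) (isDer_prim _) (vanishAt_succ (prim_left _) (isDer_prim _) hj.1),
    vanishAt_succ h2 (isDer_prim _) (vanishAt_succ h1 (isDer_prim _) hj.2)⟩

instance : CompleteSpace (flatSpace m) := (flatMap m).isClosed_ker.completeSpace_coe

theorem VanishAt.jetAt {t : Icc (0 : ℝ) (2 * Real.pi)} {k : ℕ} {f g : CI} {c : ℕ → ℝ}
    (h : VanishAt t k (f - g)) (hg : JetAt t k g c) : JetAt t k f c := by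
  simpa using JetAt.add h hg

/-- The potential `-w'' / 2 + w'² / 4 - exp (2w)`. -/
def potential (w w₁ w₂ : CI) : CI := (-1 / 2 : ℝ) • w₂ + kepler w w₁

theorem isKepler_potential {w w₁ w₂ : CI} (h : IsDer w w₁) (h₁ : IsDer w₁ w₂) :
    IsKepler (potential w w₁ w₂) w w₁ := by
  refine ⟨h, h₁.congr ?_⟩
  rw [potential]
  module

theorem IsKepler.potential_eq {q w w₁ w₂ : CI} (h : IsKepler q w w₁) (h₁ : IsDer w₁ w₂) :
    potential w w₁ w₂ = q := by
  rw [potential, h₁.unique h.2]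
  module

/-- The nonlinear parts are compared separately because their difference alone, being flat at both
ends, is periodic and so defines a function in H^{m+1}. -/
theorem VanishAt.potential_sub {t : Icc (0 : ℝ) (2 * Real.pi)} {k : ℕ} {w w₁ w₂ z z₁ z₂ : CI}
    (h : VanishAt t (k + 2) (w - z)) (hw : IsDer w w₁) (hw₁ : IsDer w₁ w₂) (hz : IsDer z z₁)
    (hz₁ : IsDer z₁ z₂) (cw : IsCk (k + 2) w) (cz : IsCk (k + 2) z) :
    VanishAt t k (kepler w w₁ - kepler z z₁) ∧
      VanishAt t k (potential w w₁ w₂ - potential z z₁ z₂) := by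
  have h1 := h.deriv (hw.sub hz)
  have h2 := h1.deriv (hw₁.sub hz₁)
  have cw₁ : IsCk (k + 1) w₁ := SmoothFamily.deriv cw fun _ => hw
  have cz₁ : IsCk (k + 1) z₁ := SmoothFamily.deriv cz fun _ => hz
  have h3 := VanishAt.kepler_sub_kepler (JetAt.mono h (by omega)) (JetAt.mono h1 (by omega))
    (SmoothFamily.mono cw (by omega)) (SmoothFamily.mono cz (by omega)) cw₁.of_succ cz₁.of_succ
  refine ⟨h3, cast ?_ ((VanishAt.smul (-1 / 2) h2).add h3)⟩
  congr 1
  simp only [potential]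
  module

/-- Potentials in `H^{m+1}` are parametrized by the end values `a`, `b` of the solution `w` of the
Kepler equation and of its derivative, the derivatives `c` of the potential at `0`, and an element
of a closed subspace of finite codimension. -/
theorem exists_flat_coordinates (m : ℕ) :
    ∃ (J : ℝ × ℝ × (Fin (m + 1) → ℝ) → CI)
      (T : (ℝ × ℝ × (Fin (m + 1) → ℝ)) × flatSpace m → sobolevCircle (m + 1))
      (R : sobolevCircle (m + 1) → (ℝ × ℝ × (Fin (m + 1) → ℝ)) × flatSpace m),
      ContDiff ℝ ∞ J ∧ ContDiff ℝ ∞ T ∧ ContDiff ℝ ∞ R ∧ (∀ x, R (T x) = x) ∧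
      (∀ q, T (R q) = q) ∧
      ∀ x, ∃ w₁, IsKepler (rep (m + 1) 0 (T x))
        (J x.1 + prim (prim (rep (m + 1) 0 (x.2 : sobolevCircle (m + 1))))) w₁ ∧
        (J x.1 + prim (prim (rep (m + 1) 0 (x.2 : sobolevCircle (m + 1))))) left = 0 ∧
        w₁ left = 0 ∧
        (J x.1 + prim (prim (rep (m + 1) 0 (x.2 : sobolevCircle (m + 1))))) right = x.1.1 ∧
        w₁ right = x.1.2.1 := by
  obtain ⟨J, hJ, hJl, hJr⟩ := exists_interpolation m
  obtain ⟨-, J₁, hd, -, J₂, hd₁, -⟩ := hJ 2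
  have hJ₁ : ∀ k, SmoothFamily k J₁ := fun k => (hJ (k + 1)).deriv hd
  have hJ₂ : ∀ k, SmoothFamily k J₂ := fun k => (hJ₁ (k + 1)).deriv hd₁
  -- the model solutions
  have ks : ∀ z, IsKepler (endPotential m left z.2.2) (startModel m z) _ := fun z =>
    isKepler_keplerSol left (endPotential m left z.2.2) 0 0
  have ke : ∀ z, IsKepler (endPotential m right z.2.2) (endModel m z) _ := fun z =>
    isKepler_keplerSol right (endPotential m right z.2.2) z.1 z.2.1
  have cp : ∀ (t₀ : Icc (0 : ℝ) (2 * Real.pi)) (c : Fin (m + 1) → ℝ), IsCk m (endPotential m t₀ c) :=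
    fun t₀ c => (smoothFamily_endPotential m m t₀ contDiff_id).isCk c
  have jp : ∀ (t₀ : Icc (0 : ℝ) (2 * Real.pi)) (c : Fin (m + 1) → ℝ),
      JetAt t₀ m (endPotential m t₀ c) (extendSeq c) := fun t₀ c => jetAt_taylorPoly t₀ m _
  have cJ : ∀ z, IsCk (m + 2) (J z) := fun z => (hJ _).isCk z
  -- the potential of the interpolation
  have jQl : ∀ z, JetAt left m (potential (J z) (J₁ z) (J₂ z)) (extendSeq z.2.2) := fun z => by
    have h := ((hJl z).potential_sub (hd z) (hd₁ z) (ks z).1 (ks z).2 (cJ z)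
      ((ks z).isCk (cp _ _)).1).2
    rw [(ks z).potential_eq (ks z).2] at h
    exact h.jetAt (jp _ _)
  have jQr : ∀ z, JetAt right m (potential (J z) (J₁ z) (J₂ z)) (extendSeq z.2.2) := fun z => by
    have h := ((hJr z).potential_sub (hd z) (hd₁ z) (ke z).1 (ke z).2 (cJ z)
      ((ke z).isCk (cp _ _)).1).2
    rw [(ke z).potential_eq (ke z).2] at h
    exact h.jetAt (jp _ _)
  have sQ : SmoothFamily (m + 1) fun z => potential (J z) (J₁ z) (J₂ z) :=
    ((hJ₂ _).const_smul _).add ((hJ _).kepler (hJ₁ _))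
  -- At both ends the jet of the potential of J is the prescribed c, so this potential is periodic.
  obtain ⟨Q, hQ, rQ⟩ := exists_contDiff_rep_eq sQ fun z => (jQl z).periodicCk (jQr z)
  have J0 : ∀ z, J z left = 0 := fun z => by
    have h : J z left - startModel m z left = 0 := (hJl z).apply
    rw [sub_eq_zero.1 h]
    exact keplerSol_self _ _ _ _
  have J0' : ∀ z, J₁ z left = 0 := fun z => by
    have h : J₁ z left - keplerSol' left (endPotential m left z.2.2) 0 0 left = 0 :=
      ((hJl z).deriv ((hd z).sub (ks z).1)).apply
    rw [sub_eq_zero.1 h]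
    exact keplerSol'_self _ _ _ _
  have J1 : ∀ z, J z right = z.1 := fun z => by
    have h : J z right - endModel m z right = 0 := (hJr z).apply
    rw [sub_eq_zero.1 h]
    exact keplerSol_self _ _ _ _
  have J1' : ∀ z, J₁ z right = z.2.1 := fun z => by
    have h : J₁ z right - keplerSol' right (endPotential m right z.2.2) z.1 z.2.1 right = 0 :=
      ((hJr z).deriv ((hd z).sub (ke z).1)).apply
    rw [sub_eq_zero.1 h]
    exact keplerSol'_self _ _ _ _
  -- the forward map
  have sy : SmoothFamily m fun x : (ℝ × ℝ × (Fin (m + 1) → ℝ)) × flatSpace m =>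
      rep (m + 1) 0 (x.2 : sobolevCircle (m + 1)) :=
    smoothFamily_rep.comp ((contDiff_coe (flatSpace m)).comp contDiff_snd)
  have sJ : ∀ k, SmoothFamily k fun x : (ℝ × ℝ × (Fin (m + 1) → ℝ)) × flatSpace m => J x.1 :=
    fun k => (hJ k).comp contDiff_fst
  have sJ₁ : ∀ k, SmoothFamily k fun x : (ℝ × ℝ × (Fin (m + 1) → ℝ)) × flatSpace m => J₁ x.1 :=
    fun k => (hJ₁ k).comp contDiff_fst
  have sW := (sJ (m + 2)).add sy.prim.prim
  have sW₁ := (sJ₁ (m + 1)).add sy.prim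
  -- The change of the nonlinear term contains no second derivative of w, so it has one more
  -- continuous derivative than y. Only linear terms involve the top derivative of y, and no
  -- products of Sobolev functions are needed.
  have sE := ((sW.mono (show m + 1 ≤ m + 2 by omega)).kepler sW₁).sub
    ((sJ (m + 1)).kepler (sJ₁ (m + 1)))
  have dW : ∀ x : (ℝ × ℝ × (Fin (m + 1) → ℝ)) × flatSpace m,
      IsDer (J x.1 + prim (prim (rep (m + 1) 0 (x.2 : sobolevCircle (m + 1)))))
        (J₁ x.1 + prim (rep (m + 1) 0 (x.2 : sobolevCircle (m + 1)))) :=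
    fun x => (hd x.1).add (isDer_prim _)
  have dW₁ : ∀ x : (ℝ × ℝ × (Fin (m + 1) → ℝ)) × flatSpace m,
      IsDer (J₁ x.1 + prim (rep (m + 1) 0 (x.2 : sobolevCircle (m + 1))))
        (J₂ x.1 + rep (m + 1) 0 (x.2 : sobolevCircle (m + 1))) :=
    fun x => (hd₁ x.1).add (isDer_prim _)
  have vE : ∀ x : (ℝ × ℝ × (Fin (m + 1) → ℝ)) × flatSpace m, VanishAt left m _ ∧
      VanishAt right m _ := fun x => by
    obtain ⟨h0, h1⟩ := vanishAt_prim_prim x.2.2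
    rw [← add_sub_cancel_left (J x.1) (prim (prim _))] at h0 h1
    exact ⟨(VanishAt.potential_sub h0 (dW x) (dW₁ x) (hd _) (hd₁ _) (sW.isCk x) (cJ _)).1,
      (VanishAt.potential_sub h1 (dW x) (dW₁ x) (hd _) (hd₁ _) (sW.isCk x) (cJ _)).1⟩
  obtain ⟨E, hE, rE⟩ := exists_contDiff_rep_eq sE fun x => (vE x).1.periodicCk (vE x).2
  let T : (ℝ × ℝ × (Fin (m + 1) → ℝ)) × flatSpace m → sobolevCircle (m + 1) :=
    fun x => Q x.1 - (1 / 2 : ℝ) • (x.2 : sobolevCircle (m + 1)) + E x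
  have rT : ∀ x, rep (m + 1) 0 (T x) =
      potential (J x.1 + prim (prim (rep (m + 1) 0 (x.2 : sobolevCircle (m + 1)))))
        (J₁ x.1 + prim (rep (m + 1) 0 (x.2 : sobolevCircle (m + 1))))
        (J₂ x.1 + rep (m + 1) 0 (x.2 : sobolevCircle (m + 1))) := fun x => by
    simp only [T, map_add, map_sub, map_smul, rQ, rE, potential]
    module
  have kT : ∀ x, IsKepler (rep (m + 1) 0 (T x)) _ _ := fun x =>
    (rT x).symm ▸ isKepler_potential (dW x) (dW₁ x)
  have hT : ContDiff ℝ ∞ T := ((hQ.comp contDiff_fst).sub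
    (((contDiff_coe (flatSpace m)).comp contDiff_snd).const_smul _)).add hE
  have jT : ∀ x, jet m (T x) = x.1.2.2 := fun x => by
    refine jet_eq_of_jetAt ?_
    have h1 : VanishAt left m (rep (m + 1) 0 (T x) - potential (J x.1) (J₁ x.1) (J₂ x.1)) := by
      obtain ⟨h0, -⟩ := vanishAt_prim_prim x.2.2
      rw [← add_sub_cancel_left (J x.1) (prim (prim _))] at h0
      rw [rT]
      exact (VanishAt.potential_sub h0 (dW x) (dW₁ x) (hd _) (hd₁ _) (sW.isCk x) (cJ _)).2
    exact h1.jetAt (jQl _)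
  -- the backward map
  have sw := SmoothFamily.keplerSol left (smoothFamily_rep (m := m)) (a := fun _ => 0)
    (b := fun _ => 0) contDiff_const contDiff_const
  let w : sobolevCircle (m + 1) → CI := fun q => keplerSol left (rep (m + 1) 0 q) 0 0
  let w₁ : sobolevCircle (m + 1) → CI := fun q => keplerSol' left (rep (m + 1) 0 q) 0 0
  have kw : ∀ q, IsKepler (rep (m + 1) 0 q) (w q) (w₁ q) := fun q => isKepler_keplerSol _ _ _ _
  let z : sobolevCircle (m + 1) → ℝ × ℝ × (Fin (m + 1) → ℝ) :=
    fun q => (w q right, w₁ q right, jet m q)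
  have hz : ContDiff ℝ ∞ z :=
    (sw.1.ev right).prodMk ((sw.2.ev right).prodMk (jet m).contDiff)
  -- Both w and the model have the same value and slope at the end point, and their potentials have
  -- the same jet of order m; J has the jet of the model.
  have vl : ∀ q, VanishAt left (m + 2) (w q - J (z q)) := fun q => by
    have h1 := ((kw q).vanishAt (ks (z q)) (k := m) (t := left)
      ((keplerSol_self _ _ _ _).trans (keplerSol_self _ _ _ _).symm)
      ((keplerSol'_self _ _ _ _).trans (keplerSol'_self _ _ _ _).symm)
      (smoothFamily_rep.isCk q) (cp _ _) (by
        simpa [VanishAt] using (jetAt_rep_jet q).1.sub (jp left (jet m q)))).1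
    simpa using h1.sub (hJl (z q))
  have vr : ∀ q, VanishAt right (m + 2) (w q - J (z q)) := fun q => by
    have h1 := ((kw q).vanishAt (ke (z q)) (k := m) (t := right)
      (keplerSol_self _ _ _ _).symm (keplerSol'_self _ _ _ _).symm
      (smoothFamily_rep.isCk q) (cp _ _) (by
        simpa [VanishAt] using (jetAt_rep_jet q).2.sub (jp right (jet m q)))).1
    simpa using h1.sub (hJr (z q))
  have cw : ∀ q, IsCk (m + 2) (w q) := fun q => sw.1.isCk q
  have sE' := ((sw.1.mono (show m + 1 ≤ m + 2 by omega)).kepler sw.2).sub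
    (((hJ (m + 1)).comp hz).kepler ((hJ₁ (m + 1)).comp hz))
  obtain ⟨E', hE', rE'⟩ := exists_contDiff_rep_eq sE' fun q => JetAt.periodicCk
    (c := 0) (VanishAt.potential_sub (vl q) (kw q).1 (kw q).2 (hd _) (hd₁ _) (cw q) (cJ _)).1
    (VanishAt.potential_sub (vr q) (kw q).1 (kw q).2 (hd _) (hd₁ _) (cw q) (cJ _)).1
  -- The candidate is y = (w - J)'', with w'' = -2q + 2 `kepler` w w' and the same formula for J,
  -- written in terms of elements of H^{m+1}.
  let y : sobolevCircle (m + 1) → sobolevCircle (m + 1) :=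
    fun q => (-2 : ℝ) • (q - Q (z q)) + (2 : ℝ) • E' q
  have hy : ContDiff ℝ ∞ y :=
    ((contDiff_id.sub (hQ.comp hz)).const_smul _).add (hE'.const_smul _)
  have dy : ∀ q, IsDer (w₁ q - J₁ (z q)) (rep (m + 1) 0 (y q)) := fun q =>
    ((kw q).2.sub (hd₁ _)).congr (by
      simp only [y, map_add, map_sub, map_smul, rQ, rE', potential]
      module)
  have vl₁ : ∀ q, VanishAt left (m + 1) (w₁ q - J₁ (z q)) := fun q =>
    (vl q).deriv ((kw q).1.sub (hd _))
  have vr₁ : ∀ q, VanishAt right (m + 1) (w₁ q - J₁ (z q)) := fun q =>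
    (vr q).deriv ((kw q).1.sub (hd _))
  have p1 : ∀ q, prim (rep (m + 1) 0 (y q)) = w₁ q - J₁ (z q) := fun q =>
    (dy q).prim_eq (vl₁ q).apply
  have p2 : ∀ q, prim (prim (rep (m + 1) 0 (y q))) = w q - J (z q) := fun q => by
    rw [p1]
    exact ((kw q).1.sub (hd _)).prim_eq (vl q).apply
  have my : ∀ q, y q ∈ flatSpace m := fun q => by
    refine mem_flatSpace.2 ⟨jet_eq_of_jetAt ?_, ?_, ?_⟩
    · rw [extendSeq_zero]
      exact (vl₁ q).deriv (dy q)
    · rw [p1]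
      exact (vr₁ q).apply
    · rw [p2]
      exact (vr q).apply
  refine ⟨J, T, fun q => (z q, ⟨y q, my q⟩), (hJ 0).contDiff, hT,
    hz.prodMk (contDiff_codRestrict hy my), fun x => ?_, fun q => ?_, fun x => ⟨_, kT x, ?_⟩⟩
  · have x0 : (J x.1 + prim (prim (rep (m + 1) 0 (x.2 : sobolevCircle (m + 1))))) left = 0 := by
      rw [ContinuousMap.add_apply, J0, prim_left, add_zero]
    have x1 : (J₁ x.1 + prim (rep (m + 1) 0 (x.2 : sobolevCircle (m + 1)))) left = 0 := by
      rw [ContinuousMap.add_apply, J0', prim_left, add_zero]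
    -- By uniqueness, the w recovered from the potential is the one from which the potential was
    -- built.
    have e : w (T x) = J x.1 + prim (prim (rep (m + 1) 0 (x.2 : sobolevCircle (m + 1)))) :=
      (kw (T x)).unique (kT x) (keplerSol_self _ _ _ _) (keplerSol'_self _ _ _ _) x0 x1
    have e₁ : w₁ (T x) = J₁ x.1 + prim (rep (m + 1) 0 (x.2 : sobolevCircle (m + 1))) :=
      (kw (T x)).1.unique (e ▸ (kT x).1)
    obtain ⟨-, r1, r2⟩ := mem_flatSpace.1 x.2.2
    have ez : z (T x) = x.1 := by
      refine Prod.ext ?_ (Prod.ext ?_ (jT x))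
      · change w (T x) right = _
        rw [e, ContinuousMap.add_apply, J1, r2, add_zero]
      · change w₁ (T x) right = _
        rw [e₁, ContinuousMap.add_apply, J1', r1, add_zero]
    refine Prod.ext ez (Subtype.ext (rep_injective ?_))
    have h1 := dy (T x)
    rw [e₁, ez, add_sub_cancel_left] at h1
    exact h1.unique (isDer_prim _)
  · refine rep_injective ?_
    rw [rT]
    simp only [p2]
    simp only [p1, add_sub_cancel]
    refine (kw q).potential_eq ?_
    refine (kw q).2.congr ?_
    simp only [y, map_add, map_sub, map_smul, rQ, rE', potential]
    module
  · obtain ⟨-, r1, r2⟩ := mem_flatSpace.1 x.2.2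
    simp only [ContinuousMap.add_apply, J0, J0', J1, J1', prim_left, r1, r2, add_zero, and_self]

end Interpolation

/-! ### The total argument as a coordinate, and the remaining Hilbert space -/

/-! ### Separable Hilbert spaces -/

section Hilbert

variable {E : Type*} [NormedAddCommGroup E] [InnerProductSpace ℝ E]

/-- Orthonormal vectors have mutual distance √2, so the balls of radius 1/2 around them are
disjoint, and a separable space has only countably many disjoint nonempty open sets. -/
theorem countable_of_orthonormal [TopologicalSpace.SeparableSpace E] {ι : Type*} {v : ι → E}
    (hv : Orthonormal ℝ v) : Countable ι := by
  have hd : ∀ i j, i ≠ j → 1 ≤ dist (v i) (v j) := fun i j hij => by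
    have h : ‖v i - v j‖ * ‖v i - v j‖ = 2 := by
      rw [norm_sub_mul_self_real, hv.1, hv.1, hv.2 hij]
      norm_num
    rw [dist_eq_norm]
    nlinarith [norm_nonneg (v i - v j)]
  have hp : (univ : Set ι).PairwiseDisjoint fun i => Metric.ball (v i) (1 / 2) :=
    fun i _ j _ hij => Metric.ball_disjoint_ball (by linarith [hd i j hij])
  exact countable_univ_iff.1 (hp.countable_of_isOpen (fun _ _ => Metric.isOpen_ball)
    fun i _ => ⟨v i, Metric.mem_ball_self (by norm_num)⟩)

theorem exists_hilbertBasis_nat [CompleteSpace E] [TopologicalSpace.SeparableSpace E]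
    (h : ¬ FiniteDimensional ℝ E) : Nonempty (HilbertBasis ℕ ℝ E) := by
  obtain ⟨w, b, -⟩ := exists_hilbertBasis ℝ E
  have : Countable w := countable_of_orthonormal b.orthonormal
  have : Infinite w := by
    by_contra hw
    have := not_infinite_iff_finite.1 hw
    have := Fintype.ofFinite w
    exact h b.toOrthonormalBasis.toBasis.finiteDimensional_of_finite
  obtain ⟨e⟩ := nonempty_denumerable_iff.2 ⟨‹Countable w›, ‹Infinite w›⟩
  refine ⟨HilbertBasis.mk (b.orthonormal.comp (Denumerable.eqv w).symm (Equiv.injective _)) ?_⟩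
  rw [EquivLike.range_comp b]
  exact b.dense_span.ge

theorem exists_linearIsometryEquiv {F : Type*} [NormedAddCommGroup F] [InnerProductSpace ℝ F]
    [CompleteSpace E] [TopologicalSpace.SeparableSpace E] (hE : ¬ FiniteDimensional ℝ E)
    [CompleteSpace F] [TopologicalSpace.SeparableSpace F] (hF : ¬ FiniteDimensional ℝ F) :
    Nonempty (E ≃ₗᵢ[ℝ] F) := by
  obtain ⟨b⟩ := exists_hilbertBasis_nat hE
  obtain ⟨c⟩ := exists_hilbertBasis_nat hF
  exact ⟨b.repr.trans c.repr.symm⟩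

end Hilbert

/-! ### Straightening one coordinate -/

/-- A smooth function which is increasing in a real variable with nonvanishing derivative can be
used as a coordinate in place of that variable. -/
theorem exists_contDiff_fibre_inverse {P : Type*} [NormedAddCommGroup P] [NormedSpace ℝ P]
    [CompleteSpace P] {f : P × ℝ → ℝ} (hf : ContDiff ℝ ∞ f) {d : P → ℝ → ℝ}
    (hd : ∀ p s, HasDerivAt (fun s => f (p, s)) (d p s) s) (hpos : ∀ p s, 0 < d p s)
    (hs : ∀ p r, ∃ s, f (p, s) = r) :
    ∃ g : P × ℝ → ℝ, ContDiff ℝ ∞ g ∧ (∀ p r, f (p, g (p, r)) = r) ∧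
      ∀ p s, g (p, f (p, s)) = s := by
  choose g hg using hs
  have hmono : ∀ p, StrictMono fun s => f (p, s) := fun p =>
    strictMono_of_hasDerivAt_pos (hd p) (hpos p)
  have hgf : ∀ p s, g p (f (p, s)) = s := fun p s => (hmono p).injective (hg p _)
  refine ⟨fun x => g x.1 x.2, contDiff_iff_contDiffAt.2 fun x => ?_, hg, hgf⟩
  let F : P × ℝ → P × ℝ := fun x => (x.1, f x)
  have hF : ContDiff ℝ ∞ F := contDiff_fst.prodMk hf
  have hFinj : Function.Injective F := by
    rintro ⟨p, s⟩ ⟨p', s'⟩ h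
    obtain ⟨h1, h2⟩ := Prod.ext_iff.1 h
    obtain rfl : p = p' := h1
    exact Prod.ext rfl ((hmono p).injective h2)
  let a : P × ℝ := (x.1, g x.1 x.2)
  have hFa : F a = x := Prod.ext rfl (hg _ _)
  let D : P × ℝ →L[ℝ] ℝ := fderiv ℝ f a
  have hD : HasFDerivAt f D a := (hf.differentiable (by simp) a).hasFDerivAt
  have hc : D (0, 1) = d x.1 (g x.1 x.2) := by
    have h1 : HasDerivAt (fun s : ℝ => ((x.1, s) : P × ℝ)) (0, 1) (g x.1 x.2) :=
      (hasDerivAt_const _ _).prodMk (hasDerivAt_id _)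
    exact (hD.comp_hasDerivAt _ h1).unique (hd _ _)
  have hc0 : D (0, 1) ≠ 0 := hc ▸ (hpos _ _).ne'
  have hDs : ∀ y : P × ℝ, D y = D (y.1, 0) + y.2 * D (0, 1) := fun y => by
    rw [← smul_eq_mul, ← map_smul, ← map_add]
    simp
  -- The derivative of F is triangular with D (0, 1) ≠ 0 in the corner, so its inverse can be
  -- written down.
  let D' : (P × ℝ) ≃L[ℝ] P × ℝ := ContinuousLinearEquiv.equivOfInverse
    ((ContinuousLinearMap.fst ℝ P ℝ).prod D)
    ((ContinuousLinearMap.fst ℝ P ℝ).prod ((D (0, 1))⁻¹ • (ContinuousLinearMap.snd ℝ P ℝ -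
      D.comp ((ContinuousLinearMap.id ℝ P).prod 0 ∘L ContinuousLinearMap.fst ℝ P ℝ))))
    (fun y => by
      refine Prod.ext rfl ?_
      change (D (0, 1))⁻¹ * (D y - D (y.1, 0)) = y.2
      rw [hDs y]
      field_simp
      ring)
    (fun y => by
      refine Prod.ext rfl ?_
      change D (y.1, (D (0, 1))⁻¹ * (y.2 - D (y.1, 0))) = y.2
      rw [hDs]
      field_simp
      ring)
  have hFD : HasFDerivAt F (D' : P × ℝ →L[ℝ] P × ℝ) a := hasFDerivAt_fst.prodMk hD
  let φ := (hF.contDiffAt (x := a)).toOpenPartialHomeomorph F hFD (by simp)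
  have hx : x ∈ φ.target := by
    have := (hF.contDiffAt (x := a)).image_mem_toOpenPartialHomeomorph_target hFD (by simp)
    rwa [hFa] at this
  -- Global injectivity of F identifies the local inverse of the inverse function theorem with the
  -- global one.
  have hsymm : ∀ y ∈ φ.target, φ.symm y = (y.1, g y.1 y.2) := fun y hy =>
    hFinj ((φ.right_inv hy).trans (Prod.ext rfl (hg _ _).symm))
  have hsmooth : ContDiffAt ℝ ∞ φ.symm x := by
    refine φ.contDiffAt_symm (f₀' := D') hx ?_ hF.contDiffAt
    rw [hsymm x hx]
    exact hFD
  refine (contDiff_snd.contDiffAt.comp x hsmooth).congr_of_eventuallyEq ?_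
  filter_upwards [φ.open_target.mem_nhds hx] with y hy
  rw [Function.comp_apply, hsymm y hy]

/-! ### The total argument as a coordinate -/

theorem prim_exp_right_pos (w : CI) : 0 < prim (NormedSpace.exp w) right :=
  prim_pos fun t _ _ => by
    rw [exp_apply]
    exact Real.exp_pos _

theorem prim_mono {f g : CI} (h : ∀ t, f t ≤ g t) : prim f right ≤ prim g right := by
  rw [prim_apply, prim_apply]
  refine intervalIntegral.integral_mono_on Real.two_pi_pos.le (ext_intervalIntegrable f _ _)
    (ext_intervalIntegrable g _ _) fun x hx => ?_
  rw [ext_of_mem f hx, ext_of_mem g hx]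
  exact h _

/-- The intermediate value theorem in s. The integral of exp(w + sφ) exceeds that of w + sφ, which
is affine in s with positive slope; as s tends to -∞ it tends to 0 by dominated convergence, since φ
> 0 in the interior. -/
theorem exists_prim_exp_eq (w : CI) {φ : CI} (hφ : ∀ t, 0 ≤ φ t)
    (hφ' : ∀ t : Icc (0 : ℝ) (2 * Real.pi), 0 < (t : ℝ) → (t : ℝ) < 2 * Real.pi → 0 < φ t)
    {r : ℝ} (hr : 0 < r) : ∃ s : ℝ, prim (NormedSpace.exp (w + s • φ)) right = r := by
  have hc : Continuous fun s : ℝ => prim (NormedSpace.exp (w + s • φ)) right := by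
    have h1 : Continuous fun s : ℝ => NormedSpace.exp (w + s • φ) :=
      contDiff_exp_CI.continuous.comp (by fun_prop)
    exact ((ev right).comp prim).continuous.comp h1
  have hp : 0 < prim φ right := prim_pos hφ'
  have htop : ∃ s : ℝ, r ≤ prim (NormedSpace.exp (w + s • φ)) right := by
    -- The value of s for which the integral of w + sφ is r.
    refine ⟨(r - prim w right) / prim φ right, ?_⟩
    have h1 : prim (w + ((r - prim w right) / prim φ right) • φ) right ≤
        prim (NormedSpace.exp (w + ((r - prim w right) / prim φ right) • φ)) right :=
      prim_mono fun t => by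
        rw [exp_apply]
        linarith [Real.add_one_le_exp ((w + ((r - prim w right) / prim φ right) • φ) t)]
    rw [map_add, map_smul, ContinuousMap.add_apply, ContinuousMap.smul_apply, smul_eq_mul,
      div_mul_cancel₀ _ hp.ne'] at h1
    linarith
  have hbot : ∃ s : ℝ, prim (NormedSpace.exp (w + s • φ)) right ≤ r := by
    have hlim : Filter.Tendsto (fun n : ℕ => prim (NormedSpace.exp (w + (-(n : ℝ)) • φ)) right)
        Filter.atTop (nhds (∫ _ in (0 : ℝ)..(2 * Real.pi), (0 : ℝ))) := by
      simp only [prim_apply]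
      refine intervalIntegral.tendsto_integral_filter_of_dominated_convergence
        (ext (NormedSpace.exp w)) (Filter.Eventually.of_forall fun n =>
          (continuous_ext _).aestronglyMeasurable) ?_ (ext_intervalIntegrable _ _ _) ?_
      · refine Filter.Eventually.of_forall fun n => Filter.Eventually.of_forall fun x hx => ?_
        rw [uIoc_of_le right.2.1] at hx
        have hx' : x ∈ Icc (0 : ℝ) (2 * Real.pi) := ⟨hx.1.le, hx.2⟩
        rw [ext_of_mem _ hx', ext_of_mem _ hx', exp_apply, exp_apply, Real.norm_eq_abs, Real.abs_exp]
        refine Real.exp_le_exp.2 ?_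
        simp only [ContinuousMap.add_apply, ContinuousMap.smul_apply, smul_eq_mul]
        nlinarith [hφ ⟨x, hx'⟩, (Nat.cast_nonneg n : (0 : ℝ) ≤ n)]
      · have hne : ∀ᵐ x : ℝ, x ≠ 2 * Real.pi := by
          simp [ae_iff]
        filter_upwards [hne] with x hx0 hx
        rw [uIoc_of_le right.2.1] at hx
        have hx' : x ∈ Icc (0 : ℝ) (2 * Real.pi) := ⟨hx.1.le, hx.2⟩
        have hφx : 0 < φ ⟨x, hx'⟩ := hφ' _ hx.1 (lt_of_le_of_ne hx.2 hx0)
        simp only [ext_of_mem _ hx', exp_apply, ContinuousMap.add_apply, ContinuousMap.smul_apply,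
          smul_eq_mul]
        refine Real.tendsto_exp_atBot.comp (Filter.tendsto_atBot_add_const_left _ _ ?_)
        simp only [neg_mul]
        exact Filter.tendsto_neg_atTop_atBot.comp
          (tendsto_natCast_atTop_atTop.atTop_mul_const hφx)
    rw [intervalIntegral.integral_zero] at hlim
    obtain ⟨n, hn⟩ := (hlim.eventually (gt_mem_nhds hr)).exists
    exact ⟨_, hn.le⟩
  exact mem_range_of_exists_le_of_exists_ge hc hbot htop

/-- The logarithm of the total argument replaces the coordinate in the direction `φ`. -/
theorem exists_argument_coordinate {P : Type*} [NormedAddCommGroup P] [NormedSpace ℝ P]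
    [CompleteSpace P] {W : P → CI} (hW : ContDiff ℝ ∞ W) {φ : CI} (hφ : ∀ t, 0 ≤ φ t)
    (hφ' : ∀ t : Icc (0 : ℝ) (2 * Real.pi), 0 < (t : ℝ) → (t : ℝ) < 2 * Real.pi → 0 < φ t) :
    ∃ σ : P × ℝ → ℝ, ContDiff ℝ ∞ σ ∧
      (∀ x r, prim (NormedSpace.exp (W x + σ (x, r) • φ)) right = Real.exp r) ∧
      ∀ x s, σ (x, Real.log (prim (NormedSpace.exp (W x + s • φ)) right)) = s := by
  have h1 : ContDiff ℝ ∞ fun x : P × ℝ => prim (NormedSpace.exp (W x.1 + x.2 • φ)) right := by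
    have h2 : ContDiff ℝ ∞ fun x : P × ℝ => NormedSpace.exp (W x.1 + x.2 • φ) :=
      contDiff_exp_CI.comp ((hW.comp contDiff_fst).add (contDiff_snd.smul contDiff_const))
    exact ((ev right).comp prim).contDiff.comp h2
  have h0 : ∀ (x : P) (s : ℝ), HasDerivAt (fun s : ℝ => prim (NormedSpace.exp (W x + s • φ)) right)
      (prim (NormedSpace.exp (W x + s • φ) * φ) right) s := fun x s => by
    have h2 : HasDerivAt (fun s : ℝ => W x + s • φ) φ s := by
      simpa using ((hasDerivAt_id s).smul_const φ).const_add (W x)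
    have h3 := (hasFDerivAt_exp (𝕂 := ℝ) (x := W x + s • φ)).comp_hasDerivAt s h2
    exact ((ev right).comp prim).hasFDerivAt.comp_hasDerivAt s h3
  obtain ⟨g, hg, hfg, hgf⟩ := exists_contDiff_fibre_inverse
    (f := fun x : P × ℝ => Real.log (prim (NormedSpace.exp (W x.1 + x.2 • φ)) right))
    (h1.log fun x => (prim_exp_right_pos _).ne')
    (fun x s => (h0 x s).log (prim_exp_right_pos _).ne')
    (fun x s => div_pos (prim_pos fun t h0 h1 => by
      rw [ContinuousMap.mul_apply, exp_apply]
      exact mul_pos (Real.exp_pos _) (hφ' t h0 h1)) (prim_exp_right_pos _))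
    (fun x r => by
      obtain ⟨s, hs⟩ := exists_prim_exp_eq (W x) hφ hφ' (Real.exp_pos r)
      exact ⟨s, by rw [hs, Real.log_exp]⟩)
  refine ⟨g, hg, fun x r => ?_, hgf⟩
  rw [← Real.exp_log (prim_exp_right_pos (W x + g (x, r) • φ)), hfg x r]

/-- V splits into the line of ψ and its orthogonal complement. The coordinate along ψ is traded for
the logarithm of the total argument, and the complement together with the n jet coordinates is an
infinite-dimensional separable Hilbert space, hence a copy of ℍ. -/
theorem exists_straightening {ℍ V : Type*} [NormedAddCommGroup ℍ] [InnerProductSpace ℝ ℍ]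
    [CompleteSpace ℍ] [TopologicalSpace.SeparableSpace ℍ] (hℍ : ¬ FiniteDimensional ℝ ℍ)
    [NormedAddCommGroup V] [InnerProductSpace ℝ V] [CompleteSpace V]
    [TopologicalSpace.SeparableSpace V] (hV : ¬ FiniteDimensional ℝ V) (L : V →L[ℝ] CI) {ψ : V}
    (hψ : ∀ t, 0 ≤ L ψ t)
    (hψ' : ∀ t : Icc (0 : ℝ) (2 * Real.pi), 0 < (t : ℝ) → (t : ℝ) < 2 * Real.pi → 0 < L ψ t)
    {n : ℕ} {J : ℝ × ℝ × (Fin n → ℝ) → CI} (hJ : ContDiff ℝ ∞ J) :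
    ∃ (A : (ℝ × ℝ × ℝ) × ℍ → (ℝ × ℝ × (Fin n → ℝ)) × V)
      (B : (ℝ × ℝ × (Fin n → ℝ)) × V → (ℝ × ℝ × ℝ) × ℍ), ContDiff ℝ ∞ A ∧ ContDiff ℝ ∞ B ∧
      (∀ x, B (A x) = x) ∧ (∀ y, A (B y) = y) ∧ ∀ x, (A x).1.1 = x.1.2.1 ∧
      (A x).1.2.1 = x.1.2.2 ∧
      prim (NormedSpace.exp (J (A x).1 + L (A x).2)) right = Real.exp x.1.1 := by
  have hψ0 : ψ ≠ 0 := by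
    rintro rfl
    have := prim_pos hψ'
    simp at this
  let Y : Submodule ℝ V := (ℝ ∙ ψ)ᗮ
  have hY : ¬ FiniteDimensional ℝ Y := fun h => hV <| by
    have h1 : FiniteDimensional ℝ ((ℝ ∙ ψ) ⊔ Y : Submodule ℝ V) :=
      Submodule.finiteDimensional_sup _ _
    rw [Submodule.sup_orthogonal_of_hasOrthogonalProjection] at h1
    exact Module.finite_def.2 (Module.Finite.iff_fg.1 h1)
  have hZ : ¬ FiniteDimensional ℝ (WithLp 2 (EuclideanSpace ℝ (Fin n) × Y)) := fun h => hY <|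
    FiniteDimensional.of_surjective
      ((LinearMap.snd ℝ (EuclideanSpace ℝ (Fin n)) Y).comp
        (WithLp.prodContinuousLinearEquiv 2 ℝ (EuclideanSpace ℝ (Fin n)) Y).toLinearEquiv.toLinearMap)
      (Prod.snd_surjective.comp (LinearEquiv.surjective _))
  have : TopologicalSpace.SeparableSpace (WithLp 2 (EuclideanSpace ℝ (Fin n) × Y)) :=
    (WithLp.prodContinuousLinearEquiv 2 ℝ (EuclideanSpace ℝ (Fin n)) Y).symm.surjective.denseRange.separableSpace
      (WithLp.prodContinuousLinearEquiv 2 ℝ (EuclideanSpace ℝ (Fin n)) Y).symm.continuous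
  obtain ⟨e₀⟩ := exists_linearIsometryEquiv hℍ hZ
  let e : ℍ ≃L[ℝ] (Fin n → ℝ) × Y := e₀.toContinuousLinearEquiv.trans
    ((WithLp.prodContinuousLinearEquiv 2 ℝ (EuclideanSpace ℝ (Fin n)) Y).trans
      ((EuclideanSpace.equiv (Fin n) ℝ).prodCongr (ContinuousLinearEquiv.refl ℝ Y)))
  let W : (ℝ × ℝ × (Fin n → ℝ)) × Y → CI := fun x => J x.1 + L x.2
  have hW : ContDiff ℝ ∞ W :=
    (hJ.comp contDiff_fst).add (L.contDiff.comp ((contDiff_coe Y).comp contDiff_snd))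
  obtain ⟨σ, hσ, h1, h2⟩ := exists_argument_coordinate hW hψ hψ'
  let c : V → ℝ := fun v => inner ℝ ψ v / inner ℝ ψ ψ
  have hc : ContDiff ℝ ∞ c := (contDiff_const.inner ℝ contDiff_id).div_const _
  have hin : inner ℝ ψ ψ ≠ 0 := inner_self_ne_zero.2 hψ0
  have hcY : ∀ v, v - c v • ψ ∈ Y := fun v => by
    rw [Submodule.mem_orthogonal_singleton_iff_inner_right, inner_sub_right, inner_smul_right,
      div_mul_cancel₀ _ hin, sub_self]
  have hYc : ∀ (y : Y) (s : ℝ), c (y + s • ψ) = s := fun y s => by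
    simp only [c]
    rw [inner_add_right, inner_smul_right, Submodule.mem_orthogonal_singleton_iff_inner_right.1 y.2,
      zero_add, mul_div_cancel_right₀ _ hin]
  let pt : (ℝ × ℝ × ℝ) × ℍ → (ℝ × ℝ × (Fin n → ℝ)) × Y :=
    fun x => ((x.1.2.1, x.1.2.2, (e x.2).1), (e x.2).2)
  have hpt : ContDiff ℝ ∞ pt := by
    have he : ContDiff ℝ ∞ fun x : (ℝ × ℝ × ℝ) × ℍ => e x.2 := e.contDiff.comp contDiff_snd
    exact (ContDiff.prodMk (by fun_prop) (ContDiff.prodMk (by fun_prop) (contDiff_fst.comp he))).prodMk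
      (contDiff_snd.comp he)
  let rest : (ℝ × ℝ × (Fin n → ℝ)) × V → Y := fun y => ⟨y.2 - c y.2 • ψ, hcY y.2⟩
  have hrest : ContDiff ℝ ∞ rest := contDiff_codRestrict
    (contDiff_snd.sub ((hc.comp contDiff_snd).smul contDiff_const)) fun y => hcY y.2
  let τ : (ℝ × ℝ × (Fin n → ℝ)) × V → ℝ :=
    fun y => Real.log (prim (NormedSpace.exp (J y.1 + L y.2)) right)
  have hτ : ContDiff ℝ ∞ τ := by
    have h3 : ContDiff ℝ ∞ fun y : (ℝ × ℝ × (Fin n → ℝ)) × V => NormedSpace.exp (J y.1 + L y.2) :=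
      contDiff_exp_CI.comp ((hJ.comp contDiff_fst).add (L.contDiff.comp contDiff_snd))
    exact (((ev right).comp prim).contDiff.comp h3).log fun x => (prim_exp_right_pos _).ne'
  have hLW : ∀ (x : (ℝ × ℝ × (Fin n → ℝ)) × Y) (s : ℝ),
      J x.1 + L (x.2 + s • ψ) = W x + s • L ψ := fun x s => by
    rw [map_add, map_smul, ← add_assoc]
  have hτ1 : ∀ x, τ ((pt x).1, (pt x).2 + σ (pt x, x.1.1) • ψ) = x.1.1 := fun x => by
    simp only [τ]
    rw [hLW, h1, Real.log_exp]
  refine ⟨fun x => ((pt x).1, (pt x).2 + σ (pt x, x.1.1) • ψ),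
    fun y => ((τ y, y.1.1, y.1.2.1), e.symm (y.1.2.2, rest y)), ?_, ?_, fun x => ?_, fun y => ?_,
    fun x => ⟨rfl, rfl, ?_⟩⟩
  · exact (contDiff_fst.comp hpt).prodMk (((contDiff_coe Y).comp (contDiff_snd.comp hpt)).add
      ((hσ.comp (hpt.prodMk (by fun_prop))).smul contDiff_const))
  · exact (hτ.prodMk (by fun_prop)).prodMk
      (e.symm.contDiff.comp (ContDiff.prodMk (by fun_prop) hrest))
  · refine Prod.ext (Prod.ext (hτ1 x) rfl) ?_
    have h3 : rest ((pt x).1, (pt x).2 + σ (pt x, x.1.1) • ψ) = (pt x).2 := by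
      refine Subtype.ext ?_
      simp only [rest, hYc, add_sub_cancel_right]
    change e.symm ((e x.2).1, rest ((pt x).1, (pt x).2 + σ (pt x, x.1.1) • ψ)) = x.2
    rw [h3]
    exact e.symm_apply_apply x.2
  · have h3 : pt ((τ y, y.1.1, y.1.2.1), e.symm (y.1.2.2, rest y)) = (y.1, rest y) := by
      simp only [pt, e.apply_symm_apply]
    have h4 : σ ((y.1, rest y), τ y) = c y.2 := by
      have h5 : J y.1 + L y.2 = W (y.1, rest y) + c y.2 • L ψ := by
        rw [← hLW]
        simp only [rest, sub_add_cancel]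
      simp only [τ, h5, h2]
    refine Prod.ext (by beta_reduce; rw [h3]) ?_
    simp only [h3, h4, rest, sub_add_cancel]
  · have := h1 (pt x) x.1.1
    rwa [← hLW] at this

/-! ### Coordinates on the space of potentials -/

theorem exists_flatSpace_eq {m : ℕ} {f : CI} (hf : IsCk (m + 3) f) (h0 : VanishAt left (m + 2) f)
    (h1 : VanishAt right (m + 2) f) :
    ∃ y ∈ flatSpace m, prim (prim (rep (m + 1) 0 y)) = f := by
  obtain ⟨-, f₁, d, -, f₂, d₁, hf₂⟩ := (hf.smoothFamily (X := ℝ))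
  have v0 := (h0.deriv (d 0)).deriv (d₁ 0)
  have v1 := (h1.deriv (d 0)).deriv (d₁ 0)
  obtain ⟨u, -, hu⟩ := exists_contDiff_rep_eq (X := ℝ) (F := fun _ => f₂ 0)
    ((show IsCk (m + 1) (f₂ 0) from hf₂.isCk 0).smoothFamily) fun _ => JetAt.periodicCk v0 v1
  have p1 : prim (rep (m + 1) 0 (u 0)) = f₁ 0 := by
    rw [hu]
    exact (d₁ 0).prim_eq (h0.deriv (d 0)).apply
  have p2 : prim (prim (rep (m + 1) 0 (u 0))) = f := by
    rw [p1]
    exact (d 0).prim_eq h0.apply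
  refine ⟨u 0, mem_flatSpace.2 ⟨jet_eq_of_jetAt ?_, ?_, ?_⟩, p2⟩
  · rw [extendSeq_zero, hu]
    exact v0
  · rw [p1]
    exact (h1.deriv (d 0)).apply
  · rw [p2]
    exact h1.apply

/-- Powers of exponent at least m + 3 vanish to order m + 2 at both ends. The case n = 0 provides
the positive direction ψ, and all n together show that the space has infinite dimension. -/
theorem exists_flatSpace_eq_parabola_pow (m n : ℕ) :
    ∃ y ∈ flatSpace m, prim (prim (rep (m + 1) 0 y)) = parabola ^ (m + 3 + n) := by
  rw [show m + 3 + n = m + 2 + n + 1 by omega]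
  exact exists_flatSpace_eq (isCk_parabola_pow _ _)
    ((vanishAt_parabola_pow parabola_left _).mono (Nat.le_add_right _ _))
    ((vanishAt_parabola_pow parabola_right _).mono (Nat.le_add_right _ _))

/-- The second antiderivative on the space of flat functions. -/
def flatPrim (m : ℕ) : flatSpace m →L[ℝ] CI :=
  (prim.comp (prim.comp (rep (m + 1) 0))).comp (flatSpace m).subtypeL

/-- The double primitives include `parabola` ^ (m + 3) times P(`parabola`) for every polynomial P.
Since `parabola` takes every value between 0 and π², this embeds the polynomials. -/
theorem flatSpace_not_finiteDimensional (m : ℕ) : ¬ FiniteDimensional ℝ (flatSpace m) := fun h => by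
  let g : Polynomial ℝ →ₗ[ℝ] CI := (LinearMap.mulLeft ℝ (parabola ^ (m + 3))).comp
    (Polynomial.aeval parabola).toLinearMap
  have hev : ∀ (P : Polynomial ℝ) t, g P t = parabola t ^ (m + 3) * P.eval (parabola t) :=
    fun P t => by
    have h1 : Polynomial.aeval parabola P t = P.eval (parabola t) := by
      have := Polynomial.aeval_algHom_apply (ContinuousMap.evalAlgHom ℝ ℝ t) parabola P
      rw [← Polynomial.coe_aeval_eq_eval]
      exact this.symm
    change (parabola ^ (m + 3) * Polynomial.aeval parabola P) t = _
    rw [ContinuousMap.mul_apply, h1, ContinuousMap.pow_apply]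
  have hr : ∀ P, g P ∈ LinearMap.range (flatPrim m).toLinearMap := fun P => by
    induction P using Polynomial.induction_on' with
    | add P Q hP hQ => exact map_add g P Q ▸ Submodule.add_mem _ hP hQ
    | monomial n a =>
      obtain ⟨y, hy, e⟩ := exists_flatSpace_eq_parabola_pow m n
      have e' : g (Polynomial.monomial n a) = a • parabola ^ (m + 3 + n) := by
        ext t
        rw [hev, Polynomial.eval_monomial, ContinuousMap.smul_apply, ContinuousMap.pow_apply,
          smul_eq_mul, pow_add]
        ring
      rw [e']
      exact Submodule.smul_mem _ _ ⟨⟨y, hy⟩, e⟩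
  have hinj : Function.Injective g := by
    rw [← LinearMap.ker_eq_bot, LinearMap.ker_eq_bot']
    intro P hP
    refine Polynomial.eq_zero_of_infinite_isRoot P (Set.Infinite.mono ?_ (Ioo_infinite
      (show (0 : ℝ) < Real.pi ^ 2 by positivity)))
    intro r hr
    have hpi := Real.pi_pos
    obtain ⟨t, -, ht⟩ : r ∈ parabola '' univ := by
      have hm : (Real.pi : ℝ) ∈ Icc (0 : ℝ) (2 * Real.pi) := ⟨hpi.le, by linarith⟩
      have hpre : IsPreconnected (univ : Set (Icc (0 : ℝ) (2 * Real.pi))) := by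
        have : PreconnectedSpace (Icc (0 : ℝ) (2 * Real.pi)) :=
          isPreconnected_iff_preconnectedSpace.1 isPreconnected_Icc
        exact isPreconnected_univ
      refine hpre.intermediate_value (mem_univ left) (mem_univ ⟨Real.pi, hm⟩)
        parabola.continuous.continuousOn ?_
      rw [parabola_left, parabola_apply]
      exact ⟨hr.1.le, hr.2.le.trans (le_of_eq (by ring))⟩
    have h2 := hev P t
    rw [hP, ht, ContinuousMap.zero_apply] at h2
    exact (mul_eq_zero.1 h2.symm).resolve_left (pow_pos hr.1 _).ne'
  have : FiniteDimensional ℝ (Polynomial ℝ) :=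
    FiniteDimensional.of_injective (g.codRestrict _ hr) fun P Q h => hinj (congrArg Subtype.val h)
  exact Polynomial.not_finite this

theorem exists_potential_coordinates (m : ℕ) {ℍ : Type*} [NormedAddCommGroup ℍ]
    [InnerProductSpace ℝ ℍ] [CompleteSpace ℍ] [TopologicalSpace.SeparableSpace ℍ]
    (hℍ : ¬ FiniteDimensional ℝ ℍ) :
    ∃ (T : (ℝ × ℝ × ℝ) × ℍ → sobolevCircle (m + 1)) (R : sobolevCircle (m + 1) → (ℝ × ℝ × ℝ) × ℍ),
      ContDiff ℝ ∞ T ∧ ContDiff ℝ ∞ R ∧ (∀ x, R (T x) = x) ∧ (∀ q, T (R q) = q) ∧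
      ∀ x, ∃ w w₁, IsKepler (rep (m + 1) 0 (T x)) w w₁ ∧ w left = 0 ∧ w₁ left = 0 ∧
        prim (NormedSpace.exp w) right = Real.exp x.1.1 ∧ w right = x.1.2.1 ∧
        w₁ right = x.1.2.2 := by
  obtain ⟨J, T, R, hJ, hT, hR, hRT, hTR, hk⟩ := exists_flat_coordinates m
  obtain ⟨y, hy, e⟩ := exists_flatSpace_eq_parabola_pow m 0
  have hsep : TopologicalSpace.SeparableSpace (flatSpace m) := by
    have : SecondCountableTopology (sobolevCircle (m + 1)) := UniformSpace.secondCountable_of_separable _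
    infer_instance
  have e' : flatPrim m ⟨y, hy⟩ = parabola ^ (m + 3 + 0) := e
  obtain ⟨A, B, hA, hB, hBA, hAB, hx⟩ := exists_straightening hℍ (flatSpace_not_finiteDimensional m)
    (flatPrim m) (ψ := (⟨y, hy⟩ : flatSpace m)) (e' ▸ parabola_pow_nonneg _) (e' ▸ parabola_pow_pos _)
    hJ
  refine ⟨T ∘ A, B ∘ R, hT.comp hA, hB.comp hR, fun x => ?_, fun q => ?_, fun x => ?_⟩
  · simp only [Function.comp_apply, hRT, hBA]
  · simp only [Function.comp_apply, hAB, hTR]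
  · obtain ⟨w₁, h1, h2, h3, h4, h5⟩ := hk (A x)
    exact ⟨_, w₁, h1, h2, h3, (hx x).2.2, h4.trans (hx x).1, h5.trans (hx x).2.1⟩

/-! ### The chart of G₀ and the monodromy as a coordinate projection -/

open CoverSL2

/-! ### Inversion in Iwasawa coordinates -/

theorem toIwasawa_ofIwasawa (z : ℝ × ℝ × ℝ) : toIwasawa (ofIwasawa z) = z := iwasawa.right_inv z

theorem ofIwasawa_toIwasawa (g : CoverSL2) : ofIwasawa (toIwasawa g) = g := iwasawa.left_inv g

/-- Inversion of `G` in Iwasawa coordinates. -/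
def invIwasawa (z : ℝ × ℝ × ℝ) : ℝ × ℝ × ℝ := toIwasawa (ofIwasawa z)⁻¹

theorem ofIwasawa_invIwasawa (z : ℝ × ℝ × ℝ) : ofIwasawa (invIwasawa z) = (ofIwasawa z)⁻¹ :=
  ofIwasawa_toIwasawa _

theorem invIwasawa_invIwasawa (z : ℝ × ℝ × ℝ) : invIwasawa (invIwasawa z) = z := by
  rw [invIwasawa, ofIwasawa_invIwasawa, inv_inv, toIwasawa_ofIwasawa]

theorem lift_ofIwasawa_inv (z : ℝ × ℝ × ℝ) : lift (ofIwasawa z)⁻¹ (Real.pi / 2) =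
    lowFun (lowMatrix (-z.2.1) (-(Real.exp (-z.2.1) * z.2.2))) (Real.pi / 2 + z.1) := rfl

theorem proj_inv (g : CoverSL2) (i j : Fin 2) : proj g⁻¹ i j =
    !![proj g 1 1, -proj g 0 1; -proj g 1 0, proj g 0 0] i j := by
  rw [map_inv, Matrix.SpecialLinearGroup.SL2_inv_expl]
  rfl

theorem proj_ofIwasawa_apply (z : ℝ × ℝ × ℝ) (i j : Fin 2) : proj (ofIwasawa z) i j =
    !![Real.cos z.1 * Real.exp (z.2.1 / 2) +
        Real.sin z.1 * (Real.exp (-(z.2.1 / 2)) * (z.2.2 / 2)),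
      Real.sin z.1 * Real.exp (-(z.2.1 / 2));
      -Real.sin z.1 * Real.exp (z.2.1 / 2) +
        Real.cos z.1 * (Real.exp (-(z.2.1 / 2)) * (z.2.2 / 2)),
      Real.cos z.1 * Real.exp (-(z.2.1 / 2))] i j := by
  rw [proj_ofIwasawa, Matrix.SpecialLinearGroup.coe_mul, Matrix.mul_apply, Fin.sum_univ_two]
  fin_cases i <;> fin_cases j <;> simp [rotMatrix, lowMatrix]

theorem contDiff_proj_ofIwasawa (i j : Fin 2) :
    ContDiff ℝ ∞ fun z : ℝ × ℝ × ℝ => proj (ofIwasawa z) i j := by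
  simp only [proj_ofIwasawa_apply]
  fin_cases i <;> fin_cases j <;> simp <;> fun_prop

/-- The argument is the imaginary part of the complex logarithm, which is smooth on the slit plane,
and `turn` stays there for lower triangular matrices with positive diagonal. -/
theorem contDiff_lift_ofIwasawa_inv :
    ContDiff ℝ ∞ fun z : ℝ × ℝ × ℝ => lift (ofIwasawa z)⁻¹ (Real.pi / 2) := by
  simp only [lift_ofIwasawa_inv, lowFun]
  refine ContDiff.add (by fun_prop) (contDiff_iff_contDiffAt.2 fun z => ?_)
  have ht : ContDiff ℝ ∞ fun z : ℝ × ℝ × ℝ =>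
      turn (lowMatrix (-z.2.1) (-(Real.exp (-z.2.1) * z.2.2))) (Real.pi / 2 + z.1) := by
    have h1 : ContDiff ℝ ∞ fun z : ℝ × ℝ × ℝ => (turn
        (lowMatrix (-z.2.1) (-(Real.exp (-z.2.1) * z.2.2))) (Real.pi / 2 + z.1)).re := by
      simp [turn, lowMatrix]
      fun_prop
    have h2 : ContDiff ℝ ∞ fun z : ℝ × ℝ × ℝ => (turn
        (lowMatrix (-z.2.1) (-(Real.exp (-z.2.1) * z.2.2))) (Real.pi / 2 + z.1)).im := by
      simp [turn, lowMatrix]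
      fun_prop
    exact Complex.equivRealProdCLM.symm.contDiff.comp (h1.prodMk h2)
  have hl := (Complex.contDiffAt_log (n := ∞) (turn_mem
    (lowMatrix_zero_one (-z.2.1) (-(Real.exp (-z.2.1) * z.2.2)))
    (lowMatrix_zero_zero _ _) (lowMatrix_one_one _ _) (Real.pi / 2 + z.1))).restrict_scalars ℝ
  simp only [← Complex.log_im]
  exact Complex.imCLM.contDiff.contDiffAt.comp z (hl.comp z ht.contDiffAt)

theorem contDiff_invIwasawa : ContDiff ℝ ∞ invIwasawa := by
  have hp : ∀ i j, ContDiff ℝ ∞ fun z : ℝ × ℝ × ℝ => proj (ofIwasawa z)⁻¹ i j := fun i j => by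
    simp only [proj_inv]
    fin_cases i <;> fin_cases j
    · exact contDiff_proj_ofIwasawa 1 1
    · exact (contDiff_proj_ofIwasawa 0 1).neg
    · exact (contDiff_proj_ofIwasawa 1 0).neg
    · exact contDiff_proj_ofIwasawa 0 0
  have hs := ((hp 0 1).pow 2).add ((hp 1 1).pow 2)
  have hn : ∀ z : ℝ × ℝ × ℝ, proj (ofIwasawa z)⁻¹ 0 1 ^ 2 + proj (ofIwasawa z)⁻¹ 1 1 ^ 2 ≠ 0 :=
    fun z => (CoverSL2.sq_pos _).ne'
  exact (contDiff_const.sub contDiff_lift_ofIwasawa_inv).prodMk ((hs.log hn).neg.prodMk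
    ((contDiff_const.mul (((hp 0 0).mul (hp 0 1)).add ((hp 1 0).mul (hp 1 1)))).div hs hn))

/-! ### The half-space `G₀` -/

/-- A continuous injective function is strictly monotone, and this one moves points by at most π, so
it cannot be decreasing. -/
theorem strictMono_lowFun {A B : SL(2, ℝ)} (hA : A 0 1 = 0) (hA0 : 0 < A 0 0) (hA1 : 0 < A 1 1)
    (hB : B 0 1 = 0) (hB0 : 0 < B 0 0) (hB1 : 0 < B 1 1) (hBA : B * A = 1) :
    StrictMono (lowFun A) := by
  have hinj : Function.Injective (lowFun A) :=
    Function.LeftInverse.injective (lowFun_inv hA hA0 hA1 hB hB0 hB1 hBA)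
  rcases (lowFun_continuous hA hA0 hA1).strictMono_of_inj hinj with h | h
  · exact h
  · have h1 : lowFun A (4 * Real.pi) < lowFun A 0 := h (by positivity)
    have h2 := Complex.neg_pi_lt_arg (turn A (4 * Real.pi))
    have h3 := Complex.arg_le_pi (turn A 0)
    simp only [lowFun] at h1
    linarith [Real.pi_pos]

theorem lowFun_lowMatrix_pi_div_two (s ν : ℝ) :
    lowFun (lowMatrix s ν) (Real.pi / 2) = Real.pi / 2 := by
  have h := lift_ofIwasawa (0, s, ν)
  have h1 : lowFun (lowMatrix s ν) (Real.pi / 2) - 0 = Real.pi / 2 - 0 := h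
  linarith

/-- The lift of the inverse is the translation by `z.1` followed by an increasing function fixing
π/2, so the argument of e₂ decreases exactly when `z.1` is negative. -/
theorem invIwasawa_fst_pos_iff (z : ℝ × ℝ × ℝ) : 0 < (invIwasawa z).1 ↔ z.1 < 0 := by
  have hm := strictMono_lowFun (lowMatrix_zero_one (-z.2.1) (-(Real.exp (-z.2.1) * z.2.2)))
    (lowMatrix_zero_zero _ _) (lowMatrix_one_one _ _) (lowMatrix_zero_one z.2.1 z.2.2)
    (lowMatrix_zero_zero _ _) (lowMatrix_one_one _ _) (mul_eq_one_comm.1 (lowMatrix_mul _ _))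
  change 0 < Real.pi / 2 - lift (ofIwasawa z)⁻¹ (Real.pi / 2) ↔ _
  rw [lift_ofIwasawa_inv, sub_pos]
  conv_lhs => rhs; rw [← lowFun_lowMatrix_pi_div_two (-z.2.1) (-(Real.exp (-z.2.1) * z.2.2))]
  rw [hm.lt_iff_lt]
  constructor <;> intro h <;> linarith

theorem mem_G₀_iff (g : CoverSL2) : g ∈ G₀ ↔ 0 < (toIwasawa g).1 := by
  change lift g (Real.pi / 2) < Real.pi / 2 ↔ 0 < Real.pi / 2 - lift g (Real.pi / 2)
  exact sub_pos.symm

/-- The element of `G` with total argument `θ`, inverse to the element with Iwasawa coordinates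
`(-θ, a, b)`. -/
def ofArgument (θ a b : ℝ) : CoverSL2 := (ofIwasawa (-θ, a, b))⁻¹

theorem ofArgument_mem_G₀ {θ : ℝ} (hθ : 0 < θ) (a b : ℝ) : ofArgument θ a b ∈ G₀ := by
  rw [mem_G₀_iff]
  exact (invIwasawa_fst_pos_iff (-θ, a, b)).2 (neg_neg_of_pos hθ)

theorem contMDiff_toIwasawa :
    ContMDiff 𝓘(ℝ, ℝ × ℝ × ℝ) 𝓘(ℝ, ℝ × ℝ × ℝ) ∞ toIwasawa := by
  have h := contMDiffOn_chart (I := 𝓘(ℝ, ℝ × ℝ × ℝ)) (n := ∞) (x := (1 : CoverSL2))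
  exact contMDiffOn_univ.1 h

theorem contMDiff_ofIwasawa :
    ContMDiff 𝓘(ℝ, ℝ × ℝ × ℝ) 𝓘(ℝ, ℝ × ℝ × ℝ) ∞ ofIwasawa := by
  have h := contMDiffOn_chart_symm (I := 𝓘(ℝ, ℝ × ℝ × ℝ)) (n := ∞) (x := (1 : CoverSL2))
  exact contMDiffOn_univ.1 h

/-- The logarithm of the total argument, and the other two Iwasawa coordinates of the inverse,
as coordinates on `G₀`. -/
def logCoordinates : G₀ ≃ₘ⟮𝓘(ℝ, ℝ × ℝ × ℝ), 𝓘(ℝ, ℝ × ℝ × ℝ)⟯ (ℝ × ℝ × ℝ) where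
  toFun g := (Real.log (-(invIwasawa (toIwasawa g.1)).1), (invIwasawa (toIwasawa g.1)).2)
  invFun x := ⟨ofArgument (Real.exp x.1) x.2.1 x.2.2, ofArgument_mem_G₀ (Real.exp_pos _) _ _⟩
  left_inv g := by
    refine Subtype.ext ?_
    have h : (invIwasawa (toIwasawa g.1)).1 < 0 := by
      rw [← invIwasawa_fst_pos_iff, invIwasawa_invIwasawa]
      exact (mem_G₀_iff _).1 g.2
    change (ofIwasawa (-Real.exp (Real.log (-(invIwasawa (toIwasawa g.1)).1)),
      (invIwasawa (toIwasawa g.1)).2))⁻¹ = g.1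
    rw [Real.exp_log (neg_pos.2 h), neg_neg, ← ofIwasawa_invIwasawa, invIwasawa_invIwasawa,
      ofIwasawa_toIwasawa]
  right_inv x := by
    have h : invIwasawa (toIwasawa (ofArgument (Real.exp x.1) x.2.1 x.2.2)) =
        (-Real.exp x.1, x.2.1, x.2.2) := by
      rw [invIwasawa, ofIwasawa_toIwasawa, ofArgument, inv_inv, toIwasawa_ofIwasawa]
    simp only [h, neg_neg, Real.log_exp]
  contMDiff_toFun := by
    have h1 : ContMDiff 𝓘(ℝ, ℝ × ℝ × ℝ) 𝓘(ℝ, ℝ × ℝ × ℝ) ∞ fun g : G₀ =>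
        invIwasawa (toIwasawa g.1) :=
      contDiff_invIwasawa.contMDiff.comp (contMDiff_toIwasawa.comp contMDiff_subtype_val)
    have h : ∀ g : G₀, -(invIwasawa (toIwasawa g.1)).1 ≠ 0 := fun g => by
      have : (invIwasawa (toIwasawa g.1)).1 < 0 := by
        rw [← invIwasawa_fst_pos_iff, invIwasawa_invIwasawa]
        exact (mem_G₀_iff _).1 g.2
      exact (neg_pos.2 this).ne'
    refine ContMDiff.prodMk_space (fun g => ?_) (contDiff_snd.contMDiff.comp h1)
    have h2 : ContMDiff 𝓘(ℝ, ℝ × ℝ × ℝ) 𝓘(ℝ, ℝ) ∞ fun g : G₀ =>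
        -(invIwasawa (toIwasawa g.1)).1 := (contDiff_fst.neg).contMDiff.comp h1
    exact (Real.contDiffAt_log.2 (h g)).contMDiffAt.comp g (h2 g)
  contMDiff_invFun := by
    rw [← ContMDiff.subtypeVal_comp_iff]
    have h : ContDiff ℝ ∞ fun x : ℝ × ℝ × ℝ => invIwasawa (-Real.exp x.1, x.2.1, x.2.2) :=
      contDiff_invIwasawa.comp (by fun_prop)
    exact (contMDiff_ofIwasawa.comp h.contMDiff).congr fun x => (ofIwasawa_invIwasawa _).symm

/-! ### The monodromy -/

theorem continuous_ofArgument {θ a b : ℝ → ℝ} (hθ : Continuous θ) (ha : Continuous a)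
    (hb : Continuous b) : Continuous fun t => ofArgument (θ t) (a t) (b t) := by
  have hz : Continuous fun t => (-θ t, a t, b t) := hθ.neg.prodMk (ha.prodMk hb)
  have h : Continuous fun t => ofIwasawa (invIwasawa (-θ t, a t, b t)) :=
    iwasawa.continuous_invFun.comp (contDiff_invIwasawa.continuous.comp hz)
  exact h.congr fun t => ofIwasawa_invIwasawa _

theorem ofArgument_zero : ofArgument 0 0 0 = 1 := by
  have h : ofIwasawa (-0, 0, 0) = 1 := by
    refine ext_of_eq ?_ ?_
    · ext i j
      rw [proj_ofIwasawa_apply, map_one]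
      fin_cases i <;> fin_cases j <;> simp
    · rw [lift_ofIwasawa]
      change Real.pi / 2 - -0 = Real.pi / 2
      simp
  rw [ofArgument, h, inv_one]

/-- This is the reason for the inverse in `ofArgument`: left Iwasawa coordinates give the polar form
of the second column, and inversion moves it to the first row, the curve (v₁, v₂). -/
theorem proj_ofArgument (θ a b : ℝ) (i j : Fin 2) : proj (ofArgument θ a b) i j =
    !![Real.exp (-(a / 2)) * Real.cos θ, Real.exp (-(a / 2)) * Real.sin θ;
      -(Real.exp (a / 2) * Real.sin θ) - Real.exp (-(a / 2)) * (b / 2 * Real.cos θ),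
      Real.exp (a / 2) * Real.cos θ - Real.exp (-(a / 2)) * (b / 2 * Real.sin θ)] i j := by
  rw [ofArgument, proj_inv]
  simp only [proj_ofIwasawa_apply]
  fin_cases i <;> fin_cases j <;> simp <;> ring

theorem fundEntry_apply (w w₁ : CI) (i j : Fin 2) (t : Icc (0 : ℝ) (2 * Real.pi)) :
    fundEntry w w₁ i j t = proj (ofArgument (prim (NormedSpace.exp w) t) (w t) (w₁ t)) i j := by
  rw [proj_ofArgument]
  fin_cases i <;> fin_cases j <;> simp [fundEntry, exp_apply, cosCI, sinCI, neg_div] <;> ring_nf <;> simp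

theorem integral_rep_mul {m : ℕ} (q : sobolevCircle (m + 1)) (f : CI) {g : ℝ → ℝ}
    (hg : ∀ s ∈ Icc (0 : ℝ) (2 * Real.pi), g s = ext f s) {t : ℝ}
    (ht : t ∈ Icc (0 : ℝ) (2 * Real.pi)) :
    ∫ s in (0 : ℝ)..t, q.1 0 s * g s = ∫ s in (0 : ℝ)..t, ext (rep (m + 1) 0 q * f) s := by
  refine L2Circle.integral_congr ?_ ht
  have h1 := coeFn_toL2 (rep (m + 1) 0 q)
  rw [toL2_rep] at h1
  filter_upwards [h1, ae_restrict_mem measurableSet_Icc] with s hs hm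
  rw [hg s hm, ← Fin.castSucc_zero, hs]
  rfl

/-- The formula holds along the whole interval: `ofArgument` of (∫ exp w, w, w') is a continuous
path in G starting at the identity and lying over the fundamental matrix, so its end point is in the
right sheet. -/
theorem isMonodromy_ofArgument {m : ℕ} {q : sobolevCircle (m + 1)} {w w₁ : CI}
    (h : IsKepler (rep (m + 1) 0 q) w w₁) (h0 : w left = 0) (h1 : w₁ left = 0) :
    IsMonodromy q (ofArgument (prim (NormedSpace.exp w) right) (w right) (w₁ right)) := by
  have hc : Continuous fun t : ℝ =>
      ofArgument (ext (prim (NormedSpace.exp w)) t) (ext w t) (ext w₁ t) :=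
    continuous_ofArgument (continuous_ext _) (continuous_ext _) (continuous_ext _)
  have he : ∀ i j, ∀ t ∈ Icc (0 : ℝ) (2 * Real.pi), proj (ofArgument
      (ext (prim (NormedSpace.exp w)) t) (ext w t) (ext w₁ t)) i j = ext (fundEntry w w₁ i j) t :=
    fun i j t ht => by
    rw [ext_of_mem _ ht, ext_of_mem _ ht, ext_of_mem _ ht, ext_of_mem _ ht, fundEntry_apply]
  refine ⟨fun t => ofArgument (ext (prim (NormedSpace.exp w)) t) (ext w t) (ext w₁ t),
    hc.continuousOn, ?_, ⟨(continuous_proj.comp hc).continuousOn, fun t ht i => ⟨?_, ?_⟩⟩, ?_⟩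
  · beta_reduce
    rw [ext_zero, ext_zero, ext_zero, h0, h1, prim_left, ofArgument_zero]
  · have h2 := (h.isLinSol_fundEntry i).1.apply_eq ⟨t, ht⟩
    rw [← ext_of_mem _ ht, fundEntry_left h0 h1, prim_apply] at h2
    rw [he 0 i t ht, h2]
    congr 1
    refine intervalIntegral.integral_congr fun s hs => ?_
    rw [uIcc_of_le ht.1] at hs
    exact (he 1 i s ⟨hs.1, hs.2.trans ht.2⟩).symm
  · have h2 := (h.isLinSol_fundEntry i).2.apply_eq ⟨t, ht⟩
    rw [← ext_of_mem _ ht, fundEntry_left h0 h1, prim_apply] at h2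
    rw [he 1 i t ht, h2]
    congr 1
    exact (integral_rep_mul q _ (he 0 i) ht).symm
  · beta_reduce
    rw [ext_two_pi, ext_two_pi, ext_two_pi]

theorem exists_monodromy_diffeomorph (m : ℕ) {ℍ : Type*} [NormedAddCommGroup ℍ]
    [InnerProductSpace ℝ ℍ] [CompleteSpace ℍ] [TopologicalSpace.SeparableSpace ℍ]
    (hℍ : ¬ FiniteDimensional ℝ ℍ) :
    ∃ T : ((ℝ × ℝ × ℝ) × ℍ) ≃ₘ⟮𝓘(ℝ, (ℝ × ℝ × ℝ) × ℍ), 𝓘(ℝ, sobolevCircle (m + 1))⟯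
        sobolevCircle (m + 1),
      ∀ x, IsMonodromy (T x) (ofArgument (Real.exp x.1.1) x.1.2.1 x.1.2.2) := by
  obtain ⟨T, R, hT, hR, hRT, hTR, hk⟩ := exists_potential_coordinates m hℍ
  refine ⟨⟨⟨T, R, hRT, hTR⟩, hT.contMDiff, hR.contMDiff⟩, fun x => ?_⟩
  obtain ⟨w, w₁, h, h0, h1, h2, h3, h4⟩ := hk x
  rw [← h2, ← h3, ← h4]
  exact isMonodromy_ofArgument h h0 h1

theorem exists_G₀_diffeomorph (m : ℕ) {ℍ : Type*} [NormedAddCommGroup ℍ]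
    [InnerProductSpace ℝ ℍ] [CompleteSpace ℍ] [TopologicalSpace.SeparableSpace ℍ]
    (hℍ : ¬ FiniteDimensional ℝ ℍ) :
    ∃ Ψ : (G₀ × ℍ) ≃ₘ⟮𝓘(ℝ, ℝ × ℝ × ℝ).prod 𝓘(ℝ, ℍ), 𝓘(ℝ, sobolevCircle (m + 1))⟯
        sobolevCircle (m + 1),
      ∀ (g : G₀) (h : ℍ), IsMonodromy (Ψ (g, h)) g := by
  obtain ⟨T, hT⟩ := exists_monodromy_diffeomorph m hℍ
  refine ⟨⟨⟨fun x => T (logCoordinates x.1, x.2),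
    fun q => (logCoordinates.symm (T.symm q).1, (T.symm q).2), fun x => ?_, fun q => ?_⟩, ?_, ?_⟩,
    fun g h => ?_⟩
  · simp
  · simp
  · exact T.contMDiff_toFun.comp
      ((logCoordinates.contMDiff_toFun.comp contMDiff_fst).prodMk_space contMDiff_snd)
  · exact (logCoordinates.symm.contMDiff_toFun.comp
      (contDiff_fst.contMDiff.comp T.symm.contMDiff_toFun)).prodMk
      (contDiff_snd.contMDiff.comp T.symm.contMDiff_toFun)
  · have h1 := hT (logCoordinates g, h)
    have h2 := congrArg Subtype.val (logCoordinates.symm_apply_apply g)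
    exact h2 ▸ h1

/-! ### Kernel strata as conditions on the monodromy -/

/-! ### Products of Sobolev functions -/

/-- The product rule for absolutely continuous functions; the derivative is again square integrable
because the primitives are bounded. -/
theorem exists_primL2_mul (x y : L2Circle) : ∃ z : L2Circle, primL2 x * primL2 y = primL2 z := by
  have hb : ∀ (f : CI) (u : L2Circle), MemLp (fun s => ext f s * u s) 2 circleMeasure := fun f u =>
    MemLp.of_le_mul (c := ‖f‖) (Lp.memLp u)
      ((continuous_ext f).aestronglyMeasurable.mul (Lp.aestronglyMeasurable u))
      (Filter.Eventually.of_forall fun s => by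
        rw [norm_mul]
        exact mul_le_mul_of_nonneg_right (abs_ext_le f s) (norm_nonneg _))
  have hz : MemLp (fun s => ext (primL2 y) s * x s + ext (primL2 x) s * y s) 2 circleMeasure :=
    (hb _ _).add (hb _ _)
  refine ⟨hz.toLp _, ?_⟩
  ext t
  rw [ContinuousMap.mul_apply, primL2_apply (hz.toLp _) t, L2Circle.integral_congr hz.coeFn_toLp t.2]
  have ix := L2Circle.intervalIntegrable_zero x t.2
  have iy := L2Circle.intervalIntegrable_zero y t.2
  have h := AbsolutelyContinuousOnInterval.integral_deriv_mul_eq_sub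
    (ix.absolutelyContinuousOnInterval_intervalIntegral (c := 0) left_mem_uIcc)
    (iy.absolutelyContinuousOnInterval_intervalIntegral (c := 0) left_mem_uIcc)
  simp only [intervalIntegral.integral_same, mul_zero, sub_zero] at h
  rw [primL2_apply, primL2_apply, ← h]
  refine intervalIntegral.integral_congr_ae ?_
  filter_upwards [ix.ae_hasDerivAt_integral, iy.ae_hasDerivAt_integral] with s hx hy hs
  have hs' := uIoc_subset_uIcc hs
  rw [uIoc_of_le t.2.1] at hs
  have hm : s ∈ Icc (0 : ℝ) (2 * Real.pi) := ⟨hs.1.le, hs.2.trans t.2.2⟩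
  rw [(hx hs' 0 left_mem_uIcc).deriv, (hy hs' 0 left_mem_uIcc).deriv, ext_of_mem _ hm,
    ext_of_mem _ hm, primL2_apply, primL2_apply]
  ring

/-- The continuous representatives of the functions in `H^{k+1}`. -/
def IsSobolev : ℕ → CI → Prop
  | 0, u => u left = u right ∧ ∃ (c : ℝ) (y : L2Circle), u = c • 1 + primL2 y
  | k + 1, u => u left = u right ∧ ∃ u', IsDer u u' ∧ IsSobolev k u'

variable {k m : ℕ} {u v u' : CI}

theorem IsDer.isSobolev_zero (h : IsDer u u') (hp : u left = u right) : IsSobolev 0 u :=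
  ⟨hp, u left, toL2 u', by rw [primL2_toL2, ← h.eq]⟩

theorem IsSobolev.of_succ (h : IsSobolev (k + 1) u) : IsSobolev k u := by
  induction k generalizing u with
  | zero =>
    obtain ⟨hp, u', hd, -⟩ := h
    exact hd.isSobolev_zero hp
  | succ k ih =>
    obtain ⟨hp, u', hd, h'⟩ := h
    exact ⟨hp, u', hd, ih h'⟩

theorem IsSobolev.add (hu : IsSobolev k u) (hv : IsSobolev k v) : IsSobolev k (u + v) := by
  induction k generalizing u v with
  | zero =>
    obtain ⟨pu, c, y, hy⟩ := hu
    obtain ⟨pv, d, z, hz⟩ := hv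
    refine ⟨?_, c + d, y + z, ?_⟩
    · rw [ContinuousMap.add_apply, pu, pv, ContinuousMap.add_apply]
    · rw [hy, hz, map_add]
      module
  | succ k ih =>
    obtain ⟨pu, u', du, hu'⟩ := hu
    obtain ⟨pv, v', dv, hv'⟩ := hv
    exact ⟨by rw [ContinuousMap.add_apply, pu, pv, ContinuousMap.add_apply], _, du.add dv,
      ih hu' hv'⟩

theorem IsSobolev.mul (hu : IsSobolev k u) (hv : IsSobolev k v) : IsSobolev k (u * v) := by
  induction k generalizing u v with
  | zero =>
    obtain ⟨pu, c, y, hy⟩ := hu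
    obtain ⟨pv, d, z, hz⟩ := hv
    obtain ⟨x, hx⟩ := exists_primL2_mul y z
    refine ⟨?_, c * d, c • z + d • y + x, ?_⟩
    · rw [ContinuousMap.mul_apply, pu, pv, ContinuousMap.mul_apply]
    · rw [hy, hz, map_add, map_add, map_smul, map_smul, ← hx]
      simp only [add_mul, mul_add, smul_mul_assoc, mul_smul_comm, one_mul, mul_one]
      module
  | succ k ih =>
    have su := hu.of_succ
    have sv := hv.of_succ
    obtain ⟨pu, u', du, hu'⟩ := hu
    obtain ⟨pv, v', dv, hv'⟩ := hv
    exact ⟨by rw [ContinuousMap.mul_apply, pu, pv, ContinuousMap.mul_apply], _, du.mul dv,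
      (ih hu' sv).add (ih su hv')⟩

/-- Regularity by bootstrapping: if v is in the class j, so is v'' = qv, and v gains two
derivatives. Periodicity is needed as a hypothesis only for v and v'; for higher derivatives it is
inherited from qv. -/
theorem IsLinSol.isSobolev {q v v₁ : CI} (h : IsLinSol q v v₁) (hq : IsSobolev m q)
    (p0 : v left = v right) (p1 : v₁ left = v₁ right) : IsSobolev (m + 2) v := by
  have step : ∀ j, IsSobolev j q → IsSobolev j v → IsSobolev (j + 2) v := fun j hj hv =>
    ⟨p0, v₁, h.1, p1, _, h.2, hj.mul hv⟩
  have key : ∀ j, IsSobolev j q → IsSobolev j v := fun j => by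
    induction j with
    | zero => exact fun _ => h.1.isSobolev_zero p0
    | succ j ih => exact fun hj => (step j hj.of_succ (ih hj.of_succ)).of_succ
  exact step m hq (key m hq)

theorem isSobolev_rep (u : sobolevCircle (m + 1)) : IsSobolev m (rep (m + 1) 0 u) := by
  have key : ∀ k (j : Fin (m + 1)), (j : ℕ) + k = m → IsSobolev k (rep (m + 1) j u) := fun k => by
    induction k with
    | zero =>
      intro j _
      refine ⟨rep_periodic j u, ?_⟩
      obtain ⟨⟨c, hc⟩, -⟩ := isPeriodicDeriv_iff.1 (u.2 j)
      exact ⟨c, _, toL2_injective ((toL2_rep j u).trans hc)⟩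
    | succ k ih =>
      intro j hj
      have hj' : (j : ℕ) + 1 < m + 1 := by omega
      exact ⟨rep_periodic j u, _, isDer_rep j ⟨j + 1, hj'⟩ rfl u, ih _ (by simp; omega)⟩
  exact key m 0 (by simp)

theorem IsSobolev.exists_rep_eq (h : IsSobolev k u) :
    ∃ v : sobolevCircle (k + 1), rep (k + 1) 0 v = u := by
  induction k generalizing u with
  | zero =>
    obtain ⟨hp, c, y, hy⟩ := h
    have hd : IsPeriodicDeriv (toL2 u) y := by
      refine isPeriodicDeriv_iff.2 ⟨⟨c, by rw [hy]⟩, ?_⟩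
      rw [hy] at hp
      simpa [primL2_left] using hp.symm
    refine ⟨⟨WithLp.toLp 2 (Fin.cons (toL2 u) fun _ => y), fun j => ?_⟩, ?_⟩
    · fin_cases j
      exact hd
    · exact toL2_injective (toL2_rep _ _)
  | succ k ih =>
    obtain ⟨hp, u', hd, h'⟩ := h
    obtain ⟨v, hv⟩ := ih h'
    refine ⟨⟨WithLp.toLp 2 (Fin.cons (toL2 u) v.1), fun j => ?_⟩, toL2_injective (toL2_rep _ _)⟩
    refine Fin.cases ?_ (fun i => ?_) j
    · have h0 : IsPeriodicDeriv (toL2 u) (v.1 0) := by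
        have := isPeriodicDeriv_toL2 hd hp
        rwa [← hv, toL2_rep] at this
      exact h0
    · exact v.2 i

/-! ### The kernel of the Sturm-Liouville operator -/

theorem toL2_mul_toL2 (f g : CI) : ((toL2 f : L2Circle) : ℝ →ₘ[circleMeasure] ℝ) *
    ((toL2 g : L2Circle) : ℝ →ₘ[circleMeasure] ℝ) = (toL2 (f * g) : L2Circle) := by
  refine AEEqFun.ext ?_
  filter_upwards [AEEqFun.coeFn_mul ((toL2 f : L2Circle) : ℝ →ₘ[circleMeasure] ℝ)
    ((toL2 g : L2Circle) : ℝ →ₘ[circleMeasure] ℝ), coeFn_toL2 f, coeFn_toL2 g,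
    coeFn_toL2 (f * g)] with s h h1 h2 h3
  rw [h, h3, Pi.mul_apply, h1, h2]
  rfl

theorem mem_ker_sturmLiouville_iff (q : sobolevCircle (m + 1)) (v : sobolevCircle (m + 1 + 2)) :
    v ∈ LinearMap.ker (sturmLiouville (m + 1) q) ↔
      IsLinSol (rep (m + 1) 0 q) (rep (m + 1 + 2) 0 v) (rep (m + 1 + 2) 1 v) := by
  have d0 : IsDer (rep (m + 1 + 2) 0 v) (rep (m + 1 + 2) 1 v) := isDer_rep 0 1 (by simp) v
  have d1 : IsDer (rep (m + 1 + 2) 1 v) (rep (m + 1 + 2) 2 v) := isDer_rep 1 2 rfl v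
  have e0 : q.1 0 = toL2 (rep (m + 1) 0 q) := (toL2_rep 0 q).symm
  have e1 : v.1 0 = toL2 (rep (m + 1 + 2) 0 v) := (toL2_rep 0 v).symm
  have e2 : v.1 2 = toL2 (rep (m + 1 + 2) 2 v) := (toL2_rep 2 v).symm
  rw [LinearMap.mem_ker]
  change -((v.1 2 : L2Circle) : ℝ →ₘ[circleMeasure] ℝ) +
    ((q.1 0 : L2Circle) : ℝ →ₘ[circleMeasure] ℝ) * ((v.1 0 : L2Circle) : ℝ →ₘ[circleMeasure] ℝ) = 0 ↔ _
  rw [e0, e1, e2, toL2_mul_toL2, neg_add_eq_zero]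
  constructor
  · intro h
    exact ⟨d0, d1.congr (toL2_injective (Subtype.ext h))⟩
  · intro h
    rw [d1.unique h.2]

/-- The initial values of a function in `H^{m+3}` and of its derivative. -/
def initialValues (m : ℕ) : sobolevCircle (m + 1 + 2) →ₗ[ℝ] (Fin 2 → ℝ) where
  toFun v := ![rep (m + 1 + 2) 0 v left, rep (m + 1 + 2) 1 v left]
  map_add' v w := by
    ext i
    fin_cases i <;> simp
  map_smul' a v := by
    ext i
    fin_cases i <;> simp

/-- The entries of the fundamental matrix of a potential, with value `A` at `2π`. -/
structure IsFundamentalSystem (q : CI) (A : SL(2, ℝ)) (F : Fin 2 → Fin 2 → CI) : Prop where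
  isLinSol : ∀ i, IsLinSol q (F 0 i) (F 1 i)
  left_eq : ∀ i j, F i j left = (1 : Matrix (Fin 2) (Fin 2) ℝ) i j
  right_eq : ∀ i j, F i j right = A i j

theorem exists_isFundamentalSystem {q : sobolevCircle (m + 1)} {g : CoverSL2}
    (h : IsMonodromy q g) : ∃ F, IsFundamentalSystem (rep (m + 1) 0 q) (proj g) F := by
  obtain ⟨Φ, -, h0, ⟨hc, hΦ⟩, rfl⟩ := h
  let F : Fin 2 → Fin 2 → CI := fun i j => ⟨fun t => proj (Φ t) i j, by
    have h1 : Continuous fun t : Icc (0 : ℝ) (2 * Real.pi) => proj (Φ t) :=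
      continuousOn_iff_continuous_domRestrict.1 hc
    exact (Continuous.subtype_val h1).matrix_elem i j⟩
  have hF : ∀ i j, ∀ s ∈ Icc (0 : ℝ) (2 * Real.pi), proj (Φ s) i j = ext (F i j) s :=
    fun i j s hs => (ext_of_mem (F i j) hs).symm
  refine ⟨F, fun i => ⟨?_, ?_⟩, fun i j => ?_, fun i j => rfl⟩
  · have e : F 0 i = ((1 : Matrix (Fin 2) (Fin 2) ℝ) 0 i) • 1 + prim (F 1 i) := by
      ext t
      refine ((hΦ t t.2 i).1).trans ?_
      rw [ContinuousMap.add_apply, prim_apply, ContinuousMap.smul_apply, ContinuousMap.one_apply,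
        smul_eq_mul, mul_one]
      congr 1
      refine intervalIntegral.integral_congr fun s hs => ?_
      rw [uIcc_of_le t.2.1] at hs
      exact hF 1 i s ⟨hs.1, hs.2.trans t.2.2⟩
    rw [e]
    exact isDer_smul_one_add_prim _ _
  · have e : F 1 i = ((1 : Matrix (Fin 2) (Fin 2) ℝ) 1 i) • 1 +
        prim (rep (m + 1) 0 q * F 0 i) := by
      ext t
      refine ((hΦ t t.2 i).2).trans ?_
      rw [ContinuousMap.add_apply, prim_apply, ContinuousMap.smul_apply, ContinuousMap.one_apply,
        smul_eq_mul, mul_one]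
      congr 1
      exact integral_rep_mul q _ (hF 0 i) t.2
    rw [e]
    exact isDer_smul_one_add_prim _ _
  · change proj (Φ 0) i j = _
    rw [h0, map_one]
    rfl

variable {q : sobolevCircle (m + 1)} {A : SL(2, ℝ)} {F : Fin 2 → Fin 2 → CI}

theorem IsFundamentalSystem.eq_add {Q v v₁ : CI} (hF : IsFundamentalSystem Q A F)
    (h : IsLinSol Q v v₁) : v = v left • F 0 0 + v₁ left • F 0 1 ∧
      v₁ = v left • F 1 0 + v₁ left • F 1 1 := by
  have hs := ((hF.isLinSol 0).smul (v left)).add ((hF.isLinSol 1).smul (v₁ left))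
  have e : v = v left • F 0 0 + v₁ left • F 0 1 := h.unique hs
    (by simp [hF.left_eq]) (by simp [hF.left_eq])
  have h1 := hs.1
  rw [← e] at h1
  exact ⟨e, h.1.unique h1⟩

/-- The vectors fixed by a matrix. -/
def fixedVectors (A : SL(2, ℝ)) : Submodule ℝ (Fin 2 → ℝ) :=
  LinearMap.ker (Matrix.toLin' (A.1 - 1))

theorem mem_fixedVectors_iff {c : Fin 2 → ℝ} : c ∈ fixedVectors A ↔
    A 0 0 * c 0 + A 0 1 * c 1 = c 0 ∧ A 1 0 * c 0 + A 1 1 * c 1 = c 1 := by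
  rw [fixedVectors, LinearMap.mem_ker, Matrix.toLin'_apply, Matrix.sub_mulVec, Matrix.one_mulVec,
    sub_eq_zero, funext_iff, Fin.forall_fin_two]
  simp [Matrix.mulVec, dotProduct, Fin.sum_univ_two]

/-- A solution with initial vector c has the vector Ac at 2π, so it closes up exactly when Ac = c;
it then has the required Sobolev regularity by `IsLinSol.isSobolev`. -/
theorem map_initialValues_ker (hF : IsFundamentalSystem (rep (m + 1) 0 q) A F) :
    (LinearMap.ker (sturmLiouville (m + 1) q)).map (initialValues m) = fixedVectors A := by
  ext c
  rw [mem_fixedVectors_iff]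
  constructor
  · rintro ⟨v, hv, rfl⟩
    obtain ⟨e0, e1⟩ := hF.eq_add ((mem_ker_sturmLiouville_iff q v).1 hv)
    have h0 := congrArg (fun f : CI => f right) e0
    have h1 := congrArg (fun f : CI => f right) e1
    simp only [ContinuousMap.add_apply, ContinuousMap.smul_apply, hF.right_eq, smul_eq_mul,
      ← rep_periodic] at h0 h1
    change A 0 0 * rep (m + 1 + 2) 0 v left + A 0 1 * rep (m + 1 + 2) 1 v left = _ ∧
      A 1 0 * rep (m + 1 + 2) 0 v left + A 1 1 * rep (m + 1 + 2) 1 v left = _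
    exact ⟨by linarith [h0, show initialValues m v 0 = rep (m + 1 + 2) 0 v left from rfl],
      by linarith [h1, show initialValues m v 1 = rep (m + 1 + 2) 1 v left from rfl]⟩
  · rintro ⟨h0, h1⟩
    have hs := ((hF.isLinSol 0).smul (c 0)).add ((hF.isLinSol 1).smul (c 1))
    have l0 : (c 0 • F 0 0 + c 1 • F 0 1) left = c 0 := by simp [hF.left_eq]
    have l1 : (c 0 • F 1 0 + c 1 • F 1 1) left = c 1 := by simp [hF.left_eq]
    have r0 : (c 0 • F 0 0 + c 1 • F 0 1) right = c 0 := by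
      simp only [ContinuousMap.add_apply, ContinuousMap.smul_apply, hF.right_eq, smul_eq_mul]
      linarith
    have r1 : (c 0 • F 1 0 + c 1 • F 1 1) right = c 1 := by
      simp only [ContinuousMap.add_apply, ContinuousMap.smul_apply, hF.right_eq, smul_eq_mul]
      linarith
    obtain ⟨v, hv⟩ := (hs.isSobolev (isSobolev_rep q) (l0.trans r0.symm)
      (l1.trans r1.symm)).exists_rep_eq
    have hv' : rep (m + 1 + 2) 0 v = c 0 • F 0 0 + c 1 • F 0 1 := hv
    have hv1 : rep (m + 1 + 2) 1 v = c 0 • F 1 0 + c 1 • F 1 1 :=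
      (isDer_rep 0 1 (by simp) v).unique (hv' ▸ hs.1)
    refine ⟨v, (mem_ker_sturmLiouville_iff q v).2 (by rw [hv', hv1]; exact hs), ?_⟩
    funext i
    fin_cases i
    · exact (congrArg (fun f : CI => f left) hv').trans l0
    · exact (congrArg (fun f : CI => f left) hv1).trans l1

/-- Solutions are determined by their initial values, so the kernel is isomorphic to the space of
fixed vectors. -/
theorem mem_kernelStratum_iff (hF : IsFundamentalSystem (rep (m + 1) 0 q) A F) (j : ℕ) :
    q ∈ kernelStratum (m + 1) j ↔ j ≤ Module.finrank ℝ (fixedVectors A) := by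
  have hinj : Function.Injective ((initialValues m).domRestrict
      (LinearMap.ker (sturmLiouville (m + 1) q))) := by
    rw [← LinearMap.ker_eq_bot, LinearMap.ker_eq_bot']
    rintro ⟨v, hv⟩ h
    obtain ⟨e0, -⟩ := hF.eq_add ((mem_ker_sturmLiouville_iff q v).1 hv)
    have h0 : rep (m + 1 + 2) 0 v left = 0 := congrFun h 0
    have h1 : rep (m + 1 + 2) 1 v left = 0 := congrFun h 1
    rw [h0, h1, zero_smul, zero_smul, add_zero] at e0
    exact Subtype.ext (rep_injective (e0.trans (map_zero _).symm))
  have hr := (LinearEquiv.ofInjective _ hinj).rank_eq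
  rw [LinearMap.range_domRestrict, map_initialValues_ker hF] at hr
  change (j : Cardinal) ≤ _ ↔ _
  rw [hr, ← Module.finrank_eq_rank, Nat.cast_le]

/-- For det A = 1, det(A - I) = 2 - tr A. -/
theorem one_le_finrank_fixedVectors_iff :
    1 ≤ Module.finrank ℝ (fixedVectors A) ↔ A.1.trace = 2 := by
  have hdet : A 0 0 * A 1 1 - A 0 1 * A 1 0 = 1 := by
    rw [← Matrix.det_fin_two]
    exact A.2
  rw [Submodule.one_le_finrank_iff, Submodule.ne_bot_iff]
  have h : (∃ c ∈ fixedVectors A, c ≠ 0) ↔ ∃ c ≠ 0, (A.1 - 1).mulVec c = 0 := by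
    simp only [fixedVectors, LinearMap.mem_ker, Matrix.toLin'_apply]
    exact exists_congr fun c => and_comm
  rw [h, Matrix.exists_mulVec_eq_zero_iff, Matrix.det_fin_two, Matrix.trace_fin_two]
  simp only [Matrix.sub_apply, Matrix.one_apply_eq, Matrix.one_apply_ne (zero_ne_one (α := Fin 2)),
    Matrix.one_apply_ne (one_ne_zero (α := Fin 2)), sub_zero]
  constructor <;> intro h <;> linarith

theorem two_le_finrank_fixedVectors_iff :
    2 ≤ Module.finrank ℝ (fixedVectors A) ↔ A = 1 := by
  constructor
  · intro h
    have h2 : fixedVectors A = ⊤ := Submodule.eq_top_of_finrank_eq (le_antisymm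
      (Submodule.finrank_le _) (by simpa using h))
    have h0 : (Pi.single 0 1 : Fin 2 → ℝ) ∈ fixedVectors A := h2 ▸ Submodule.mem_top
    have h1 : (Pi.single 1 1 : Fin 2 → ℝ) ∈ fixedVectors A := h2 ▸ Submodule.mem_top
    rw [mem_fixedVectors_iff] at h0 h1
    simp at h0 h1
    ext i j
    fin_cases i <;> fin_cases j <;> simp [h0, h1]
  · rintro rfl
    have : fixedVectors 1 = ⊤ := by
      rw [fixedVectors]
      simp
    rw [this, finrank_top]
    simp

/-! ### The center -/

theorem turn_sub_int_mul_two_pi (A : SL(2, ℝ)) (x : ℝ) (k : ℤ) :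
    turn A (x - k * (2 * Real.pi)) = turn A x := by
  simp only [turn, Real.cos_sub_int_mul_two_pi, Real.sin_sub_int_mul_two_pi]

theorem exists_eq_rotElement {g : CoverSL2} (h : proj g = 1) :
    ∃ k : ℤ, g = rotElement (k * (2 * Real.pi)) := by
  obtain ⟨r, hr, e⟩ := isAngleLift g (Real.pi / 2)
  rw [h] at e
  obtain ⟨k, hk⟩ := exists_int_of_unitVec (x := Real.pi / 2) (y := lift g (Real.pi / 2)) one_pos hr
    (by simpa using e)
  refine ⟨k, ext_of_eq ?_ ?_⟩
  · have hs : Real.sin (k * (2 * Real.pi)) = 0 := by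
      simpa using Real.sin_add_int_mul_two_pi 0 k
    rw [h]
    change 1 = rotMatrix _
    ext i j
    fin_cases i <;> fin_cases j <;>
      simp [rotMatrix, Real.cos_int_mul_two_pi, hs]
  · change _ = Real.pi / 2 - k * (2 * Real.pi)
    linarith

/-- An element over the identity shifts arguments by a multiple of 2π, and every lift commutes with
such shifts. -/
theorem mem_center_of_proj_eq_one {g : CoverSL2} (h : proj g = 1) :
    g ∈ Subgroup.center CoverSL2 := by
  rw [Subgroup.mem_center_iff]
  intro f
  refine ext_of_eq ?_ ?_
  · rw [map_mul, map_mul, h, mul_one, one_mul]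
  · obtain ⟨k, rfl⟩ := exists_eq_rotElement h
    obtain ⟨z, rfl⟩ : ∃ z, f = ofIwasawa z := ⟨_, (ofIwasawa_toIwasawa f).symm⟩
    change lowFun (lowMatrix z.2.1 z.2.2) (Real.pi / 2 - k * (2 * Real.pi)) - z.1 =
      lowFun (lowMatrix z.2.1 z.2.2) (Real.pi / 2) - z.1 - k * (2 * Real.pi)
    rw [lowFun, lowFun, turn_sub_int_mul_two_pi]
    ring

/-- A matrix commuting with the rotation by π/2 and with (1, 0; 1, 1) is scalar, and trace 2 makes
the scalar 1. -/
theorem proj_eq_one_of_mem_center {g : CoverSL2} (h : g ∈ Subgroup.center CoverSL2)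
    (ht : (proj g).1.trace = 2) : proj g = 1 := by
  rw [Subgroup.mem_center_iff] at h
  have h1 := congrArg proj (h (rotElement (Real.pi / 2)))
  have h2 := congrArg proj (h (lowElement 0 2))
  rw [map_mul, map_mul] at h1 h2
  change rotMatrix (Real.pi / 2) * proj g = proj g * rotMatrix (Real.pi / 2) at h1
  change lowMatrix 0 2 * proj g = proj g * lowMatrix 0 2 at h2
  have e1 := fun i j => congrArg (fun M : SL(2, ℝ) => M i j) h1
  have e2 := fun i j => congrArg (fun M : SL(2, ℝ) => M i j) h2
  simp only [Matrix.SpecialLinearGroup.coe_mul, Matrix.mul_apply, Fin.sum_univ_two] at e1 e2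
  have a1 := e1 0 0
  have a2 := e1 0 1
  have a3 := e2 0 0
  rw [Matrix.trace_fin_two] at ht
  simp [rotMatrix, lowMatrix] at a1 a2 a3
  ext i j
  fin_cases i <;> fin_cases j <;> simp <;> linarith

/-! ### The strata -/

theorem mem_kernelStratum_one_iff {g : CoverSL2} (h : IsMonodromy q g) :
    q ∈ kernelStratum (m + 1) 1 ↔ g ∈ traceLevel 2 := by
  obtain ⟨F, hF⟩ := exists_isFundamentalSystem h
  exact (mem_kernelStratum_iff hF 1).trans one_le_finrank_fixedVectors_iff

theorem mem_kernelStratum_two_iff {g : CoverSL2} (h : IsMonodromy q g) :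
    q ∈ kernelStratum (m + 1) 2 ↔
      g ∈ (Subgroup.center CoverSL2 : Set CoverSL2) ∩ traceLevel 2 := by
  obtain ⟨F, hF⟩ := exists_isFundamentalSystem h
  refine ((mem_kernelStratum_iff hF 2).trans two_le_finrank_fixedVectors_iff).trans
    ⟨fun h1 => ⟨mem_center_of_proj_eq_one h1, ?_⟩, fun h1 => proj_eq_one_of_mem_center h1.1 h1.2⟩
  change (proj g).1.trace = 2
  rw [h1]
  simp

theorem image_eq_of_forall_iff {X Y : Type*} {f : X → Y} (hf : Function.Surjective f) {s : Set X}
    {t : Set Y} (h : ∀ x, f x ∈ t ↔ x ∈ s) : f '' s = t := by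
  have e : s = f ⁻¹' t := Set.ext fun x => (h x).symm
  rw [e, image_preimage_eq t hf]

/-! ### The surface of trace 2 and its model in ℝ³ -/

/-! ### The trace in logarithmic coordinates -/

theorem trace_ofArgument (θ a b : ℝ) : (proj (ofArgument θ a b)).1.trace =
    2 * Real.cosh (a / 2) * Real.cos θ - Real.exp (-(a / 2)) * (b / 2) * Real.sin θ := by
  rw [Matrix.trace_fin_two, proj_ofArgument, proj_ofArgument, Real.cosh_eq]
  simp
  ring

/-- The trace of the element of `G₀` with total argument `exp x.1`. -/
def logTrace (x : ℝ × ℝ × ℝ) : ℝ := 2 * Real.cosh (x.2.1 / 2) * Real.cos (Real.exp x.1) -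
  Real.exp (-(x.2.1 / 2)) * (x.2.2 / 2) * Real.sin (Real.exp x.1)

theorem contDiff_logTrace : ContDiff ℝ ∞ logTrace := by
  have h : ContDiff ℝ ∞ fun x : ℝ × ℝ × ℝ => Real.cosh (x.2.1 / 2) :=
    Real.contDiff_cosh.comp (by fun_prop)
  exact ContDiff.sub ((contDiff_const.mul h).mul (by fun_prop)) (by fun_prop)

/-! ### Shifting the trace for total arguments less than `π` -/

/-- The change of the third coordinate which adds `φ t` to the trace `t`, where the total argument
is less than `π`. -/
def shear (φ : ℝ → ℝ) (x : ℝ × ℝ × ℝ) : ℝ × ℝ × ℝ :=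
  (x.1, x.2.1, if Real.exp x.1 < Real.pi then
    x.2.2 - 2 * Real.exp (x.2.1 / 2) * φ (logTrace x) / Real.sin (Real.exp x.1) else x.2.2)

/-- The factor 1 / sin θ does no harm: at θ = π the trace is -2 cosh(a/2) ≤ -2, so nearby it is
below -1, where φ vanishes and the shear is the identity. -/
theorem contDiff_shear {φ : ℝ → ℝ} (hφ : ContDiff ℝ ∞ φ) (h0 : ∀ t ≤ -1, φ t = 0) :
    ContDiff ℝ ∞ (shear φ) := by
  refine contDiff_fst.prodMk ((contDiff_fst.comp contDiff_snd).prodMk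
    (contDiff_iff_contDiffAt.2 fun x => ?_))
  have hc : Continuous fun x : ℝ × ℝ × ℝ => Real.exp x.1 := by fun_prop
  rcases lt_or_ge (Real.exp x.1) Real.pi with h | h
  · have h1 : ContDiffAt ℝ ∞ (fun x : ℝ × ℝ × ℝ => x.2.2 -
        2 * Real.exp (x.2.1 / 2) * φ (logTrace x) / Real.sin (Real.exp x.1)) x := by
      have h2 : ContDiffAt ℝ ∞ (fun x : ℝ × ℝ × ℝ => φ (logTrace x)) x :=
        (hφ.comp contDiff_logTrace).contDiffAt
      refine ContDiffAt.sub (by fun_prop) (ContDiffAt.div (ContDiffAt.mul (by fun_prop) h2)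
        (by fun_prop) (Real.sin_pos_of_pos_of_lt_pi (Real.exp_pos _) h).ne')
    refine h1.congr_of_eventuallyEq ?_
    filter_upwards [(isOpen_lt hc continuous_const).mem_nhds h] with y hy
    exact if_pos hy
  · have h1 : ∀ᶠ y : ℝ × ℝ × ℝ in nhds x, Real.pi < Real.exp y.1 ∨ logTrace y < -1 := by
      rcases eq_or_lt_of_le h with h | h
      · have h2 : logTrace x < -1 := by
          rw [logTrace, ← h, Real.cos_pi, Real.sin_pi]
          linarith [Real.one_le_cosh (x.2.1 / 2)]
        filter_upwards [(isOpen_lt contDiff_logTrace.continuous continuous_const).mem_nhds h2]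
          with y hy
        exact Or.inr hy
      · filter_upwards [(isOpen_lt continuous_const hc).mem_nhds h] with y hy
        exact Or.inl hy
    have h2 : ContDiffAt ℝ ∞ (fun x : ℝ × ℝ × ℝ => x.2.2) x := by fun_prop
    refine h2.congr_of_eventuallyEq ?_
    filter_upwards [h1] with y hy
    split_ifs with hlt
    · rw [h0 _ (hy.resolve_left hlt.not_gt).le, mul_zero, zero_div, sub_zero]
    · rfl

/-- The trace is affine in the third coordinate with slope -exp(-a/2) sin θ / 2, which is nonzero
for 0 < θ < π and explains the correction in `shear`. -/
theorem logTrace_shear_of_lt (φ : ℝ → ℝ) {x : ℝ × ℝ × ℝ} (h : Real.exp x.1 < Real.pi) :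
    logTrace (shear φ x) = logTrace x + φ (logTrace x) := by
  have hs := (Real.sin_pos_of_pos_of_lt_pi (Real.exp_pos _) h).ne'
  have he : Real.exp (-(x.2.1 / 2)) * Real.exp (x.2.1 / 2) = 1 := by
    rw [← Real.exp_add, neg_add_cancel, Real.exp_zero]
  have e : shear φ x = (x.1, x.2.1,
      x.2.2 - 2 * Real.exp (x.2.1 / 2) * φ (logTrace x) / Real.sin (Real.exp x.1)) := by
    rw [shear, if_pos h]
  rw [e]
  generalize φ (logTrace x) = r
  simp only [logTrace]
  field_simp
  linear_combination 2 * r * he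

theorem shear_of_le (φ : ℝ → ℝ) {x : ℝ × ℝ × ℝ} (h : Real.pi ≤ Real.exp x.1) : shear φ x = x := by
  rw [shear, if_neg h.not_gt]

theorem shear_shear {φ ψ : ℝ → ℝ} (h : ∀ t, φ t + ψ (t + φ t) = 0) (x : ℝ × ℝ × ℝ) :
    shear ψ (shear φ x) = x := by
  rcases lt_or_ge (Real.exp x.1) Real.pi with hx | hx
  · have e1 : (shear φ x).1 = x.1 := rfl
    have e2 : (shear φ x).2.1 = x.2.1 := rfl
    have e3 : (shear φ x).2.2 = x.2.2 -
        2 * Real.exp (x.2.1 / 2) * φ (logTrace x) / Real.sin (Real.exp x.1) := if_pos hx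
    rw [shear, logTrace_shear_of_lt φ hx, e1, e2, e3, if_pos hx,
      eq_neg_of_add_eq_zero_right (h (logTrace x))]
    refine Prod.ext rfl (Prod.ext rfl ?_)
    ring
  · rw [shear_of_le φ hx, shear_of_le ψ hx]

theorem deriv_expNegInvGlue_nonneg (x : ℝ) : 0 ≤ deriv expNegInvGlue x :=
  expNegInvGlue.monotone.deriv_nonneg

theorem hasDerivAt_expNegInvGlue (x : ℝ) :
    HasDerivAt expNegInvGlue (deriv expNegInvGlue x) x :=
  ((expNegInvGlue.contDiff (n := 1)).differentiable (by simp) x).hasDerivAt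

/-- Take φ(t) = 2 g(t + 1) / g(1) with g the smooth function `expNegInvGlue`. It is nondecreasing,
so t + φ(t) is a diffeomorphism of the line, and ψ is the inverse minus the identity. The
normalization φ(0) = 2 moves trace 0 to trace 2. -/
theorem exists_trace_shift : ∃ φ ψ : ℝ → ℝ, ContDiff ℝ ∞ φ ∧ ContDiff ℝ ∞ ψ ∧
    (∀ t ≤ -1, φ t = 0) ∧ (∀ t ≤ -1, ψ t = 0) ∧ (∀ t, φ t + ψ (t + φ t) = 0) ∧
    (∀ t, ψ t + φ (t + ψ t) = 0) ∧ φ 0 = 2 := by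
  have h1 : 0 < expNegInvGlue 1 := expNegInvGlue.pos_of_pos one_pos
  let φ : ℝ → ℝ := fun t => 2 * expNegInvGlue (t + 1) / expNegInvGlue 1
  have hφ : ContDiff ℝ ∞ φ :=
    (contDiff_const.mul (expNegInvGlue.contDiff.comp (contDiff_id.add contDiff_const))).div_const _
  have hφ0 : ∀ t ≤ -1, φ t = 0 := fun t ht => by
    simp only [φ, expNegInvGlue.zero_of_nonpos (show t + 1 ≤ 0 by linarith), mul_zero, zero_div]
  have hpos : ∀ t, 0 ≤ φ t := fun t =>
    div_nonneg (mul_nonneg zero_le_two (expNegInvGlue.nonneg _)) h1.le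
  have hd : ∀ t, HasDerivAt (fun t => t + φ t)
      (1 + 2 * deriv expNegInvGlue (t + 1) / expNegInvGlue 1) t := fun t =>
    (hasDerivAt_id t).add
      ((((hasDerivAt_expNegInvGlue (t + 1)).comp_add_const t 1).const_mul 2).div_const _)
  have hs : ∀ r, ∃ t, t + φ t = r := fun r => by
    refine mem_range_of_exists_le_of_exists_ge (continuous_id.add hφ.continuous)
      ⟨min r (-1), ?_⟩ ⟨r, ?_⟩
    · change min r (-1) + φ (min r (-1)) ≤ r
      rw [hφ0 _ (min_le_right _ _), add_zero]
      exact min_le_left _ _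
    · change r ≤ r + φ r
      linarith [hpos r]
  -- The parameter space is a dummy; only its point 0 is used.
  obtain ⟨g, hg, hfg, hgf⟩ := exists_contDiff_fibre_inverse (P := ℝ)
    (f := fun x => x.2 + φ x.2) (contDiff_snd.add (hφ.comp contDiff_snd)) (fun _ t => hd t)
    (fun _ t => add_pos_of_pos_of_nonneg one_pos (div_nonneg
      (mul_nonneg zero_le_two (deriv_expNegInvGlue_nonneg _)) h1.le)) (fun _ r => hs r)
  have e1 : ∀ t, g (0, t + φ t) = t := hgf 0
  have e2 : ∀ t, g (0, t) + φ (g (0, t)) = t := hfg 0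
  refine ⟨φ, fun t => g (0, t) - t, hφ, (hg.comp (contDiff_const.prodMk contDiff_id)).sub contDiff_id,
    hφ0, fun t ht => ?_, fun t => ?_, fun t => ?_, ?_⟩
  · have := e1 t
    rw [hφ0 t ht, add_zero] at this
    exact sub_eq_zero.2 this
  · beta_reduce
    rw [e1]
    ring
  · beta_reduce
    rw [add_sub_cancel]
    linarith [e2 t]
  · simp only [φ, zero_add]
    exact mul_div_cancel_right₀ _ h1.ne'

/-! ### Polar coordinates -/

/-- The first coordinate of `P`, rotated by `θ`. -/
def rotFst (P : ℝ × ℝ) (θ : ℝ) : ℝ := P.1 * Real.cos θ - P.2 * Real.sin θ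

/-- The second coordinate of `P`, rotated by `θ`. -/
def rotSnd (P : ℝ × ℝ) (θ : ℝ) : ℝ := P.2 * Real.cos θ + P.1 * Real.sin θ

/-- The angular coordinate on `G`, as a function of the total argument `θ` and of the symmetric
traceless part `P`. -/
def polarAngle (P : ℝ × ℝ) (θ : ℝ) : ℝ :=
  θ - Real.arctan (rotSnd P θ / √(1 + rotFst P θ ^ 2))

theorem rotFst_sq_add_rotSnd_sq (P : ℝ × ℝ) (θ : ℝ) :
    rotFst P θ ^ 2 + rotSnd P θ ^ 2 = P.1 ^ 2 + P.2 ^ 2 := by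
  simp only [rotFst, rotSnd]
  linear_combination (P.1 ^ 2 + P.2 ^ 2) * Real.sin_sq_add_cos_sq θ

theorem contDiff_rotFst : ContDiff ℝ ∞ fun x : (ℝ × ℝ) × ℝ => rotFst x.1 x.2 := by
  simp only [rotFst]
  fun_prop

theorem contDiff_rotSnd : ContDiff ℝ ∞ fun x : (ℝ × ℝ) × ℝ => rotSnd x.1 x.2 := by
  simp only [rotSnd]
  fun_prop

theorem sqrt_one_add_sq_pos (u : ℝ) : 0 < √(1 + u ^ 2) := Real.sqrt_pos.2 (by positivity)

theorem contDiff_polarAngle : ContDiff ℝ ∞ fun x : (ℝ × ℝ) × ℝ => polarAngle x.1 x.2 :=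
  contDiff_snd.sub ((contDiff_rotSnd.div ((contDiff_const.add (contDiff_rotFst.pow 2)).sqrt
    fun x => (show 0 < 1 + rotFst x.1 x.2 ^ 2 by positivity).ne') fun x =>
      (sqrt_one_add_sq_pos _).ne').arctan)

/-- For the rotated point (u, v) one has u' = -v and v' = u; with c = √(1 + u²) the derivative of
arctan(v/c) simplifies to u/c. It is less than 1, so the angle increases with θ for fixed P. -/
theorem hasDerivAt_polarAngle (P : ℝ × ℝ) (θ : ℝ) :
    HasDerivAt (polarAngle P) (1 - rotFst P θ / √(1 + rotFst P θ ^ 2)) θ := by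
  have hu : HasDerivAt (rotFst P) (-rotSnd P θ) θ := by
    refine (((Real.hasDerivAt_cos θ).const_mul P.1).sub
      ((Real.hasDerivAt_sin θ).const_mul P.2)).congr_deriv ?_
    rw [rotSnd]
    ring
  have hv : HasDerivAt (rotSnd P) (rotFst P θ) θ := by
    refine (((Real.hasDerivAt_cos θ).const_mul P.2).add
      ((Real.hasDerivAt_sin θ).const_mul P.1)).congr_deriv ?_
    rw [rotFst]
    ring
  have hc0 := sqrt_one_add_sq_pos (rotFst P θ)
  have hc := ((hu.pow 2).const_add 1).sqrt
    (show (1 + rotFst P θ ^ 2 : ℝ) ≠ 0 by positivity)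
  refine ((hasDerivAt_id θ).sub ((hv.div hc hc0.ne').arctan)).congr_deriv ?_
  simp only [Pi.pow_apply, Pi.div_apply]
  generalize √(1 + rotFst P θ ^ 2) = c at *
  have h2 : 0 < c ^ 2 + rotSnd P θ ^ 2 := by positivity
  field_simp
  ring

theorem rotFst_div_lt_one (P : ℝ × ℝ) (θ : ℝ) : rotFst P θ / √(1 + rotFst P θ ^ 2) < 1 := by
  rw [div_lt_one (sqrt_one_add_sq_pos _)]
  exact Real.lt_sqrt_of_sq_lt (by linarith)

theorem abs_sub_polarAngle (P : ℝ × ℝ) (θ : ℝ) :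
    θ - Real.pi / 2 < polarAngle P θ ∧ polarAngle P θ < θ + Real.pi / 2 := by
  rw [polarAngle]
  constructor
  · linarith [Real.arctan_lt_pi_div_two (rotSnd P θ / √(1 + rotFst P θ ^ 2))]
  · linarith [Real.neg_pi_div_two_lt_arctan (rotSnd P θ / √(1 + rotFst P θ ^ 2))]

/-- With (u, v) the rotated point and c = √(1 + u²), the vector (c, v) has length √(1 + |P|²) and
argument arctan(v/c); this is the formula for the cosine of a difference. -/
theorem sqrt_mul_cos_polarAngle (P : ℝ × ℝ) (θ : ℝ) :
    √(1 + P.1 ^ 2 + P.2 ^ 2) * Real.cos (polarAngle P θ) =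
      √(1 + rotFst P θ ^ 2) * Real.cos θ + rotSnd P θ * Real.sin θ := by
  have hc := sqrt_one_add_sq_pos (rotFst P θ)
  have hc2 : √(1 + rotFst P θ ^ 2) ^ 2 = 1 + rotFst P θ ^ 2 := Real.sq_sqrt (by positivity)
  have e : √(1 + P.1 ^ 2 + P.2 ^ 2) = √(1 + rotFst P θ ^ 2) *
      √(1 + (rotSnd P θ / √(1 + rotFst P θ ^ 2)) ^ 2) := by
    rw [← Real.sqrt_mul (by positivity)]
    congr 1
    rw [div_pow, hc2, add_assoc, ← rotFst_sq_add_rotSnd_sq P θ]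
    field_simp
    ring
  have h1 := sqrt_one_add_sq_pos (rotSnd P θ / √(1 + rotFst P θ ^ 2))
  rw [e, polarAngle, Real.cos_sub, Real.cos_arctan, Real.sin_arctan]
  generalize √(1 + (rotSnd P θ / √(1 + rotFst P θ ^ 2)) ^ 2) = d at *
  field_simp

/-! ### The height function -/

/-- An increasing function which is the identity on `[π, ∞)` and which maps `π / 2` to `0`. -/
def flatten (z : ℝ) : ℝ :=
  z - Real.pi / 2 * (expNegInvGlue (Real.pi - z) / expNegInvGlue (Real.pi / 2))

theorem contDiff_flatten : ContDiff ℝ ∞ flatten :=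
  contDiff_id.sub (contDiff_const.mul
    ((expNegInvGlue.contDiff.comp (contDiff_const.sub contDiff_id)).div_const _))

theorem glue_pos : 0 < expNegInvGlue (Real.pi / 2) := expNegInvGlue.pos_of_pos (by positivity)

theorem exists_hasDerivAt_flatten (z : ℝ) : ∃ d, 0 < d ∧ HasDerivAt flatten d z := by
  have h1 := (hasDerivAt_expNegInvGlue (Real.pi - z)).comp_const_sub Real.pi z
  refine ⟨_, ?_, (hasDerivAt_id z).sub ((h1.div_const _).const_mul (Real.pi / 2))⟩
  have h2 := div_nonneg (deriv_expNegInvGlue_nonneg (Real.pi - z)) glue_pos.le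
  have h3 := mul_nonneg (show 0 ≤ Real.pi / 2 by positivity) h2
  rw [neg_div, mul_neg]
  linarith

theorem flatten_strictMono : StrictMono flatten := by
  choose d h1 h2 using exists_hasDerivAt_flatten
  exact strictMono_of_hasDerivAt_pos h2 h1

theorem flatten_pi_div_two : flatten (Real.pi / 2) = 0 := by
  rw [flatten, sub_half, div_self glue_pos.ne', mul_one, sub_self]

theorem flatten_of_le {z : ℝ} (h : Real.pi ≤ z) : flatten z = z := by
  rw [flatten, expNegInvGlue.zero_of_nonpos (sub_nonpos.2 h), zero_div, mul_zero, sub_zero]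

theorem flatten_le (z : ℝ) : flatten z ≤ z :=
  sub_le_self _ (mul_nonneg (by positivity) (div_nonneg (expNegInvGlue.nonneg _) glue_pos.le))

/-- The vertical coordinate of the model, as a function of the symmetric traceless part `P` and
of the logarithm `τ` of the total argument. -/
def height (P : ℝ × ℝ) (τ : ℝ) : ℝ := flatten (polarAngle P (Real.exp τ)) -
  expNegInvGlue (Real.pi / 2 - polarAngle P (Real.exp τ)) * Real.exp (-τ)

theorem height_le (P : ℝ × ℝ) (τ : ℝ) : height P τ ≤ flatten (polarAngle P (Real.exp τ)) :=
  sub_le_self _ (mul_nonneg (expNegInvGlue.nonneg _) (Real.exp_pos _).le)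

theorem height_of_le {P : ℝ × ℝ} {τ : ℝ} (h : Real.pi / 2 ≤ polarAngle P (Real.exp τ)) :
    height P τ = flatten (polarAngle P (Real.exp τ)) := by
  rw [height, expNegInvGlue.zero_of_nonpos (sub_nonpos.2 h), zero_mul, sub_zero]

theorem contDiff_height : ContDiff ℝ ∞ fun x : (ℝ × ℝ) × ℝ => height x.1 x.2 := by
  have h : ContDiff ℝ ∞ fun x : (ℝ × ℝ) × ℝ => polarAngle x.1 (Real.exp x.2) :=
    contDiff_polarAngle.comp (contDiff_fst.prodMk contDiff_snd.exp)
  exact (contDiff_flatten.comp h).sub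
    ((expNegInvGlue.contDiff.comp (contDiff_const.sub h)).mul contDiff_snd.neg.exp)

/-- The angle increases with τ, so `flatten` of it increases, while the cutoff factor does not
increase and exp(-τ) decreases; both corrections have the favourable sign. -/
theorem exists_hasDerivAt_height (P : ℝ × ℝ) (τ : ℝ) : ∃ d, 0 < d ∧ HasDerivAt (height P) d τ := by
  obtain ⟨d, hd, hf⟩ := exists_hasDerivAt_flatten (polarAngle P (Real.exp τ))
  have hz : HasDerivAt (fun τ => polarAngle P (Real.exp τ)) _ τ :=
    (hasDerivAt_polarAngle P (Real.exp τ)).comp τ (Real.hasDerivAt_exp τ)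
  have hz0 : 0 < (1 - rotFst P (Real.exp τ) / √(1 + rotFst P (Real.exp τ) ^ 2)) * Real.exp τ :=
    mul_pos (sub_pos.2 (rotFst_div_lt_one _ _)) (Real.exp_pos _)
  have hg := (hasDerivAt_expNegInvGlue (Real.pi / 2 - polarAngle P (Real.exp τ))).comp τ
    (hz.const_sub (Real.pi / 2))
  have he := (hasDerivAt_neg τ).exp
  have hf' : HasDerivAt (flatten ∘ fun τ => polarAngle P (Real.exp τ)) _ τ :=
    HasDerivAt.comp (h₂ := flatten) τ hf hz
  refine ⟨_, ?_, hf'.sub (hg.mul he)⟩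
  have h1 := mul_pos hd hz0
  have h2 := mul_nonneg (mul_nonneg
    (deriv_expNegInvGlue_nonneg (Real.pi / 2 - polarAngle P (Real.exp τ))) hz0.le)
    (Real.exp_pos (-τ)).le
  have h3 := mul_nonneg (expNegInvGlue.nonneg (Real.pi / 2 - polarAngle P (Real.exp τ)))
    (Real.exp_pos (-τ)).le
  simp only [Function.comp_apply]
  linarith

/-- As θ tends to 0 the angle tends to `polarAngle P 0` < π/2, where the cutoff is positive, so the
term with exp(-τ) drives the height to -∞. This stretches the half-line θ > 0 to the whole line
while changing nothing at angles from π/2 on. -/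
theorem exists_height_eq (P : ℝ × ℝ) (r : ℝ) : ∃ τ, height P τ = r := by
  have hpi := Real.pi_pos
  refine mem_range_of_exists_le_of_exists_ge
    (contDiff_height.continuous.comp (continuous_const.prodMk continuous_id)) ?_ ?_
  · have hz : Filter.Tendsto (fun τ => polarAngle P (Real.exp τ)) Filter.atBot
        (nhds (polarAngle P 0)) := by
      have h1 : Continuous (polarAngle P) :=
        contDiff_polarAngle.continuous.comp (continuous_const.prodMk continuous_id)
      exact (h1.tendsto 0).comp Real.tendsto_exp_atBot
    have h2 := (expNegInvGlue.contDiff (n := 0)).continuous.tendsto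
      (Real.pi / 2 - polarAngle P 0) |>.comp (hz.const_sub (Real.pi / 2))
    have h3 : Filter.Tendsto (fun τ : ℝ => Real.exp (-τ)) Filter.atBot Filter.atTop :=
      Real.tendsto_exp_atTop.comp Filter.tendsto_neg_atBot_atTop
    have h4 := h2.pos_mul_atTop (expNegInvGlue.pos_of_pos (by
      linarith [(abs_sub_polarAngle P 0).2])) h3
    have h5 := (contDiff_flatten.continuous.tendsto _).comp hz
    have h6 : Filter.Tendsto (height P) Filter.atBot Filter.atBot :=
      h5.add_atBot (Filter.tendsto_neg_atTop_atBot.comp h4)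
    exact (h6.eventually (Filter.eventually_le_atBot r)).exists
  -- The angle differs from θ by less than π/2, so it exceeds both π and r here, and the height
  -- equals the angle.
  · refine ⟨Real.log (|r| + 2 * Real.pi), ?_⟩
    have h1 := (abs_sub_polarAngle P (|r| + 2 * Real.pi)).1
    have h2 : 0 < |r| + 2 * Real.pi := by positivity
    have h3 : Real.pi ≤ polarAngle P (|r| + 2 * Real.pi) := by linarith [abs_nonneg r]
    rw [height_of_le (by rw [Real.exp_log h2]; linarith), Real.exp_log h2, flatten_of_le h3]
    linarith [le_abs_self r]

/-! ### The plane and the cones -/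

theorem height_eq_zero_iff (P : ℝ × ℝ) (τ : ℝ) :
    height P τ = 0 ↔ polarAngle P (Real.exp τ) = Real.pi / 2 := by
  rcases lt_or_ge (polarAngle P (Real.exp τ)) (Real.pi / 2) with h | h
  · have h1 := flatten_strictMono h
    rw [flatten_pi_div_two] at h1
    exact ⟨fun h2 => absurd h2 ((height_le P τ).trans_lt h1).ne, fun h2 => absurd h2 h.ne⟩
  · rw [height_of_le h, ← flatten_pi_div_two]
    exact flatten_strictMono.injective.eq_iff

theorem mem_planeAndCones_iff (x y z : ℝ) : (x, y, z) ∈ planeAndCones ↔ z = 0 ∨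
    ∃ n : ℕ, 0 < n ∧ x ^ 2 + y ^ 2 = Real.tan z ^ 2 ∧ 2 * Real.pi * n - Real.pi / 2 < z ∧
      z < 2 * Real.pi * n + Real.pi / 2 := by
  simp only [planeAndCones, mem_union, mem_iUnion, exists_prop]
  rfl

theorem cone_lower_bound {n : ℕ} (hn : 0 < n) {z : ℝ} (h : 2 * Real.pi * n - Real.pi / 2 < z) :
    3 * Real.pi / 2 < z := by
  have h1 : (1 : ℝ) ≤ n := by exact_mod_cast hn
  nlinarith [Real.pi_pos]

/-- For 0 < θ < π the angle lies between -π/2 and 3π/2. The cones with n > 0 lie above 3π/2 and are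
not reached, and the only zero of the cosine in this range is π/2, which the height sends to 0. -/
theorem mem_planeAndCones_of_lt {P : ℝ × ℝ} {τ : ℝ} (h : Real.exp τ < Real.pi) :
    (P.1, P.2, height P τ) ∈ planeAndCones ↔ Real.cos (polarAngle P (Real.exp τ)) = 0 := by
  have hpi := Real.pi_pos
  have h0 := Real.exp_pos τ
  obtain ⟨h1, h2⟩ := abs_sub_polarAngle P (Real.exp τ)
  have h3 : ¬ ∃ n : ℕ, 0 < n ∧ P.1 ^ 2 + P.2 ^ 2 = Real.tan (height P τ) ^ 2 ∧
      2 * Real.pi * n - Real.pi / 2 < height P τ ∧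
      height P τ < 2 * Real.pi * n + Real.pi / 2 := by
    rintro ⟨n, hn, -, h4, -⟩
    have h5 := cone_lower_bound hn h4
    linarith [height_le P τ, flatten_le (polarAngle P (Real.exp τ))]
  rw [mem_planeAndCones_iff, or_iff_left h3, height_eq_zero_iff]
  constructor
  · intro h4
    rw [h4, Real.cos_pi_div_two]
  · intro h4
    obtain ⟨k, hk⟩ := Real.cos_eq_zero_iff.1 h4
    have k1 : (-1 : ℝ) < k := by nlinarith
    have k2 : (k : ℝ) < 1 := by nlinarith
    have k3 : -1 < k := by exact_mod_cast k1
    have k4 : k < 1 := by exact_mod_cast k2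
    obtain rfl : k = 0 := by omega
    rw [hk]
    push_cast
    ring

theorem exists_int_of_cos_pos {z : ℝ} (h : 0 < Real.cos z) :
    ∃ n : ℤ, 2 * Real.pi * n - Real.pi / 2 < z ∧ z < 2 * Real.pi * n + Real.pi / 2 := by
  have hpi := Real.pi_pos
  have h1 := Int.floor_le ((z + Real.pi) / (2 * Real.pi))
  have h2 := Int.lt_floor_add_one ((z + Real.pi) / (2 * Real.pi))
  set n := ⌊(z + Real.pi) / (2 * Real.pi)⌋
  rw [le_div_iff₀ (by positivity)] at h1
  rw [div_lt_iff₀ (by positivity)] at h2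
  have hc : 0 < Real.cos (z - n * (2 * Real.pi)) := by rwa [Real.cos_sub_int_mul_two_pi]
  refine ⟨n, ?_, ?_⟩ <;> by_contra hcon <;> push Not at hcon
  · rw [← Real.cos_neg] at hc
    exact hc.not_ge (Real.cos_nonpos_of_pi_div_two_le_of_le (by linarith) (by linarith))
  · exact hc.not_ge (Real.cos_nonpos_of_pi_div_two_le_of_le (by linarith) (by linarith))

/-- For θ ≥ π the angle z exceeds π/2, so the plane is not met, and cos z > 0 forces z into the
interval around 2πn for some n > 0, where `flatten` is the identity. There √(1 + |P|²) cos z = 1 is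
equivalent to |P|² = tan² z. -/
theorem mem_planeAndCones_of_ge {P : ℝ × ℝ} {τ : ℝ} (h : Real.pi ≤ Real.exp τ) :
    (P.1, P.2, height P τ) ∈ planeAndCones ↔
      √(1 + P.1 ^ 2 + P.2 ^ 2) * Real.cos (polarAngle P (Real.exp τ)) = 1 := by
  have hpi := Real.pi_pos
  have h1 : Real.pi / 2 < polarAngle P (Real.exp τ) := by
    linarith [(abs_sub_polarAngle P (Real.exp τ)).1]
  have h2 : 0 < flatten (polarAngle P (Real.exp τ)) := by
    rw [← flatten_pi_div_two]
    exact flatten_strictMono h1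
  rw [mem_planeAndCones_iff, height_of_le h1.le, or_iff_right h2.ne']
  generalize polarAngle P (Real.exp τ) = z at *
  have hN : √(1 + P.1 ^ 2 + P.2 ^ 2) ^ 2 = 1 + P.1 ^ 2 + P.2 ^ 2 := Real.sq_sqrt (by positivity)
  have hN0 : 0 < √(1 + P.1 ^ 2 + P.2 ^ 2) := Real.sqrt_pos.2 (by positivity)
  have hsc := Real.sin_sq_add_cos_sq z
  constructor
  · rintro ⟨n, hn, h3, h4, h5⟩
    have h6 := cone_lower_bound hn h4
    have h7 : flatten z = z := flatten_of_le (by linarith [flatten_le z])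
    rw [h7] at h3 h4 h5
    have hc : 0 < Real.cos z := by
      rw [← Real.cos_sub_nat_mul_two_pi z n]
      exact Real.cos_pos_of_mem_Ioo ⟨by linarith, by linarith⟩
    rw [Real.tan_eq_sin_div_cos, div_pow, eq_div_iff (by positivity)] at h3
    have h8 : (√(1 + P.1 ^ 2 + P.2 ^ 2) * Real.cos z) ^ 2 = 1 := by
      rw [mul_pow, hN]
      linarith
    exact (pow_eq_one_iff_of_nonneg (mul_pos hN0 hc).le two_ne_zero).1 h8
  · intro h3
    have hc : 0 < Real.cos z := pos_of_mul_pos_right (by rw [h3]; exact one_pos) hN0.le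
    obtain ⟨n, h4, h5⟩ := exists_int_of_cos_pos hc
    have hn : 0 < n := by
      have h6 : (0 : ℝ) < n := by nlinarith
      exact_mod_cast h6
    lift n to ℕ using hn.le
    have hn' : 0 < n := by exact_mod_cast hn
    have h4' : 2 * Real.pi * n - Real.pi / 2 < z := by exact_mod_cast h4
    have h5' : z < 2 * Real.pi * n + Real.pi / 2 := by exact_mod_cast h5
    have h6 := cone_lower_bound hn' h4'
    have h7 : flatten z = z := flatten_of_le (by linarith)
    refine ⟨n, hn', ?_, by rwa [h7], by rwa [h7]⟩
    rw [h7, Real.tan_eq_sin_div_cos, div_pow, eq_div_iff (by positivity)]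
    have h8 : (√(1 + P.1 ^ 2 + P.2 ^ 2) * Real.cos z) ^ 2 = 1 := by rw [h3, one_pow]
    rw [mul_pow, hN] at h8
    linarith

/-! ### The model -/

/-- Logarithmic coordinates in terms of the symmetric traceless part and of the logarithm of the
total argument. -/
def ofSymmetric (x : (ℝ × ℝ) × ℝ) : ℝ × ℝ × ℝ :=
  (x.2, 2 * Real.arsinh (rotFst x.1 (Real.exp x.2)),
    -(4 * Real.exp (Real.arsinh (rotFst x.1 (Real.exp x.2))) * rotSnd x.1 (Real.exp x.2)))

/-- The inverse of `ofSymmetric`. -/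
def toSymmetric (x : ℝ × ℝ × ℝ) : (ℝ × ℝ) × ℝ :=
  ((rotFst (Real.sinh (x.2.1 / 2), -(Real.exp (-(x.2.1 / 2)) * x.2.2 / 4)) (-Real.exp x.1),
    rotSnd (Real.sinh (x.2.1 / 2), -(Real.exp (-(x.2.1 / 2)) * x.2.2 / 4)) (-Real.exp x.1)), x.1)

theorem rotFst_rot (P : ℝ × ℝ) (θ ξ : ℝ) :
    rotFst (rotFst P θ, rotSnd P θ) ξ = rotFst P (θ + ξ) := by
  simp only [rotFst, rotSnd, Real.cos_add, Real.sin_add]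
  ring

theorem rotSnd_rot (P : ℝ × ℝ) (θ ξ : ℝ) :
    rotSnd (rotFst P θ, rotSnd P θ) ξ = rotSnd P (θ + ξ) := by
  simp only [rotFst, rotSnd, Real.cos_add, Real.sin_add]
  ring

theorem rotFst_zero (P : ℝ × ℝ) : rotFst P 0 = P.1 := by simp [rotFst]

theorem rotSnd_zero (P : ℝ × ℝ) : rotSnd P 0 = P.2 := by simp [rotSnd]

theorem toSymmetric_ofSymmetric (x : (ℝ × ℝ) × ℝ) : toSymmetric (ofSymmetric x) = x := by
  have e : -(Real.exp (-Real.arsinh (rotFst x.1 (Real.exp x.2))) *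
      -(4 * Real.exp (Real.arsinh (rotFst x.1 (Real.exp x.2))) * rotSnd x.1 (Real.exp x.2)) / 4) =
      rotSnd x.1 (Real.exp x.2) := by
    rw [Real.exp_neg]
    field_simp
  simp only [toSymmetric, ofSymmetric, mul_div_cancel_left₀ _ (two_ne_zero (α := ℝ)),
    Real.sinh_arsinh, e, rotFst_rot, rotSnd_rot, add_neg_cancel, rotFst_zero, rotSnd_zero]

theorem ofSymmetric_toSymmetric (x : ℝ × ℝ × ℝ) : ofSymmetric (toSymmetric x) = x := by
  simp only [toSymmetric, ofSymmetric, rotFst_rot, rotSnd_rot, neg_add_cancel, rotFst_zero,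
    rotSnd_zero, Real.arsinh_sinh]
  refine Prod.ext rfl (Prod.ext ?_ ?_)
  · change 2 * (x.2.1 / 2) = x.2.1
    ring
  · change -(4 * Real.exp (x.2.1 / 2) * -(Real.exp (-(x.2.1 / 2)) * x.2.2 / 4)) = x.2.2
    rw [Real.exp_neg]
    field_simp

theorem contDiff_ofSymmetric : ContDiff ℝ ∞ ofSymmetric := by
  have hg : ContDiff ℝ ∞ fun x : (ℝ × ℝ) × ℝ => (x.1, Real.exp x.2) :=
    contDiff_fst.prodMk contDiff_snd.exp
  have h1 : ContDiff ℝ ∞ fun x : (ℝ × ℝ) × ℝ => rotFst x.1 (Real.exp x.2) :=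
    contDiff_rotFst.comp hg
  have h2 : ContDiff ℝ ∞ fun x : (ℝ × ℝ) × ℝ => rotSnd x.1 (Real.exp x.2) :=
    contDiff_rotSnd.comp hg
  exact contDiff_snd.prodMk ((contDiff_const.mul h1.arsinh).prodMk
    ((contDiff_const.mul h1.arsinh.exp).mul h2).neg)

theorem contDiff_toSymmetric : ContDiff ℝ ∞ toSymmetric := by
  have hs : ContDiff ℝ ∞ fun x : ℝ × ℝ × ℝ => Real.sinh (x.2.1 / 2) :=
    Real.contDiff_sinh.comp (by fun_prop)
  have hg : ContDiff ℝ ∞ fun x : ℝ × ℝ × ℝ =>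
      ((Real.sinh (x.2.1 / 2), -(Real.exp (-(x.2.1 / 2)) * x.2.2 / 4)), -Real.exp x.1) :=
    (hs.prodMk (by fun_prop)).prodMk (by fun_prop)
  exact ((contDiff_rotFst.comp hg).prodMk (contDiff_rotSnd.comp hg)).prodMk contDiff_fst

/-- With u = sinh(a/2) and v = -exp(-a/2) b/4 the trace is 2(√(1 + u²) cos θ + v sin θ), and P is
(u, v) rotated by -θ. -/
theorem logTrace_ofSymmetric (P : ℝ × ℝ) (τ : ℝ) : logTrace (ofSymmetric (P, τ)) =
    2 * (√(1 + P.1 ^ 2 + P.2 ^ 2) * Real.cos (polarAngle P (Real.exp τ))) := by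
  rw [sqrt_mul_cos_polarAngle]
  simp only [logTrace, ofSymmetric, mul_div_cancel_left₀ _ (two_ne_zero (α := ℝ)),
    Real.cosh_arsinh, Real.exp_neg]
  field_simp
  ring

/-- The height replaces log θ as a coordinate for fixed P, and the shear turns trace 0 into trace 2
in the region θ < π while fixing the region θ ≥ π. -/
theorem exists_model : ∃ D D' : ℝ × ℝ × ℝ → ℝ × ℝ × ℝ, ContDiff ℝ ∞ D ∧ ContDiff ℝ ∞ D' ∧
    (∀ x, D' (D x) = x) ∧ (∀ x, D (D' x) = x) ∧
    ∀ x, logTrace (D x) = 2 ↔ x ∈ planeAndCones := by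
  obtain ⟨φ, ψ, hφ, hψ, φ0, ψ0, hφψ, hψφ, h2⟩ := exists_trace_shift
  choose d d0 hd using exists_hasDerivAt_height
  obtain ⟨g, hg, hfg, hgf⟩ := exists_contDiff_fibre_inverse contDiff_height hd d0 exists_height_eq
  let N : ℝ × ℝ × ℝ → (ℝ × ℝ) × ℝ := fun x => ((x.1, x.2.1), g ((x.1, x.2.1), x.2.2))
  let N' : (ℝ × ℝ) × ℝ → ℝ × ℝ × ℝ := fun x => (x.1.1, x.1.2, height x.1 x.2)
  have hN : ContDiff ℝ ∞ N := by
    have h1 : ContDiff ℝ ∞ fun x : ℝ × ℝ × ℝ => ((x.1, x.2.1), x.2.2) := by fun_prop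
    exact (contDiff_fst.comp h1).prodMk (hg.comp h1)
  have hN' : ContDiff ℝ ∞ N' :=
    (contDiff_fst.comp contDiff_fst).prodMk
      ((contDiff_snd.comp contDiff_fst).prodMk contDiff_height)
  have hNN : ∀ x, N' (N x) = x := fun x => Prod.ext rfl (Prod.ext rfl (hfg (x.1, x.2.1) x.2.2))
  have hNN' : ∀ x, N (N' x) = x := fun x => Prod.ext rfl (hgf x.1 x.2)
  refine ⟨fun x => shear φ (ofSymmetric (N x)), fun x => N' (toSymmetric (shear ψ x)),
    (contDiff_shear hφ φ0).comp (contDiff_ofSymmetric.comp hN),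
    hN'.comp (contDiff_toSymmetric.comp (contDiff_shear hψ ψ0)), fun x => ?_, fun x => ?_,
    fun x => ?_⟩
  · beta_reduce
    rw [shear_shear hφψ, toSymmetric_ofSymmetric, hNN]
  · beta_reduce
    rw [hNN', ofSymmetric_toSymmetric, shear_shear hψφ]
  · obtain ⟨⟨P, τ⟩, rfl⟩ : ∃ y, x = N' y := ⟨N x, (hNN x).symm⟩
    beta_reduce
    rw [hNN']
    change _ ↔ (P.1, P.2, height P τ) ∈ planeAndCones
    rcases lt_or_ge (Real.exp τ) Real.pi with h | h
    -- ψ recovers t from t + φ(t), so 0 is the only trace moved to 2.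
    · have hinj : ∀ t, t + φ t = 2 ↔ t = 0 := fun t => by
        constructor
        · intro ht
          have e1 := hφψ t
          have e2 := hφψ 0
          rw [zero_add, h2] at e2
          rw [ht] at e1
          linarith
        · rintro rfl
          rw [h2, zero_add]
      rw [logTrace_shear_of_lt φ (x := ofSymmetric (P, τ)) h, hinj, mem_planeAndCones_of_lt h,
        logTrace_ofSymmetric, mul_eq_zero, mul_eq_zero]
      have hN0 : √(1 + P.1 ^ 2 + P.2 ^ 2) ≠ 0 := (Real.sqrt_pos.2 (by positivity)).ne'
      simp [hN0]
    · rw [shear_of_le φ (x := ofSymmetric (P, τ)) h, mem_planeAndCones_of_ge h,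
        logTrace_ofSymmetric]
      constructor <;> intro h3 <;> linarith

theorem exists_model_diffeomorph (m : ℕ) {ℍ : Type*} [NormedAddCommGroup ℍ]
    [InnerProductSpace ℝ ℍ] [CompleteSpace ℍ] [TopologicalSpace.SeparableSpace ℍ]
    (hℍ : ¬ FiniteDimensional ℝ ℍ) :
    ∃ Θ : ((ℝ × ℝ × ℝ) × ℍ) ≃ₘ⟮𝓘(ℝ, (ℝ × ℝ × ℝ) × ℍ), 𝓘(ℝ, sobolevCircle (m + 1))⟯
        sobolevCircle (m + 1),
      Θ '' (planeAndCones ×ˢ univ) = kernelStratum (m + 1) 1 := by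
  obtain ⟨T, hT⟩ := exists_monodromy_diffeomorph m hℍ
  obtain ⟨D, D', hD, hD', hDD, hDD', hp⟩ := exists_model
  let e : ((ℝ × ℝ × ℝ) × ℍ) ≃ₘ⟮𝓘(ℝ, (ℝ × ℝ × ℝ) × ℍ), 𝓘(ℝ, (ℝ × ℝ × ℝ) × ℍ)⟯
      ((ℝ × ℝ × ℝ) × ℍ) :=
    { toFun := fun x => (D x.1, x.2)
      invFun := fun x => (D' x.1, x.2)
      left_inv := fun x => Prod.ext (hDD _) rfl
      right_inv := fun x => Prod.ext (hDD' _) rfl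
      contMDiff_toFun := ((hD.comp contDiff_fst).prodMk contDiff_snd).contMDiff
      contMDiff_invFun := ((hD'.comp contDiff_fst).prodMk contDiff_snd).contMDiff }
  refine ⟨e.trans T, image_eq_of_forall_iff (e.trans T).surjective fun x => ?_⟩
  rw [mem_prod, and_iff_left (mem_univ _), ← hp]
  refine (mem_kernelStratum_one_iff (hT (e x))).trans ?_
  change (proj (ofArgument _ _ _)).1.trace = 2 ↔ _
  rw [trace_ofArgument]
  rfl

end Hill

end

theorem mainTheorem2 (p : ℕ) (hp : 0 < p)
    {ℍ : Type*} [NormedAddCommGroup ℍ] [InnerProductSpace ℝ ℍ] [CompleteSpace ℍ]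
    [TopologicalSpace.SeparableSpace ℍ] (hℍ : ¬ FiniteDimensional ℝ ℍ) :
    (∃ Ψ : (CoverSL2.G₀ × ℍ) ≃ₘ⟮𝓘(ℝ, ℝ × ℝ × ℝ).prod 𝓘(ℝ, ℍ), 𝓘(ℝ, sobolevCircle p)⟯
        sobolevCircle p,
      ∀ (g : CoverSL2.G₀) (h : ℍ), IsMonodromy (Ψ (g, h)) g) ∧
    (∀ Ψ : (CoverSL2.G₀ × ℍ) ≃ₘ⟮𝓘(ℝ, ℝ × ℝ × ℝ).prod 𝓘(ℝ, ℍ), 𝓘(ℝ, sobolevCircle p)⟯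
        sobolevCircle p,
      (∀ (g : CoverSL2.G₀) (h : ℍ), IsMonodromy (Ψ (g, h)) g) →
      Ψ '' Set.univ = kernelStratum p 0 ∧
      Ψ '' {x | (x.1 : CoverSL2) ∈ CoverSL2.traceLevel 2} = kernelStratum p 1 ∧
      Ψ '' {x | (x.1 : CoverSL2) ∈
          (Subgroup.center CoverSL2 : Set CoverSL2) ∩ CoverSL2.traceLevel 2} =
        kernelStratum p 2) ∧
    (∃ Θ : ((ℝ × ℝ × ℝ) × ℍ) ≃ₘ⟮𝓘(ℝ, (ℝ × ℝ × ℝ) × ℍ), 𝓘(ℝ, sobolevCircle p)⟯ sobolevCircle p,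
      Θ '' (planeAndCones ×ˢ Set.univ) = kernelStratum p 1) := by
  -- Positivity of p is what gives potentials continuous representatives.
  obtain ⟨m, rfl⟩ : ∃ m, p = m + 1 := ⟨p - 1, by omega⟩
  refine ⟨Hill.exists_G₀_diffeomorph m hℍ, fun Ψ hΨ => ⟨?_, ?_, ?_⟩,
    Hill.exists_model_diffeomorph m hℍ⟩
  · rw [Set.image_univ, show Set.range Ψ = Set.univ from Ψ.surjective.range_eq]
    refine (Set.eq_univ_of_forall fun q => ?_).symm
    simp [kernelStratum]
  · exact Hill.image_eq_of_forall_iff Ψ.surjective fun x =>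
      Hill.mem_kernelStratum_one_iff (hΨ x.1 x.2)
  · exact Hill.image_eq_of_forall_iff Ψ.surjective fun x =>
      Hill.mem_kernelStratum_two_iff (hΨ x.1 x.2)
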